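/- Work over $\mathbb C$. Let $n\ge 0$ and let $\mathcal C\subset G(2,n)$ be a smooth irreducible quasi-projective curve in the Grassmannian of planes in $\mathbb P^n$, and for $\sigma\in\mathcal C$ let $\mathbb P^2(\sigma)\subset\mathbb P^n$ be the corresponding plane. Let $\mathcal I_{\mathcal C}=\{(Q,\sigma): \sigma\in\mathcal C,\ Q\in\mathbb P^2(\sigma)\}$, with projection $p:\mathcal I_{\mathcal C}\to\mathbb P^n$. A point $Q\in\mathbb P^2(\sigma)$ is a (first order) focal point if the differential $dp:T_{\mathcal I_{\mathcal C},(Q,\sigma)}\to T_{\mathbb P^n,Q}$ is not injective (equivalently, if $\chi(\sigma)(w)(Q)=0$ for some $0\ne w\in T_{\mathcal C,\sigma}$, where $\chi(\sigma)$ is the characteristic map). Suppose that the family is developable, that is, for general $\sigma\in\mathcal C$ the set of focal points in $\mathbb P^2(\sigma)$ is a line. Let $U\subset\mathcal C$ be the set of $\sigma$ for which this set is a line $r(\sigma)$, and let $X=\overline{\bigcup_{\sigma\in U}r(\sigma)}\subset\mathbb P^n$ (the first order focal scheme, realized in $\mathbb P^n$). A point $Q\in r(\sigma)$ is a second order focal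 point if it is focal for the family of lines $\{r(\sigma)\}_{\sigma\in U}$, that is, if the differential at $(Q,\sigma)$ of the projection $\{(Q,\sigma):\sigma\in U,\ Q\in r(\sigma)\}\to\mathbb P^n$ is not injective. Let $D\subset\mathbb P^n$ be the closure of the set of points $P(\sigma)$, where $\sigma$ runs over those elements of $U$ for which $r(\sigma)$ has exactly one second order focal point $P(\sigma)$ (the second order focal scheme, realized in $\mathbb P^n$). Then one of the following holds. 1. $\dim X=1$, the set $X$ is a line, and all planes of $\mathcal C$ contain this line. 2. (a) $\dim X=2$, $\dim D=0$, $D=\{P\}$ is a point, $X$ is an irreducible cone with vertex $P$, and $\mathcal C$ consists of the tangent planes to $X$: for general $\sigma\in\mathcal C$ the plane $\mathbb P^2(\sigma)$ is the tangent plane to $X$ at a smooth point lying on $r(\sigma)$, and at the general point $Q\in X$ the tangent plane is $\mathbb P^2(\sigma)$ for some $\sigma\in U$ with $Q\in r(\sigma)$. (b) $\dim X=2$, $\dim D=1$, $D$ is an irreducible curve, and $\mathcal C$ consists of the osculating planes to $D$: for general $\sigma\in\mathcal C$ the plane $\mathbb P^2(\sigma)$ is the osculating plane to $D$ at the smooth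 point $P(\sigma)$, and the osculating plane at the general point $P\in D$ is $\mathbb P^2(\sigma)$ for some $\sigma\in U$ with $P=P(\sigma)$ the only second order focal point on $r(\sigma)$. -/

import Mathlib

noncomputable section

/-! ### Projective space and Grassmannians over `ℂ` with their Zariski topologies -/

/-- The vector space `ℂ^{n+1}` whose lines are the points of `ℙⁿ`. -/
abbrev Vec (n : ℕ) : Type := Fin (n + 1) → ℂ

/-- The complex projective space `ℙⁿ`. -/
abbrev PSpace (n : ℕ) : Type := Projectivization ℂ (Vec n)

/-- The Grassmannian `G(r, n)` of `r`-dimensional linear subspaces of `ℙⁿ`, that is, of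
`(r+1)`-dimensional vector subspaces of `ℂ^{n+1}`. -/
def Grass (r n : ℕ) : Type := {W : Submodule ℂ (Vec n) // Module.finrank ℂ W = r + 1}

/-- The Zariski topology on the affine space `ℂ^ι`: the closed sets are the zero loci of ideals
of polynomials. (`ℂ^ι` also has its classical topology as an instance, so this is not one.) -/
@[reducible] def zariski (ι : Type) : TopologicalSpace (ι → ℂ) :=
  TopologicalSpace.induced (MvPolynomial.pointToPoint (k := ℂ)) inferInstance

/-- The Zariski topology on `ℙⁿ`: a set is closed iff the cone over it is closed in
`ℂ^{n+1} ∖ {0}`. -/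
instance zariskiPSpace (n : ℕ) : TopologicalSpace (PSpace n) :=
  TopologicalSpace.coinduced (Projectivization.mk' ℂ)
    (TopologicalSpace.induced (Subtype.val : {v : Vec n // v ≠ 0} → Vec n) (zariski _))

/-- A frame: a basis of an `(r+1)`-dimensional subspace of `ℂ^{n+1}`. -/
def Frame (r n : ℕ) : Type := {b : Fin (r + 1) → Vec n // LinearIndependent ℂ b}

/-- The entries of a frame, as a point of an affine space. -/
def Frame.coords {r n : ℕ} (b : Frame r n) : Fin (r + 1) × Fin (n + 1) → ℂ :=
  fun ij => b.1 ij.1 ij.2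

/-- The linear subspace spanned by a frame. -/
def Frame.span {r n : ℕ} (b : Frame r n) : Grass r n :=
  ⟨Submodule.span ℂ (Set.range b.1), by
    rw [finrank_span_eq_card b.2, Fintype.card_fin]⟩

/-- The Zariski topology on `G(r, n)`, as the quotient of the variety of frames (an open subset
of the affine space of matrices) by the general linear group `GL_{r+1}`. -/
instance zariskiGrass (r n : ℕ) : TopologicalSpace (Grass r n) :=
  TopologicalSpace.coinduced (Frame.span : Frame r n → Grass r n)
    (TopologicalSpace.induced Frame.coords (zariski _))

/-- The set of points of `ℙⁿ` that lie in a linear subspace. -/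
def linearPoints {n : ℕ} (L : Submodule ℂ (Vec n)) : Set (PSpace n) :=
  {Q | Q.submodule ≤ L}

/-- `p` holds at the general point of `Z` (an irreducible set, in the applications): on the
intersection of `Z` with an open set that meets `Z`. -/
def General {α : Type} [TopologicalSpace α] (Z : Set α) (p : α → Prop) : Prop :=
  ∃ O : Set α, IsOpen O ∧ (O ∩ Z).Nonempty ∧ ∀ z ∈ O ∩ Z, p z

/-! ### Tangent spaces -/

/-- The Zariski tangent space at `x` of a (locally closed) subset `Z` of an affine space: the
common kernel of the differentials at `x` of all polynomials that vanish on `Z`. -/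
def zariskiTangent {ι : Type} [Fintype ι] (Z : Set (ι → ℂ)) (x : ι → ℂ) :
    Submodule ℂ (ι → ℂ) where
  carrier := {v | ∀ F ∈ MvPolynomial.vanishingIdeal ℂ Z,
    ∑ i, MvPolynomial.eval x (MvPolynomial.pderiv i F) * v i = 0}
  zero_mem' := by intro F _; simp
  add_mem' := by
    intro v w hv hw F hF
    simp only [Pi.add_apply, mul_add, Finset.sum_add_distrib, hv F hF, hw F hF, add_zero]
  smul_mem' := by
    intro c v hv F hF
    have h := hv F hF
    simp only [Pi.smul_apply, smul_eq_mul]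
    calc ∑ i, MvPolynomial.eval x (MvPolynomial.pderiv i F) * (c * v i)
        = c * ∑ i, MvPolynomial.eval x (MvPolynomial.pderiv i F) * v i := by
          rw [Finset.mul_sum]; exact Finset.sum_congr rfl fun i _ => by ring
      _ = 0 := by rw [h, mul_zero]

/-- The affine cone (without its vertex) over a subset of `ℙⁿ`. -/
def affineCone {n : ℕ} (X : Set (PSpace n)) : Set (Vec n) :=
  {v | ∃ hv : v ≠ 0, Projectivization.mk ℂ v hv ∈ X}

/-- The embedded projective tangent space of `X ⊆ ℙⁿ` at `Q`, as a vector subspace of `ℂ^{n+1}`: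
the tangent space of the affine cone at a representative of `Q`. If `X` is an irreducible
variety, `Q` is a smooth point iff this has vector space dimension `dim X + 1`. -/
def embeddedTangent {n : ℕ} (X : Set (PSpace n)) (Q : PSpace n) : Submodule ℂ (Vec n) :=
  zariskiTangent (affineCone X) Q.rep

/-- The set of (coordinates of) frames of members of a family `C ⊆ G(r, n)`. -/
def framesOf {r n : ℕ} (C : Set (Grass r n)) : Set (Fin (r + 1) × Fin (n + 1) → ℂ) :=
  {x | ∃ b : Frame r n, x = b.coords ∧ b.span ∈ C}

/-- The tangent space `T_{C,σ}` at `σ = ⟨b₀, …, b_r⟩`. It lies in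
`T_{G(r,n),σ} = Hom(σ, ℂ^{n+1}/σ)`, and a homomorphism is given here by its values on the
basis `b`. -/
def tangentSpace {r n : ℕ} (C : Set (Grass r n)) (b : Frame r n) :
    Submodule ℂ (Fin (r + 1) → (Vec n ⧸ b.span.1)) :=
  (zariskiTangent (framesOf C) b.coords).map
    (LinearMap.pi fun i => b.span.1.mkQ ∘ₗ LinearMap.funLeft ℂ ℂ fun j => (i, j))

/-- A smooth irreducible quasi-projective curve in `G(r, n)`. -/
structure IsSmoothCurve {r n : ℕ} (C : Set (Grass r n)) : Prop where
  locallyClosed : IsLocallyClosed C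
  irreducible : IsIrreducible C
  dim_eq_one : topologicalKrullDim C = 1
  smooth : ∀ b : Frame r n, b.span ∈ C → Module.finrank ℂ (tangentSpace C b) = 1

/-! ### Incidence varieties and focal points -/

/-- The set of pairs (vector representing `Q`, frame of `σ`) with `(Q, σ) ∈ I`. -/
def incidenceFrames {r n : ℕ} (I : Set (PSpace n × Grass r n)) :
    Set (Fin (n + 1) ⊕ Fin (r + 1) × Fin (n + 1) → ℂ) :=
  {x | ∃ (q : Vec n) (hq : q ≠ 0) (b : Frame r n),
    x = Sum.elim q b.coords ∧ (Projectivization.mk ℂ q hq, b.span) ∈ I}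

/-- Let `I ⊆ ℙⁿ × G(r, n)` be an incidence variety, a family of subvarieties of `ℙⁿ`, with first
projection `p`. The point `Q` is focal for the family at `σ` if the differential
`(dp) : T_{I,(Q,σ)} → T_{ℙⁿ,Q}` is not injective. In homogeneous coordinates `(q, b)`, tangent
vectors are pairs `(v, w)`; the pair `(v, w)` maps to `0` in `T_{ℙⁿ,Q} = Hom(⟨q⟩, ℂ^{n+1}/⟨q⟩)` iff
`v ∈ ⟨q⟩`, and `w` is zero in `T_{G(r,n),σ} = Hom(σ, ℂ^{n+1}/σ)` iff all `w i` lie in `σ`. -/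
def IsFocal {r n : ℕ} (I : Set (PSpace n × Grass r n)) (Q : PSpace n) (σ : Grass r n) : Prop :=
  (Q, σ) ∈ I ∧ ∃ (q : Vec n) (hq : q ≠ 0) (b : Frame r n),
    Projectivization.mk ℂ q hq = Q ∧ b.span = σ ∧
    ∃ v ∈ zariskiTangent (incidenceFrames I) (Sum.elim q b.coords),
      (fun j => v (Sum.inl j)) ∈ Submodule.span ℂ {q} ∧
      ∃ i, (fun j => v (Sum.inr (i, j))) ∉ σ.1

/-- The focal locus of the family `I` on its member over `σ`. -/
def focalLocus {r n : ℕ} (I : Set (PSpace n × Grass r n)) (σ : Grass r n) : Set (PSpace n) :=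
  {Q | IsFocal I Q σ}

/-- The incidence variety of a family of linear subspaces. -/
def incidence {r n : ℕ} (C : Set (Grass r n)) : Set (PSpace n × Grass r n) :=
  {x | x.2 ∈ C ∧ x.1.submodule ≤ x.2.1}

/-- The first order focal locus of `C` on the plane `σ` is a line. -/
def HasFocalLine {n : ℕ} (C : Set (Grass 2 n)) (σ : Grass 2 n) : Prop :=
  ∃ l : Grass 1 n, focalLocus (incidence C) σ = linearPoints l.1

/-- A family of planes is developable if its general first order focal locus is a line. -/
def IsDevelopable {n : ℕ} (C : Set (Grass 2 n)) : Prop :=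
  General C (HasFocalLine C)

/-- The first order foci: pairs `(Q, σ)` such that the first order focal locus of `C` on `σ` is a
line `r(σ)` and `Q ∈ r(σ)`. This is also the incidence variety of the family of lines `r(σ)`. -/
def firstFocal {n : ℕ} (C : Set (Grass 2 n)) : Set (PSpace n × Grass 2 n) :=
  {x | x.2 ∈ C ∧ HasFocalLine C x.2 ∧ x.1 ∈ focalLocus (incidence C) x.2}

/-- The second order foci: pairs `(P, σ)` such that `P` is the only focal point on the line `r(σ)`
of the family of the focal lines. -/
def secondFocal {n : ℕ} (C : Set (Grass 2 n)) : Set (PSpace n × Grass 2 n) :=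
  {x | x.2 ∈ C ∧ HasFocalLine C x.2 ∧ focalLocus (firstFocal C) x.2 = {x.1}}

/-- The projective realization of a family: the Zariski closure in `ℙⁿ` of its image. -/
def realization {r n : ℕ} (I : Set (PSpace n × Grass r n)) : Set (PSpace n) :=
  closure (Prod.fst '' I)

/-! ### Cones, tangent planes and osculating planes -/

/-- `X` is a cone with vertex `P`: an irreducible closed set containing `P` that contains, with
each point `Q`, the line joining `P` and `Q`. -/
structure IsCone {n : ℕ} (X : Set (PSpace n)) (P : PSpace n) : Prop where
  closed : IsClosed X
  irreducible : IsIrreducible X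
  vertex_mem : P ∈ X
  join_subset : ∀ Q ∈ X, linearPoints (P.submodule ⊔ Q.submodule) ⊆ X

/-- `σ` is the tangent plane to the surface `X` at the (smooth) point `Q`. -/
def IsTangentPlane {n : ℕ} (X : Set (PSpace n)) (Q : PSpace n) (σ : Grass 2 n) : Prop :=
  Q ∈ X ∧ embeddedTangent X Q = σ.1

/-- `σ` is the osculating plane to the curve `D` at `P`: the point `P` is a smooth point of `D`,
and `σ` is spanned by `x, x', x''` for a parametrization `x + u x' + u² x''` of `D` around `P` to
the second order, that is, modulo `u³` (the factor `1/2` in front of the second derivative does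
not matter for the span). -/
def IsOsculatingPlane {n : ℕ} (D : Set (PSpace n)) (P : PSpace n) (σ : Grass 2 n) : Prop :=
  P ∈ D ∧ Module.finrank ℂ (embeddedTangent D P) = 2 ∧
  ∃ (x x' x'' : Vec n) (hx : x ≠ 0), Projectivization.mk ℂ x hx = P ∧
    (∀ F ∈ MvPolynomial.vanishingIdeal ℂ (affineCone D),
      (Polynomial.X : Polynomial ℂ) ^ 3 ∣
        MvPolynomial.aeval (fun i => Polynomial.C (x i) + Polynomial.C (x' i) * Polynomial.X
          + Polynomial.C (x'' i) * Polynomial.X ^ 2) F) ∧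
    Submodule.span ℂ {x, x', x''} = σ.1

/-- All the planes of `C` contain the line `l`, and `l` is the locus of the first order foci. -/
def IsPlanesThroughLine {n : ℕ} (C : Set (Grass 2 n)) (l : Grass 1 n) : Prop :=
  (∀ σ ∈ C, l.1 ≤ σ.1) ∧ realization (firstFocal C) = linearPoints l.1

/-- The locus of the first order foci of `C` is a cone with vertex `P`, the point `P` is the locus
of the second order foci, and `C` consists of the tangent planes to the cone: the general member of
`C` is the tangent plane at a point of its focal line, and the tangent plane at the general point of
the cone is a member of `C` with that point on its focal line. -/
structure IsTangentPlanesToCone {n : ℕ} (C : Set (Grass 2 n)) (P : PSpace n) : Prop where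
  isCone : IsCone (realization (firstFocal C)) P
  vertex : realization (secondFocal C) = {P}
  tangent_of_mem : General C fun σ =>
    ∃ Q, (Q, σ) ∈ firstFocal C ∧ IsTangentPlane (realization (firstFocal C)) Q σ
  mem_of_tangent : General (realization (firstFocal C)) fun Q =>
    ∃ σ ∈ C, (Q, σ) ∈ firstFocal C ∧ IsTangentPlane (realization (firstFocal C)) Q σ

/-- The locus `D` of the second order foci of `C` is an irreducible closed set (a curve, once its
dimension is `1`), and `C` consists of the osculating planes to `D`: the general member of `C` is
the osculating plane at its second order focus, and the osculating plane at the general point of `D`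
is a member of `C` with that point as its second order focus. -/
structure IsOsculatingPlanes {n : ℕ} (C : Set (Grass 2 n)) (D : Set (PSpace n)) : Prop where
  closed : IsClosed D
  irreducible : IsIrreducible D
  eq_secondFocal : D = realization (secondFocal C)
  osculating_of_mem : General C fun σ =>
    ∃ P, (P, σ) ∈ secondFocal C ∧ IsOsculatingPlane D P σ
  mem_of_osculating : General D fun P =>
    ∃ σ ∈ C, (P, σ) ∈ secondFocal C ∧ IsOsculatingPlane D P σ

end

/-!
The planes of the family are studied through a single generic plane, and the differential calculus
on the family becomes a calculus with derivations of a field.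

**The generic frame.** Let `Ω` be the field of rational functions in some auxiliary variables `s`
over the function field of the variety of frames of members of `C`, and let `β` be the tautological
frame over `Ω` (`IsGenericFrame`, `IsSmoothCurve.exists_isGenericFrame`). General specializations
`Ω → ℂ` (`genericFilter`) transfer identities, spans and ranks between `Ω` and `ℂ`, and by
Chevalley's theorem they reach all general members of `C` (`exists_generic_lift`). In characteristic
zero, the tangent vectors at a generic point are the values of derivations of `Ω`
(`exists_derivation_of_mem_genericTangent`). Since `C` is a smooth curve, all derivations are
multiples of one derivation `δ`, up to those that preserve the plane `W` spanned by `β`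
(`IsGenericFrame.exists_derivation`, `IsGenericFrame.exists_sub_smul_mem`).

**Focal loci.** For a family of linear spaces with generic member `K`, the generic focal space is
`derivedKernel K`, the space of those `q ∈ K` whose derivatives lie in `K`
(`IsLinearFamily.generic_focalLocus`). So the generic focal line is `K = derivedKernel W`, and the
generic second order focal space is `L = derivedKernel K`. If `K` moves, then `L` is a point, since
`δ` maps `K` to the one-dimensional space `W / K`
(`IsGenericFrame.finrank_derivedKernel_derivedKernel`).

The closures `X` and `D` are defined by means of all members whose focal locus is a line, or a
point, and not only by means of the general ones. It has to be excluded that special members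
contribute further components. If the focal space of a special member has the generic dimension,
then the rank of the matrix that defines it is constant, and each of its vectors is the value of a
polynomial section of the generic focal space (`exists_polynomial_mem_ker`,
`IsGenericFrame.exists_section_derivedKernel`). Therefore the generic point of the generic focal
line is a generic point of `X`, and likewise for `D` (`IsLinearFamily.isGenericPointOf_famPoint`). In
particular `X` and `D` are irreducible, and their tangent spaces and dimensions can be computed at
these generic points (`IsLinearFamily.genericTangent_famPoint`,
`topologicalKrullDim_le_of_genericTangent`).

**Classification.** If `K` is stable under derivations, then `X` is a line, whose points lie in the
generic plane and hence in all planes (`IsGenericFrame.isPlanesThroughLine`). Otherwise `X` is a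
surface whose tangent space at the generic point is `W`. If `L` is stable, then `D` is a point which
lies on the generic focal line, so that `X` is a cone (`IsGenericFrame.isTangentPlanesToCone`).
If `L` is not stable, let `η` be a generic point of `L`. Then `η` and `δη` span `K`, and `δ²η` does
not lie in `K`, because `K` is not stable; hence `η`, `δη` and `δ²η` span `W`. The Taylor expansion
of `η` along `δ` specializes to parametrizations of `D` to the second order, and so the planes are
the osculating planes of the curve `D` (`IsGenericFrame.isOsculatingPlanes`).
-/

open Filter Topology

noncomputable section

/-! ### Extension of homomorphisms to `ℂ` -/

/-- Nullstellensatz: every maximal ideal of a finitely generated `ℂ`-algebra is the kernel of a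
homomorphism to `ℂ`. -/
theorem exists_algHom_of_maximal {B : Type} [CommRing B] [Algebra ℂ B] [Algebra.FiniteType ℂ B]
    (N : Ideal B) [N.IsMaximal] : ∃ χ : B →ₐ[ℂ] ℂ, ∀ b, χ b = 0 ↔ b ∈ N := by
  let : Field (B ⧸ N) := Ideal.Quotient.field N
  have hfin : Module.Finite ℂ (B ⧸ N) := by
    have : Algebra.FiniteType ℂ (B ⧸ N) := inferInstance
    exact finite_of_finite_type_of_isJacobsonRing ℂ (B ⧸ N)
  have hb := IsAlgClosed.algebraMap_bijective_of_isIntegral (k := ℂ) (K := B ⧸ N)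
  let e := AlgEquiv.ofBijective (Algebra.ofId ℂ (B ⧸ N)) hb
  refine ⟨(e.symm : (B ⧸ N) →ₐ[ℂ] ℂ).comp (Ideal.Quotient.mkₐ ℂ N), fun b => ?_⟩
  simp [Ideal.Quotient.eq_zero_iff_mem]

/-- Let `A ⊆ B` be finitely generated domains over `ℂ`. By Chevalley's theorem, the image of
`Spec B → Spec A` contains a principal open set `f ≠ 0`, and so all homomorphisms `A → ℂ` that do
not vanish at `f` extend to `B`. -/
theorem exists_forall_algHom_extends {A B : Type} [CommRing A] [CommRing B] [IsDomain A]
    [IsDomain B] [Algebra ℂ A] [Algebra ℂ B] [Algebra A B] [IsScalarTower ℂ A B]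
    [Algebra.FiniteType ℂ A] [Algebra.FiniteType ℂ B]
    (inj : Function.Injective (algebraMap A B)) :
    ∃ f : A, f ≠ 0 ∧ ∀ ψ : A →ₐ[ℂ] ℂ, ψ f ≠ 0 →
      ∃ χ : B →ₐ[ℂ] ℂ, ∀ a, χ (algebraMap A B a) = ψ a := by
  have hnoeth : IsNoetherianRing A := Algebra.FiniteType.isNoetherianRing ℂ A
  have hft : Algebra.FiniteType A B := Algebra.FiniteType.of_restrictScalars_finiteType ℂ A B
  have hfp : (algebraMap A B).FinitePresentation :=
    RingHom.FinitePresentation.of_finiteType.mp (RingHom.finiteType_algebraMap.mpr hft)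
  -- `S` describes the image as a finite union of sets `f ≠ 0, g₁ = ⋯ = gₖ = 0`
  obtain ⟨S, hS⟩ := PrimeSpectrum.exists_constructibleSetData_iff.mpr
    (PrimeSpectrum.isConstructible_range_comap hfp)
  have hbot : (⊥ : PrimeSpectrum A) ∈ Set.range (PrimeSpectrum.comap (algebraMap A B)) := by
    refine ⟨⊥, ?_⟩
    ext x
    simp [PrimeSpectrum.comap_asIdeal]
    exact map_eq_zero_iff _ inj
  rw [← hS] at hbot
  simp only [PrimeSpectrum.ConstructibleSetData.toSet, Set.mem_iUnion] at hbot
  obtain ⟨c, hc, hmem⟩ := hbot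
  -- in the set that contains the generic point of `Spec A`, all `gᵢ` are zero
  have hg : ∀ i, c.g i = 0 := by
    intro i
    have := hmem.1 (Set.mem_range_self i)
    simpa using this
  have hf : c.f ≠ 0 := by
    intro h
    apply hmem.2
    simp [h]
  refine ⟨c.f, hf, fun ψ hψ => ?_⟩
  let m : PrimeSpectrum A := ⟨RingHom.ker ψ, RingHom.ker_isPrime _⟩
  have hm : m ∈ Set.range (PrimeSpectrum.comap (algebraMap A B)) := by
    rw [← hS]
    simp only [PrimeSpectrum.ConstructibleSetData.toSet, Set.mem_iUnion]
    refine ⟨c, hc, ?_, ?_⟩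
    · rintro _ ⟨i, rfl⟩
      simp [hg]
    · simpa [m] using hψ
  obtain ⟨P, hP⟩ := hm
  obtain ⟨N, hN, hPN⟩ := Ideal.exists_le_maximal P.asIdeal P.2.ne_top
  obtain ⟨χ, hχ⟩ := exists_algHom_of_maximal N
  refine ⟨χ, fun a => ?_⟩
  have h1 : a - algebraMap ℂ A (ψ a) ∈ (PrimeSpectrum.comap (algebraMap A B) P).asIdeal := by
    rw [hP]
    simp [m]
  have h2 : algebraMap A B (a - algebraMap ℂ A (ψ a)) ∈ N := hPN h1
  rw [← hχ] at h2
  rw [map_sub, map_sub, ← IsScalarTower.algebraMap_apply, AlgHom.commutes, sub_eq_zero] at h2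
  exact h2

/-! ### General specializations of a field extension of `ℂ` -/

section Generic

variable {Ω : Type} [Field Ω] [Algebra ℂ Ω]

/-- The map `φ : Ω → ℂ` restricts to a homomorphism of `ℂ`-algebras on the subalgebra generated by
`S`. Its values outside of this subalgebra are arbitrary. -/
def IsHomOn (S : Set Ω) (φ : Ω → ℂ) : Prop :=
  ∃ ψ : Algebra.adjoin ℂ S →ₐ[ℂ] ℂ, ∀ a : Algebra.adjoin ℂ S, φ a = ψ a

theorem IsHomOn.mono {S T : Set Ω} (h : S ⊆ T) {φ : Ω → ℂ} (hφ : IsHomOn T φ) : IsHomOn S φ := by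
  obtain ⟨ψ, hψ⟩ := hφ
  exact ⟨ψ.comp (Subalgebra.inclusion (Algebra.adjoin_mono h)), fun a => hψ ⟨a, _⟩⟩

variable (Ω) in
/-- The filter of the general specializations `Ω → ℂ`. A property holds eventually along this
filter if it holds for all maps that are homomorphisms on a suitable finitely generated subalgebra.
In this way a specialization can be applied to all elements of the field `Ω`, although it respects
the operations only on finitely many elements at a time. -/
def genericFilter : Filter (Ω → ℂ) := ⨅ S : Finset Ω, 𝓟 {φ | IsHomOn (S : Set Ω) φ}

theorem eventually_generic {P : (Ω → ℂ) → Prop} :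
    (∀ᶠ φ in genericFilter Ω, P φ) ↔ ∃ S : Finset Ω, ∀ φ, IsHomOn (S : Set Ω) φ → P φ := by
  classical
  rw [Filter.Eventually, genericFilter, Filter.mem_iInf_of_directed]
  · simp [Set.subset_def]
  · intro S T
    refine ⟨S ∪ T, ?_, ?_⟩ <;> simp only [ge_iff_le, le_principal_iff, mem_principal] <;>
      intro φ hφ <;> exact IsHomOn.mono (by simp) hφ

theorem generic_isHomOn {S : Set Ω} (hS : S.Finite) :
    ∀ᶠ φ in genericFilter Ω, IsHomOn S φ :=
  eventually_generic.2 ⟨hS.toFinset, fun φ h => by simpa using h⟩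

theorem IsHomOn.aeval {S : Set Ω} {φ : Ω → ℂ} (h : IsHomOn S φ) {ι : Type*} {ξ : ι → Ω}
    (hξ : ∀ i, ξ i ∈ Algebra.adjoin ℂ S) (F : MvPolynomial ι ℂ) :
    φ (MvPolynomial.aeval ξ F) = MvPolynomial.eval (fun i => φ (ξ i)) F := by
  obtain ⟨ψ, hψ⟩ := h
  have h1 : MvPolynomial.aeval ξ F = (MvPolynomial.aeval (fun i => (⟨ξ i, hξ i⟩ :
      Algebra.adjoin ℂ S)) F : Algebra.adjoin ℂ S) := by
    have := MvPolynomial.comp_aeval_apply (fun i => (⟨ξ i, hξ i⟩ : Algebra.adjoin ℂ S))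
      (Algebra.adjoin ℂ S).val F
    simpa using this.symm
  rw [h1, hψ]
  have := MvPolynomial.comp_aeval_apply (fun i => (⟨ξ i, hξ i⟩ : Algebra.adjoin ℂ S)) ψ F
  rw [this]
  have h2 : (fun i => φ (ξ i)) = fun i => ψ ⟨ξ i, hξ i⟩ := funext fun i => hψ ⟨ξ i, hξ i⟩
  rw [h2, MvPolynomial.aeval_eq_eval]

theorem generic_aeval {ι : Type*} [Finite ι] (ξ : ι → Ω) :
    ∀ᶠ φ in genericFilter Ω, ∀ F : MvPolynomial ι ℂ,
      φ (MvPolynomial.aeval ξ F) = MvPolynomial.eval (fun i => φ (ξ i)) F := by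
  filter_upwards [generic_isHomOn (Set.finite_range ξ)] with φ h F
  exact h.aeval (fun i => Algebra.subset_adjoin (Set.mem_range_self i)) F

theorem generic_add (a b : Ω) : ∀ᶠ φ in genericFilter Ω, φ (a + b) = φ a + φ b := by
  filter_upwards [generic_aeval ![a, b]] with φ h
  have := h (MvPolynomial.X 0 + MvPolynomial.X 1)
  simp only [map_add, MvPolynomial.aeval_X, MvPolynomial.eval_X] at this
  simpa using this

theorem generic_mul (a b : Ω) : ∀ᶠ φ in genericFilter Ω, φ (a * b) = φ a * φ b := by
  filter_upwards [generic_aeval ![a, b]] with φ h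
  have := h (MvPolynomial.X 0 * MvPolynomial.X 1)
  simp only [map_mul, MvPolynomial.aeval_X, MvPolynomial.eval_X] at this
  simpa using this

theorem generic_const : ∀ᶠ φ in genericFilter Ω, ∀ c : ℂ, φ (algebraMap ℂ Ω c) = c := by
  filter_upwards [generic_aeval (![] : Fin 0 → Ω)] with φ h c
  simpa using h (MvPolynomial.C c)

theorem generic_zero : ∀ᶠ φ in genericFilter Ω, φ 0 = 0 := by
  filter_upwards [generic_const] with φ h
  simpa using h 0

theorem generic_one : ∀ᶠ φ in genericFilter Ω, φ 1 = 1 := by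
  filter_upwards [generic_const] with φ h
  simpa using h 1

theorem generic_ne {a : Ω} (ha : a ≠ 0) : ∀ᶠ φ in genericFilter Ω, φ a ≠ 0 := by
  filter_upwards [generic_mul a a⁻¹, generic_one] with φ h h1 h0
  rw [mul_inv_cancel₀ ha, h1, h0, zero_mul] at h
  exact one_ne_zero h

theorem generic_sum {κ : Type*} (s : Finset κ) (f : κ → Ω) :
    ∀ᶠ φ in genericFilter Ω, φ (∑ i ∈ s, f i) = ∑ i ∈ s, φ (f i) := by
  classical
  induction s using Finset.induction_on with
  | empty => simpa using generic_zero
  | insert a s ha ih =>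
    filter_upwards [ih, generic_add (f a) (∑ i ∈ s, f i)] with φ h1 h2
    rw [Finset.sum_insert ha, Finset.sum_insert ha, h2, h1]

theorem generic_sum_mul {κ : Type*} [Fintype κ] (f g : κ → Ω) :
    ∀ᶠ φ in genericFilter Ω, φ (∑ i, f i * g i) = ∑ i, φ (f i) * φ (g i) := by
  filter_upwards [generic_sum Finset.univ (fun i => f i * g i),
    eventually_all.2 fun i => generic_mul (f i) (g i)] with φ h1 h2
  rw [h1]
  exact Finset.sum_congr rfl fun i _ => h2 i

/-- If a property holds for general specializations, then the general point `x` of the variety with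
the generic point `ξ` is the image of `ξ` under a specialization with this property. -/
theorem exists_generic_lift {ι : Type} [Finite ι] (ξ : ι → Ω) {P : (Ω → ℂ) → Prop}
    (hP : ∀ᶠ φ in genericFilter Ω, P φ) :
    ∃ h : MvPolynomial ι ℂ, MvPolynomial.aeval ξ h ≠ 0 ∧ ∀ x : ι → ℂ,
      (∀ F : MvPolynomial ι ℂ, MvPolynomial.aeval ξ F = 0 → MvPolynomial.eval x F = 0) →
      MvPolynomial.eval x h ≠ 0 → ∃ φ, P φ ∧ ∀ i, φ (ξ i) = x i := by
  classical
  obtain ⟨S, hS⟩ := eventually_generic.1 hP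
  let A := Algebra.adjoin ℂ (Set.range ξ)
  let B := Algebra.adjoin ℂ ((S : Set Ω) ∪ Set.range ξ)
  have hAB : A ≤ B := Algebra.adjoin_mono Set.subset_union_right
  let : Algebra A B := (Subalgebra.inclusion hAB).toAlgebra
  have : IsScalarTower ℂ A B := IsScalarTower.of_algebraMap_eq fun x => rfl
  have : Algebra.FiniteType ℂ A :=
    (Subalgebra.fg_iff_finiteType A).1 (Subalgebra.fg_def.2 ⟨_, Set.finite_range ξ, rfl⟩)
  have : Algebra.FiniteType ℂ B := (Subalgebra.fg_iff_finiteType B).1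
    (Subalgebra.fg_def.2 ⟨_, S.finite_toSet.union (Set.finite_range ξ), rfl⟩)
  obtain ⟨f, hf, hext⟩ := exists_forall_algHom_extends (A := A) (B := B)
    (Subalgebra.inclusion_injective hAB)
  have hfr : (f : Ω) ∈ (MvPolynomial.aeval (R := ℂ) ξ).range := by
    rw [← Algebra.adjoin_range_eq_range_aeval]; exact f.2
  obtain ⟨h, hh⟩ := hfr
  have hh' : MvPolynomial.aeval ξ h = (f : Ω) := hh
  refine ⟨h, by rw [hh']; simpa using hf, fun x hx hne => ?_⟩
  -- the homomorphism `A → ℂ` given by the point `x`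
  have hx' : ∀ F, F ∈ RingHom.ker (MvPolynomial.aeval (R := ℂ) ξ).rangeRestrict →
      MvPolynomial.aeval x F = 0 := by
    intro F hF
    rw [MvPolynomial.aeval_eq_eval]
    apply hx
    have := (RingHom.mem_ker).1 hF
    simpa [Subtype.ext_iff] using this
  let ψ0 := Ideal.Quotient.liftₐ (RingHom.ker (MvPolynomial.aeval (R := ℂ) ξ).rangeRestrict)
    (MvPolynomial.aeval x) hx'
  let e := Ideal.quotientKerAlgEquivOfSurjective
    (MvPolynomial.aeval (R := ℂ) ξ).rangeRestrict_surjective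
  let e2 := Subalgebra.equivOfEq _ _ (Algebra.adjoin_range_eq_range_aeval ℂ ξ)
  let ψ : A →ₐ[ℂ] ℂ := (ψ0.comp e.symm.toAlgHom).comp e2.toAlgHom
  have hψ : ∀ (F : MvPolynomial ι ℂ) (a : A), (a : Ω) = MvPolynomial.aeval ξ F →
      ψ a = MvPolynomial.eval x F := by
    intro F a ha
    have h1 : e2 a = (MvPolynomial.aeval (R := ℂ) ξ).rangeRestrict F := by
      apply Subtype.ext; simpa [e2] using ha
    have h2 : e.symm ((MvPolynomial.aeval (R := ℂ) ξ).rangeRestrict F) =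
        Ideal.Quotient.mk _ F := by
      rw [AlgEquiv.symm_apply_eq]; rfl
    change ψ0 (e.symm (e2 a)) = _
    rw [h1, h2]
    change MvPolynomial.aeval x F = _
    rw [MvPolynomial.aeval_eq_eval]
  obtain ⟨χ, hχ⟩ := hext ψ (by rw [hψ h f hh'.symm]; exact hne)
  refine ⟨fun a => if ha : a ∈ B then χ ⟨a, ha⟩ else 0, hS _ ?_, fun i => ?_⟩
  · refine IsHomOn.mono Set.subset_union_left (T := (S : Set Ω) ∪ Set.range ξ)
      ⟨χ, fun a => ?_⟩
    exact dif_pos a.2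
  · have hi : ξ i ∈ A := Algebra.subset_adjoin (Set.mem_range_self i)
    change (if ha : ξ i ∈ B then χ ⟨ξ i, ha⟩ else 0) = x i
    rw [dif_pos (hAB hi)]
    have := hχ ⟨ξ i, hi⟩
    rw [hψ (MvPolynomial.X i) _ (by simp), MvPolynomial.eval_X] at this
    exact this

/-- General specializations exist. -/
instance : (genericFilter Ω).NeBot := by
  rw [Filter.neBot_iff]
  intro h
  have : ∀ᶠ φ in genericFilter Ω, False := by rw [h]; exact Filter.eventually_bot
  obtain ⟨h, hh, H⟩ := exists_generic_lift (ι := Fin 0) (fun i => i.elim0) this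
  obtain ⟨c, rfl⟩ := MvPolynomial.C_surjective (Fin 0) h
  obtain ⟨φ, hφ, -⟩ := H (fun i => i.elim0) (fun F hF => by
    obtain ⟨d, rfl⟩ := MvPolynomial.C_surjective (Fin 0) F
    simpa using hF) (by simpa using hh)
  exact hφ

theorem aeval_eq_zero_of_eventually {ι : Type*} [Finite ι] {ξ : ι → Ω} {F : MvPolynomial ι ℂ}
    (h : ∀ᶠ φ in genericFilter Ω, MvPolynomial.eval (fun i => φ (ξ i)) F = 0) :
    MvPolynomial.aeval ξ F = 0 := by
  by_contra hne
  obtain ⟨φ, h1, h2, h3⟩ := (h.and ((generic_aeval ξ).and (generic_ne hne))).exists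
  exact h3 (by rw [h2, h1])

end Generic

/-! ### Linear algebra under general specializations -/

section LinearAlgebra
variable {Ω : Type} [Field Ω] [Algebra ℂ Ω] {ι κ : Type} [Fintype ι] [Fintype κ]

/-- General specializations preserve linear independence, since a left inverse specializes too. -/
theorem generic_linearIndependent {v : κ → ι → Ω} (hv : LinearIndependent Ω v) :
    ∀ᶠ φ in genericFilter Ω, LinearIndependent ℂ (fun k i => φ (v k i)) := by
  classical
  obtain ⟨f, hf⟩ := LinearMap.exists_leftInverse_of_injective (Fintype.linearCombination Ω v)
    (LinearMap.ker_eq_bot.2 hv.fintypeLinearCombination_injective)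
  have hdual : ∀ k' k, ∑ i, f (Pi.single i 1) k' * v k i = if k' = k then 1 else 0 := by
    intro k' k
    have h1 : f (v k) = Pi.single k 1 := by
      have := LinearMap.congr_fun hf (Pi.single k 1)
      simpa [Fintype.linearCombination_apply_single] using this
    have h2 : v k = ∑ i, v k i • (Pi.single i 1 : ι → Ω) := pi_eq_sum_univ' (v k)
    have h3 : f (v k) k' = ∑ i, f (Pi.single i 1) k' * v k i := by
      conv_lhs => rw [h2, map_sum]
      simp [mul_comm]
    rw [← h3, h1, Pi.single_apply]
  filter_upwards [eventually_all.2 fun k' => eventually_all.2 fun k =>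
    generic_sum_mul (fun i => f (Pi.single i 1) k') (v k), generic_one, generic_zero]
    with φ h1 hone hzero
  rw [Fintype.linearIndependent_iff]
  intro c hc k'
  have h4 : ∀ i, ∑ k, c k * φ (v k i) = 0 := fun i => by
    have := congrFun hc i
    simpa using this
  calc c k' = ∑ k, c k * φ (if k' = k then 1 else 0) := by
        simp [apply_ite φ, hone, hzero]
    _ = ∑ k, c k * ∑ i, φ (f (Pi.single i 1) k') * φ (v k i) := by
        refine Finset.sum_congr rfl fun k _ => ?_
        rw [← h1, hdual]
    _ = ∑ i, φ (f (Pi.single i 1) k') * ∑ k, c k * φ (v k i) := by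
        simp only [Finset.mul_sum]
        rw [Finset.sum_comm]
        exact Finset.sum_congr rfl fun _ _ => Finset.sum_congr rfl fun _ _ => by ring
    _ = 0 := by simp [h4]

theorem generic_mem_span {v : κ → ι → Ω} {u : ι → Ω} (hu : u ∈ Submodule.span Ω (Set.range v)) :
    ∀ᶠ φ in genericFilter Ω,
      (fun i => φ (u i)) ∈ Submodule.span ℂ (Set.range fun k i => φ (v k i)) := by
  obtain ⟨c, rfl⟩ := (Submodule.mem_span_range_iff_exists_fun Ω).1 hu
  filter_upwards [eventually_all.2 fun i => generic_sum_mul c (fun k => v k i)] with φ h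
  refine (Submodule.mem_span_range_iff_exists_fun ℂ).2 ⟨fun k => φ (c k), ?_⟩
  ext i
  simpa using (h i).symm

/-- The span of `v` has linear equations `l j` which define the span of the specialized vectors
after a general specialization. They are the rows of `1 - p`, where `p` is a projection to the
span. -/
theorem exists_equations_of_span (v : κ → ι → Ω) : ∃ l : ι → ι → Ω,
    (∀ j, ∀ u ∈ Submodule.span Ω (Set.range v), ∑ i, l j i * u i = 0) ∧
    (∀ u : ι → Ω, (∀ j, ∑ i, l j i * u i = 0) → u ∈ Submodule.span Ω (Set.range v)) ∧
    ∀ᶠ φ in genericFilter Ω, ∀ u : ι → ℂ, (∀ j, ∑ i, φ (l j i) * u i = 0) →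
      u ∈ Submodule.span ℂ (Set.range fun k i => φ (v k i)) := by
  classical
  set V := Submodule.span Ω (Set.range v) with hV
  obtain ⟨p, hp⟩ := V.subtype.exists_leftInverse_of_injective (Submodule.ker_subtype V)
  have hpV : ∀ u ∈ V, (p u : ι → Ω) = u := fun u hu => by
    have := LinearMap.congr_fun hp ⟨u, hu⟩
    simpa using congrArg Subtype.val this
  let l : ι → ι → Ω := fun j i => (if j = i then 1 else 0) - (p (Pi.single i 1) : ι → Ω) j
  have hl : ∀ (u : ι → Ω) j, ∑ i, l j i * u i = u j - (p u : ι → Ω) j := by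
    intro u j
    have h2 : u = ∑ i, u i • (Pi.single i 1 : ι → Ω) := pi_eq_sum_univ' u
    have h3 : (p u : ι → Ω) j = ∑ i, (p (Pi.single i 1) : ι → Ω) j * u i := by
      conv_lhs => rw [h2, map_sum]
      simp [mul_comm]
    rw [h3]
    simp [l, sub_mul, Finset.sum_sub_distrib]
  refine ⟨l, fun j u hu => by rw [hl, hpV u hu, sub_self], fun u hu => ?_, ?_⟩
  · have : u = p u := by
      ext j
      have := hu j
      rwa [hl, sub_eq_zero] at this
    rw [this]
    exact (p u).2
  · filter_upwards [eventually_all.2 fun i => generic_mem_span (p (Pi.single i 1)).2,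
      eventually_all.2 fun j => eventually_all.2 fun i =>
        generic_add (l j i) ((p (Pi.single i 1) : ι → Ω) j), generic_one, generic_zero]
      with φ h1 h2 hone hzero u hu
    have h3 : u = ∑ i, u i • (fun j => φ ((p (Pi.single i 1) : ι → Ω) j)) := by
      ext j
      have h4 : ∀ i, φ ((p (Pi.single i 1) : ι → Ω) j) = (if j = i then 1 else 0) - φ (l j i) := by
        intro i
        have := h2 j i
        simp only [l, sub_add_cancel] at this ⊢
        rw [apply_ite φ, hone, hzero] at this
        rw [this]; ring
      have h5 := hu j
      simp only [Finset.sum_apply, Pi.smul_apply, smul_eq_mul, h4, mul_sub,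
        Finset.sum_sub_distrib]
      rw [show ∑ i, u i * φ (l j i) = 0 by rw [← h5]; exact Finset.sum_congr rfl fun _ _ => by ring]
      simp
    rw [h3]
    exact Submodule.sum_mem _ fun i _ => Submodule.smul_mem _ _ (h1 i)

end LinearAlgebra

/-! ### Differentials of polynomials -/

section Differential
variable {R : Type} [CommRing R] [Algebra ℂ R] {ι κ : Type} [Fintype ι] [Fintype κ]

/-- The differential at `x` of a polynomial, applied to the vector `v`. -/
def differential (x v : ι → R) (F : MvPolynomial ι ℂ) : R :=
  ∑ i, MvPolynomial.aeval x (MvPolynomial.pderiv i F) * v i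

theorem differential_C (x v : ι → R) (c : ℂ) : differential x v (MvPolynomial.C c) = 0 := by
  simp [differential]

theorem differential_X (x v : ι → R) (i : ι) : differential x v (MvPolynomial.X i) = v i := by
  classical
  simp [differential, MvPolynomial.pderiv_X, Pi.single_apply, apply_ite]

theorem differential_add (x v : ι → R) (F G : MvPolynomial ι ℂ) :
    differential x v (F + G) = differential x v F + differential x v G := by
  simp [differential, add_mul, Finset.sum_add_distrib]

theorem differential_sub (x v : ι → R) (F G : MvPolynomial ι ℂ) :
    differential x v (F - G) = differential x v F - differential x v G := by
  simp [differential, sub_mul, Finset.sum_sub_distrib]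

theorem differential_mul (x v : ι → R) (F G : MvPolynomial ι ℂ) :
    differential x v (F * G) =
      differential x v F * MvPolynomial.aeval x G + MvPolynomial.aeval x F * differential x v G := by
  simp only [differential, Derivation.leibniz, smul_eq_mul, map_add, map_mul, add_mul,
    Finset.sum_add_distrib, Finset.sum_mul, Finset.mul_sum]
  rw [add_comm]
  congr 1 <;> exact Finset.sum_congr rfl fun _ _ => by ring

theorem differential_sum {τ : Type*} (s : Finset τ) (x v : ι → R) (F : τ → MvPolynomial ι ℂ) :
    differential x v (∑ i ∈ s, F i) = ∑ i ∈ s, differential x v (F i) := by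
  classical
  induction s using Finset.induction_on with
  | empty => simpa using differential_C x v 0
  | insert a s ha ih => rw [Finset.sum_insert ha, Finset.sum_insert ha, differential_add, ih]

theorem differential_smul_vec (x v : ι → R) (c : R) (F : MvPolynomial ι ℂ) :
    differential x (c • v) F = c * differential x v F := by
  simp only [differential, Pi.smul_apply, smul_eq_mul, Finset.mul_sum]
  exact Finset.sum_congr rfl fun _ _ => by ring

theorem differential_add_vec (x v w : ι → R) (F : MvPolynomial ι ℂ) :
    differential x (v + w) F = differential x v F + differential x w F := by
  simp [differential, mul_add, Finset.sum_add_distrib]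

/-- The chain rule. -/
theorem differential_bind₁ (x v : ι → R) (g : κ → MvPolynomial ι ℂ) (F : MvPolynomial κ ℂ) :
    differential x v (MvPolynomial.bind₁ g F) =
      differential (fun j => MvPolynomial.aeval x (g j)) (fun j => differential x v (g j)) F := by
  induction F using MvPolynomial.induction_on with
  | C a => simp [differential_C]
  | add p q hp hq => rw [map_add, differential_add, differential_add, hp, hq]
  | mul_X p i hp =>
    rw [map_mul, differential_mul, differential_mul, hp, differential_X, MvPolynomial.bind₁_X_right,
      MvPolynomial.aeval_X]
    congr 2
    rw [MvPolynomial.aeval_bind₁]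

theorem Derivation.apply_aeval (D : Derivation ℂ R R) (x : ι → R) (F : MvPolynomial ι ℂ) :
    D (MvPolynomial.aeval x F) = differential x (fun i => D (x i)) F := by
  induction F using MvPolynomial.induction_on with
  | C a => simp [differential_C]
  | add p q hp hq => rw [map_add, map_add, differential_add, hp, hq]
  | mul_X p i hp =>
    rw [map_mul, differential_mul, differential_X, Derivation.leibniz, hp, MvPolynomial.aeval_X]
    simp only [smul_eq_mul]; ring

theorem mem_zariskiTangent_iff {Z : Set (ι → ℂ)} {x v : ι → ℂ} :
    v ∈ zariskiTangent Z x ↔ ∀ F ∈ MvPolynomial.vanishingIdeal ℂ Z, differential x v F = 0 := by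
  simp only [differential, MvPolynomial.aeval_eq_eval]
  rfl

end Differential

/-! ### Derivations and the tangent space at a generic point -/

section Tangent

variable {Ω : Type} [Field Ω] [Algebra ℂ Ω] {ι κ : Type} [Fintype ι] [Fintype κ]

/-- The tangent space over `Ω` at the point `ξ` of the variety over `ℂ` whose generic point is `ξ`:
the common kernel of the differentials at `ξ` of the polynomials that vanish at `ξ`. -/
def genericTangent (ξ : ι → Ω) : Submodule Ω (ι → Ω) where
  carrier := {v | ∀ F : MvPolynomial ι ℂ, MvPolynomial.aeval ξ F = 0 → differential ξ v F = 0}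
  zero_mem' F _ := by simp [differential]
  add_mem' {v w} hv hw F hF := by rw [differential_add_vec, hv F hF, hw F hF, add_zero]
  smul_mem' c v hv F hF := by rw [differential_smul_vec, hv F hF, mul_zero]

theorem derivation_mem_genericTangent (D : Derivation ℂ Ω Ω) (ξ : ι → Ω) :
    (fun i => D (ξ i)) ∈ genericTangent ξ := fun F hF => by
  rw [← Derivation.apply_aeval, hF, map_zero]

/-- The lifting property of formally smooth algebras, in terms of ring homomorphisms. -/
theorem exists_ringHom_lift {A B E : Type} [CommRing A] [CommRing B] [CommRing E] [Algebra A E]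
    [Algebra.FormallySmooth A E] (f : A →+* B) (g : B →+* E) (hg : Function.Surjective g)
    (hn : IsNilpotent (RingHom.ker g)) (hfg : g.comp f = algebraMap A E) :
    ∃ h : E →+* B, (∀ x, g (h x) = x) ∧ ∀ a, h (algebraMap A E a) = f a := by
  let _ : Algebra A B := f.toAlgebra
  let g' : B →ₐ[A] E := { g with commutes' := fun a => RingHom.congr_fun hfg a }
  let h := Algebra.FormallySmooth.liftOfSurjective (AlgHom.id A E) g' hg hn
  exact ⟨h, fun x => Algebra.FormallySmooth.liftOfSurjective_apply (AlgHom.id A E) g' hg hn x,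
    fun a => h.commutes a⟩

theorem formallySmooth_of_charZero {K E : Type} [Field K] [Field E] [Algebra K E] [CharZero K] :
    Algebra.FormallySmooth K E := by
  obtain ⟨s, hs⟩ := exists_isTranscendenceBasis K E
  have := hs.isAlgebraic_field
  exact Algebra.FormallySmooth.of_algebraicIndependent_of_isSeparable hs.1

theorem formallySmooth_of_injective {A E : Type} [CommRing A] [IsDomain A] [Algebra ℂ A] [Field E]
    [Algebra A E] (hinj : Function.Injective (algebraMap A E)) :
    Algebra.FormallySmooth A E := by
  have : FaithfulSMul A E := (faithfulSMul_iff_algebraMap_injective A E).2 hinj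
  let _ : Algebra (FractionRing A) E := FractionRing.liftAlgebra A E
  have : IsScalarTower A (FractionRing A) E := FractionRing.isScalarTower_liftAlgebra A E
  have : CharZero (FractionRing A) := charZero_of_injective_algebraMap
    (algebraMap ℂ (FractionRing A)).injective
  have := formallySmooth_of_charZero (K := FractionRing A) (E := E)
  have := Algebra.FormallySmooth.of_isLocalization (R := A) (Rₘ := FractionRing A)
    (nonZeroDivisors A)
  exact Algebra.FormallySmooth.comp A (FractionRing A) E

/-- Every tangent vector at `ξ` comes from a derivation of `Ω`: the homomorphism `F ↦ F(ξ + ε v)`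
to the dual numbers `Ω[ε]` factors through the coordinate ring `ℂ[ξ]`, and it extends to `Ω` since
the latter is formally smooth over `ℂ[ξ]`, the characteristic being zero. -/
theorem exists_derivation_of_mem_genericTangent {ξ v : ι → Ω} (hv : v ∈ genericTangent ξ) :
    ∃ D : Derivation ℂ Ω Ω, ∀ i, D (ξ i) = v i := by
  let I := RingHom.ker (MvPolynomial.aeval (R := ℂ) ξ)
  let A := MvPolynomial ι ℂ ⧸ I
  have : I.IsPrime := RingHom.ker_isPrime _
  let a : A →ₐ[ℂ] Ω := Ideal.Quotient.liftₐ I (MvPolynomial.aeval ξ) fun F hF => hF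
  let _ : Algebra A Ω := a.toAlgebra
  have hinj : Function.Injective (algebraMap A Ω) := by
    rw [injective_iff_map_eq_zero]
    intro y
    obtain ⟨F, rfl⟩ := Ideal.Quotient.mk_surjective y
    exact fun hF => Ideal.Quotient.eq_zero_iff_mem.2 hF
  have := formallySmooth_of_injective hinj
  let x : ι → TrivSqZeroExt Ω Ω := fun i => TrivSqZeroExt.inl (ξ i) + TrivSqZeroExt.inr (v i)
  have hx : ∀ F, MvPolynomial.aeval x F = TrivSqZeroExt.inl (MvPolynomial.aeval ξ F) +
      TrivSqZeroExt.inr (differential ξ v F) := by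
    intro F
    induction F using MvPolynomial.induction_on with
    | C c =>
      simp only [MvPolynomial.aeval_C, differential_C]
      ext <;> simp [TrivSqZeroExt.algebraMap_eq_inl']
    | add p q hp hq =>
      rw [map_add, map_add, differential_add, hp, hq]
      ext <;> simp
    | mul_X p i hp =>
      rw [map_mul, map_mul, differential_mul, hp, differential_X, MvPolynomial.aeval_X,
        MvPolynomial.aeval_X]
      ext
      · simp [x]
      · simp [x]; ring
  let f : A →ₐ[ℂ] TrivSqZeroExt Ω Ω := Ideal.Quotient.liftₐ I (MvPolynomial.aeval x) fun F hF => by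
    rw [hx, hv F hF, show MvPolynomial.aeval ξ F = 0 from hF]; simp
  obtain ⟨h, h1, h2⟩ := exists_ringHom_lift (f : A →+* TrivSqZeroExt Ω Ω)
    (TrivSqZeroExt.fstHom Ω Ω Ω : TrivSqZeroExt Ω Ω →+* Ω)
    (fun y => ⟨TrivSqZeroExt.inl y, rfl⟩)
    ⟨2, by
      have := TrivSqZeroExt.kerIdeal_sq Ω Ω
      exact this⟩
    (by
      refine RingHom.ext fun y => ?_
      obtain ⟨F, rfl⟩ := Ideal.Quotient.mk_surjective y
      change (MvPolynomial.aeval x F).fst = MvPolynomial.aeval ξ F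
      rw [hx]; simp)
  have hc : ∀ c : ℂ, h (algebraMap ℂ Ω c) = algebraMap ℂ _ c := by
    intro c
    have := h2 (algebraMap ℂ A c)
    rw [show algebraMap A Ω (algebraMap ℂ A c) = algebraMap ℂ Ω c from a.commutes c] at this
    exact this.trans (f.commutes c)
  have hfst : ∀ y, (h y).fst = y := h1
  refine ⟨Derivation.mk' { toFun := fun y => (h y).snd, map_add' := by simp, map_smul' := ?_ } ?_,
    ?_⟩
  · intro c y
    rw [Algebra.smul_def, map_mul, hc, ← Algebra.smul_def]
    simp
  · intro y z
    simp [hfst, mul_comm]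
  · intro i
    have := h2 (Ideal.Quotient.mk I (MvPolynomial.X i))
    rw [show algebraMap A Ω (Ideal.Quotient.mk I (MvPolynomial.X i)) = ξ i from
      MvPolynomial.aeval_X ξ i] at this
    change (h (ξ i)).snd = _
    rw [this]
    change (MvPolynomial.aeval x (MvPolynomial.X i)).snd = _
    rw [hx, differential_X]; simp

end Tangent

/-! ### Tangent spaces at general points -/

section GenericPoint
variable {Ω : Type} [Field Ω] [Algebra ℂ Ω] {ι κ : Type} [Fintype ι] [Fintype κ]

/-- `ξ` is a generic point of the Zariski closure of `Z`: the polynomials over `ℂ` that vanish at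
`ξ` are those that vanish on `Z`. -/
def IsGenericPointOf (ξ : ι → Ω) (Z : Set (ι → ℂ)) : Prop :=
  ∀ F : MvPolynomial ι ℂ, F ∈ MvPolynomial.vanishingIdeal ℂ Z ↔ MvPolynomial.aeval ξ F = 0

theorem generic_differential (ξ v : ι → Ω) : ∀ᶠ φ in genericFilter Ω, ∀ F : MvPolynomial ι ℂ,
    φ (differential ξ v F) = differential (fun i => φ (ξ i)) (fun i => φ (v i)) F := by
  filter_upwards [generic_aeval (Sum.elim ξ v)] with φ h F
  let G : MvPolynomial (ι ⊕ ι) ℂ := ∑ i,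
    MvPolynomial.rename Sum.inl (MvPolynomial.pderiv i F) * MvPolynomial.X (Sum.inr i)
  have h1 := h G
  have e1 : MvPolynomial.aeval (Sum.elim ξ v) G = differential ξ v F := by
    simp only [G, differential, map_sum, map_mul, MvPolynomial.aeval_rename, MvPolynomial.aeval_X]
    rfl
  have e2 : MvPolynomial.eval (fun i => φ (Sum.elim ξ v i)) G =
      differential (fun i => φ (ξ i)) (fun i => φ (v i)) F := by
    simp only [G, differential, map_sum, map_mul, MvPolynomial.eval_rename, MvPolynomial.eval_X]
    rfl
  rw [← e1, h1, e2]

theorem generic_mem_zariskiTangent {ξ : ι → Ω} {Z : Set (ι → ℂ)} (hZ : IsGenericPointOf ξ Z)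
    {v : ι → Ω} (hv : v ∈ genericTangent ξ) : ∀ᶠ φ in genericFilter Ω,
      (fun i => φ (v i)) ∈ zariskiTangent Z (fun i => φ (ξ i)) := by
  filter_upwards [generic_differential ξ v, generic_zero] with φ h h0
  rw [mem_zariskiTangent_iff]
  intro F hF
  rw [← h, hv F ((hZ F).1 hF), h0]

/-- The specialized tangent spaces are not larger than the tangent space at the generic point. -/
theorem generic_zariskiTangent_le {ξ : ι → Ω} {Z : Set (ι → ℂ)} (hZ : IsGenericPointOf ξ Z)
    {w : κ → ι → Ω} (hw : genericTangent ξ ≤ Submodule.span Ω (Set.range w)) :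
    ∀ᶠ φ in genericFilter Ω, zariskiTangent Z (fun i => φ (ξ i)) ≤
      Submodule.span ℂ (Set.range fun k i => φ (w k i)) := by
  classical
  obtain ⟨l, hl1, -, hl2⟩ := exists_equations_of_span w
  let d : {F : MvPolynomial ι ℂ // MvPolynomial.aeval ξ F = 0} → Module.Dual Ω (ι → Ω) := fun F =>
    ∑ i, MvPolynomial.aeval ξ (MvPolynomial.pderiv i F.1) • LinearMap.proj i
  have hd : ∀ F v, d F v = differential ξ v F.1 := fun F v => by
    simp [d, differential, LinearMap.sum_apply]
  -- the conormal space at `ξ`: it contains the equations `l j`, and each of its elements is a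
  -- combination of finitely many differentials, so that it specializes to a conormal vector
  let N := Submodule.span Ω (Set.range d)
  have key : ∀ f ∈ N, ∀ᶠ φ in genericFilter Ω, ∀ u ∈ zariskiTangent Z (fun i => φ (ξ i)),
      ∑ i, φ (f (Pi.single i 1)) * u i = 0 := by
    intro f hf
    induction hf using Submodule.span_induction with
    | mem f hf =>
      obtain ⟨F, rfl⟩ := hf
      filter_upwards [generic_aeval ξ] with φ h u hu
      rw [mem_zariskiTangent_iff] at hu
      have := hu F.1 ((hZ F.1).2 F.2)
      rw [← this, differential]
      refine Finset.sum_congr rfl fun i _ => ?_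
      have e : d F (Pi.single i 1) = MvPolynomial.aeval ξ (MvPolynomial.pderiv i F.1) := by
        simp [d, LinearMap.sum_apply, Pi.single_apply]
      rw [e, h, MvPolynomial.aeval_eq_eval]
    | zero =>
      filter_upwards [generic_zero] with φ h u hu
      simp [h]
    | add f g _ _ hf hg =>
      filter_upwards [hf, hg, eventually_all.2 fun i =>
        generic_add (f (Pi.single i 1)) (g (Pi.single i 1))] with φ h1 h2 h3 u hu
      simp only [LinearMap.add_apply, h3, add_mul, Finset.sum_add_distrib, h1 u hu, h2 u hu,
        add_zero]
    | smul c f _ hf =>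
      filter_upwards [hf, eventually_all.2 fun i => generic_mul c (f (Pi.single i 1))]
        with φ h1 h2 u hu
      simp only [LinearMap.smul_apply, smul_eq_mul, h2, mul_assoc, ← Finset.mul_sum, h1 u hu,
        mul_zero]
  have hlN : ∀ j, (∑ i, l j i • LinearMap.proj i : Module.Dual Ω (ι → Ω)) ∈ N := by
    intro j
    rw [← Subspace.dualCoannihilator_dualAnnihilator_eq (W := N), Submodule.mem_dualAnnihilator]
    intro v hv
    have hvT : v ∈ genericTangent ξ := by
      intro F hF
      rw [Submodule.mem_dualCoannihilator] at hv
      have := hv _ (Submodule.subset_span ⟨⟨F, hF⟩, rfl⟩)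
      rwa [hd] at this
    simpa [LinearMap.sum_apply] using hl1 j v (hw hvT)
  filter_upwards [hl2, eventually_all.2 fun j => key _ (hlN j)] with φ h1 h2 u hu
  refine h1 u fun j => ?_
  simpa [LinearMap.sum_apply, Pi.single_apply] using h2 j u hu

end GenericPoint

/-! ### Kernels of polynomial matrices of constant rank -/

section ConstantRank

/-- A matrix of rank `ρ` becomes the unit matrix of size `ρ` after multiplication on both sides. -/
theorem exists_mul_mul_eq_one {k : Type*} [Field k] {τ ν : Type} [Fintype τ] [Fintype ν]
    (A : Matrix τ ν k) :
    ∃ (P : Matrix (Fin A.rank) τ k) (Q : Matrix ν (Fin A.rank) k), P * A * Q = 1 := by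
  classical
  let f := A.mulVecLin
  let e : LinearMap.range f ≃ₗ[k] (Fin A.rank → k) :=
    LinearEquiv.ofFinrankEq _ _ (by rw [Module.finrank_fin_fun]; rfl)
  obtain ⟨g, hg⟩ := (e.toLinearMap ∘ₗ f.rangeRestrict).exists_rightInverse_of_surjective
    (LinearMap.range_eq_top.2 (e.surjective.comp f.surjective_rangeRestrict))
  obtain ⟨p, hp⟩ := (LinearMap.range f).subtype.exists_leftInverse_of_injective
    (Submodule.ker_subtype _)
  refine ⟨LinearMap.toMatrix' (e.toLinearMap ∘ₗ p), LinearMap.toMatrix' g, ?_⟩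
  apply Matrix.toLin'.injective
  rw [Matrix.toLin'_mul, Matrix.toLin'_mul, Matrix.toLin'_toMatrix', Matrix.toLin'_toMatrix',
    Matrix.toLin'_one]
  refine LinearMap.ext fun y => ?_
  have h1 := LinearMap.congr_fun hg y
  have h2 := LinearMap.congr_fun hp (f.rangeRestrict (g y))
  simp only [LinearMap.comp_apply, LinearMap.id_apply] at h1 h2 ⊢
  rw [show Matrix.toLin' A (g y) = (LinearMap.range f).subtype (f.rangeRestrict (g y)) from rfl, h2]
  exact h1

variable {Ω : Type} [Field Ω] [Algebra ℂ Ω] {ι τ ν : Type} [Fintype τ] [Fintype ν]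

/-- Let `R` be a matrix of polynomials whose rank at the special point `x` is not smaller than its
rank at the generic point `ξ`. Then each vector `v₀` of the kernel at `x` extends to a vector of
polynomials whose value at `ξ` lies in the kernel at `ξ`. -/
theorem exists_polynomial_mem_ker (R : Matrix τ ν (MvPolynomial ι ℂ)) {ξ : ι → Ω} {x : ι → ℂ}
    (hx : ∀ F : MvPolynomial ι ℂ, MvPolynomial.aeval ξ F = 0 → MvPolynomial.eval x F = 0)
    (hrank : (R.map (MvPolynomial.aeval ξ)).rank ≤ (R.map (MvPolynomial.eval x)).rank)
    {v₀ : ν → ℂ} (hv₀ : (R.map (MvPolynomial.eval x)).mulVec v₀ = 0) :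
    ∃ v : ν → MvPolynomial ι ℂ,
      (R.map (MvPolynomial.aeval ξ)).mulVec (fun c => MvPolynomial.aeval ξ (v c)) = 0 ∧
      ∀ c, MvPolynomial.eval x (v c) = v₀ c := by
  classical
  set A := R.map (MvPolynomial.eval x) with hA
  set B := R.map (MvPolynomial.aeval ξ) with hB
  obtain ⟨P, Q, hPQ⟩ := exists_mul_mul_eq_one A
  let P' := P.map (MvPolynomial.C (σ := ι))
  let Q' := Q.map (MvPolynomial.C (σ := ι))
  let E := P' * R * Q'
  let u₀ : ν → MvPolynomial ι ℂ := fun c => MvPolynomial.C (v₀ c)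
  -- the formula of Cramer: `P R v = det E • P R u₀ - E (adj E) P R u₀ = 0`, and the value of `v` at
  -- `x`, where `E = 1` and `R u₀ = 0`, is `v₀`
  let v : ν → MvPolynomial ι ℂ := E.det • u₀ - Q'.mulVec (E.adjugate.mulVec ((P' * R).mulVec u₀))
  have hPRv : (P' * R).mulVec v = 0 := by
    simp only [v]
    rw [Matrix.mulVec_sub, Matrix.mulVec_smul, Matrix.mulVec_mulVec, Matrix.mulVec_mulVec]
    change _ - (E * E.adjugate).mulVec _ = 0
    rw [Matrix.mul_adjugate, Matrix.smul_mulVec, Matrix.one_mulVec, sub_self]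
  have hEx : E.map (MvPolynomial.eval x) = 1 := by
    rw [← hPQ]
    simp only [E, Matrix.map_mul, P', Q', Matrix.map_map]
    congr 2
    · ext; simp
    · ext; simp
  have hdet : MvPolynomial.eval x E.det = 1 := by
    rw [RingHom.map_det, RingHom.mapMatrix_apply, hEx, Matrix.det_one]
  have hdet' : MvPolynomial.aeval ξ E.det ≠ 0 := fun h => by
    rw [hx _ h] at hdet; exact zero_ne_one hdet
  refine ⟨v, ?_, fun c => ?_⟩
  · -- `ker (P B) = ker B`, as the rank of `P B` is at least `rank A ≥ rank B`
    let PΩ := P'.map (MvPolynomial.aeval ξ)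
    let QΩ := Q'.map (MvPolynomial.aeval ξ)
    have hE : PΩ * B * QΩ = E.map (MvPolynomial.aeval ξ) := by
      simp only [PΩ, QΩ, hB, E]
      rw [← AlgHom.coe_toRingHom, Matrix.map_mul, Matrix.map_mul]
    have hunit : IsUnit (PΩ * B * QΩ) := by
      rw [hE, Matrix.isUnit_iff_isUnit_det, ← AlgHom.coe_toRingHom, ← RingHom.mapMatrix_apply,
        ← RingHom.map_det]
      exact hdet'.isUnit
    have hr1 : A.rank ≤ (PΩ * B).rank := by
      have := Matrix.rank_mul_le_left (PΩ * B) QΩ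
      rw [Matrix.rank_of_isUnit _ hunit, Fintype.card_fin] at this
      exact this
    have hle : LinearMap.ker B.mulVecLin ≤ LinearMap.ker (PΩ * B).mulVecLin := by
      intro y hy
      have hy' : B.mulVec y = 0 := hy
      change (PΩ * B).mulVec y = 0
      rw [← Matrix.mulVec_mulVec, hy', Matrix.mulVec_zero]
    have heq : LinearMap.ker B.mulVecLin = LinearMap.ker (PΩ * B).mulVecLin := by
      apply Submodule.eq_of_le_of_finrank_le hle
      have e1 := LinearMap.finrank_range_add_finrank_ker B.mulVecLin
      have e2 := LinearMap.finrank_range_add_finrank_ker (PΩ * B).mulVecLin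
      have e3 : Module.finrank Ω (LinearMap.range B.mulVecLin) ≤
        Module.finrank Ω (LinearMap.range (PΩ * B).mulVecLin) := hrank.trans hr1
      omega
    change (fun c => MvPolynomial.aeval ξ (v c)) ∈ LinearMap.ker B.mulVecLin
    rw [heq]
    change (PΩ * B).mulVec _ = 0
    have h1 : PΩ * B = (P' * R).map (MvPolynomial.aeval (R := ℂ) ξ).toRingHom := by
      rw [Matrix.map_mul]; rfl
    ext j
    have h2 := congrArg (MvPolynomial.aeval (R := ℂ) ξ).toRingHom (congrFun hPRv j)
    rw [RingHom.map_mulVec] at h2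
    rw [h1]
    simpa [Function.comp_def] using h2
  · have h3 : MvPolynomial.eval x ∘ v = v₀ := by
      have hu : MvPolynomial.eval x ∘ u₀ = v₀ := by ext; simp [u₀]
      have h4 : MvPolynomial.eval x ∘ ((P' * R).mulVec u₀) = 0 := by
        ext j
        rw [Function.comp_apply, RingHom.map_mulVec, hu, Matrix.map_mul, ← hA,
          ← Matrix.mulVec_mulVec, hv₀]
        simp
      ext c
      simp only [v, Function.comp_apply, Pi.sub_apply, Pi.smul_apply, smul_eq_mul, map_sub, map_mul,
        hdet, one_mul]
      rw [RingHom.map_mulVec]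
      have h5 : MvPolynomial.eval x ∘ (E.adjugate.mulVec ((P' * R).mulVec u₀)) = 0 := by
        ext j
        rw [Function.comp_apply, RingHom.map_mulVec, h4]
        simp
      rw [h5]
      simp [u₀]
    exact congrFun h3 c

end ConstantRank

/-! ### Zariski open sets -/

section Zariski
variable {ι : Type}

theorem isOpen_zariski_iff {O : Set (ι → ℂ)} : IsOpen[zariski ι] O ↔
    ∀ x ∈ O, ∃ F : MvPolynomial ι ℂ, MvPolynomial.eval x F ≠ 0 ∧
      ∀ y, MvPolynomial.eval y F ≠ 0 → y ∈ O := by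
  have hpt : ∀ (x : ι → ℂ) (F : MvPolynomial ι ℂ),
      MvPolynomial.pointToPoint x ∈ PrimeSpectrum.basicOpen F ↔ MvPolynomial.eval x F ≠ 0 := by
    intro x F
    rw [PrimeSpectrum.mem_basicOpen]
    change ¬ F ∈ MvPolynomial.vanishingIdeal ℂ {x} ↔ _
    rw [MvPolynomial.mem_vanishingIdeal_singleton_iff, MvPolynomial.aeval_eq_eval]
  constructor
  · rintro ⟨U, hU, rfl⟩ x hx
    obtain ⟨_, ⟨F, rfl⟩, hF, hFU⟩ :=
      PrimeSpectrum.isTopologicalBasis_basic_opens.exists_subset_of_mem_open hx hU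
    exact ⟨F, (hpt x F).1 hF, fun y hy => hFU ((hpt y F).2 hy)⟩
  · intro h
    choose! F hF1 hF2 using h
    refine ⟨⋃ x ∈ O, PrimeSpectrum.basicOpen (F x),
      isOpen_biUnion fun x _ => (PrimeSpectrum.basicOpen (F x)).isOpen, ?_⟩
    ext y
    simp only [Set.mem_preimage, Set.mem_iUnion, SetLike.mem_coe, hpt, exists_prop]
    exact ⟨fun ⟨x, hx, hy⟩ => hF2 x hx y hy, fun hy => ⟨y, hy, hF1 y hy⟩⟩

/-- The open sets of a quotient of a subset of an affine space. -/
theorem isOpen_coinduced_zariski_iff {E B : Type} (c : E → ι → ℂ) (π : E → B) {O : Set B} :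
    IsOpen[TopologicalSpace.coinduced π (TopologicalSpace.induced c (zariski ι))] O ↔
    ∀ e, π e ∈ O → ∃ F : MvPolynomial ι ℂ, MvPolynomial.eval (c e) F ≠ 0 ∧
      ∀ e', MvPolynomial.eval (c e') F ≠ 0 → π e' ∈ O := by
  rw [isOpen_coinduced]
  constructor
  · rintro ⟨U, hU, hUO⟩ e he
    have he' : e ∈ c ⁻¹' U := hUO ▸ he
    obtain ⟨F, h1, h2⟩ := isOpen_zariski_iff.1 hU _ he'
    exact ⟨F, h1, fun e' h => by
      have : e' ∈ c ⁻¹' U := h2 _ h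
      rw [hUO] at this; exact this⟩
  · intro h
    refine ⟨{x | ∃ F : MvPolynomial ι ℂ, MvPolynomial.eval x F ≠ 0 ∧
      ∀ e', MvPolynomial.eval (c e') F ≠ 0 → π e' ∈ O}, ?_, ?_⟩
    · rw [isOpen_zariski_iff]
      rintro x ⟨F, h1, h2⟩
      exact ⟨F, h1, fun y hy => ⟨F, hy, h2⟩⟩
    · ext e
      exact ⟨fun ⟨F, h1, h2⟩ => h2 e h1, fun he => h e he⟩

end Zariski

/-! ### The Zariski topology of projective space -/

section PSpace
variable {n : ℕ}

theorem isOpen_PSpace_iff {O : Set (PSpace n)} : IsOpen O ↔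
    ∀ (v : Vec n) (hv : v ≠ 0), Projectivization.mk ℂ v hv ∈ O →
      ∃ F : MvPolynomial (Fin (n + 1)) ℂ, MvPolynomial.eval v F ≠ 0 ∧
        ∀ (w : Vec n) (hw : w ≠ 0), MvPolynomial.eval w F ≠ 0 → Projectivization.mk ℂ w hw ∈ O := by
  rw [show IsOpen O ↔ _ from isOpen_coinduced_zariski_iff _ _]
  simp only [Subtype.forall]
  rfl

/-- The image in `ℙⁿ` of the principal open set `F ≠ 0`. -/
def projOpen (F : MvPolynomial (Fin (n + 1)) ℂ) : Set (PSpace n) :=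
  {Q | ∃ (v : Vec n) (hv : v ≠ 0), Projectivization.mk ℂ v hv = Q ∧ MvPolynomial.eval v F ≠ 0}

theorem eval_bind₁ {ι κ : Type} (x : ι → ℂ) (g : κ → MvPolynomial ι ℂ) (F : MvPolynomial κ ℂ) :
    MvPolynomial.eval x (MvPolynomial.bind₁ g F) =
      MvPolynomial.eval (fun k => MvPolynomial.eval x (g k)) F := by
  have := MvPolynomial.aeval_bind₁ (R := ℂ) x g F
  simpa only [MvPolynomial.aeval_eq_eval] using this

theorem isOpen_projOpen (F : MvPolynomial (Fin (n + 1)) ℂ) : IsOpen (projOpen F) := by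
  rw [isOpen_PSpace_iff]
  rintro v hv ⟨w, hw, hwv, hF⟩
  obtain ⟨a, rfl⟩ := (Projectivization.mk_eq_mk_iff' ℂ w v hw hv).1 hwv
  have ha : a ≠ 0 := fun h => hw (by rw [h, zero_smul])
  refine ⟨MvPolynomial.bind₁ (fun i => MvPolynomial.C a * MvPolynomial.X i) F, ?_, ?_⟩
  · rw [eval_bind₁]
    simpa [Pi.smul_def] using hF
  · intro u hu hne
    refine ⟨a • u, smul_ne_zero ha hu, (Projectivization.mk_eq_mk_iff' ℂ _ _ _ _).2 ⟨a, rfl⟩, ?_⟩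
    rw [eval_bind₁] at hne
    simpa [Pi.smul_def] using hne

/-- The Zariski closure in `ℙⁿ` is defined by the polynomials that vanish on the cone. -/
theorem mk_mem_closure_iff {Y : Set (PSpace n)} {v : Vec n} (hv : v ≠ 0) :
    Projectivization.mk ℂ v hv ∈ closure Y ↔
      ∀ F ∈ MvPolynomial.vanishingIdeal ℂ (affineCone Y), MvPolynomial.eval v F = 0 := by
  constructor
  · intro h F hF
    by_contra hne
    obtain ⟨Q, ⟨w, hw, rfl, hFw⟩, hQY⟩ := mem_closure_iff.1 h (projOpen F) (isOpen_projOpen F)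
      ⟨v, hv, rfl, hne⟩
    exact hFw (by simpa [MvPolynomial.aeval_eq_eval] using hF w ⟨hw, hQY⟩)
  · intro h
    by_contra hne
    obtain ⟨F, h1, h2⟩ := isOpen_PSpace_iff.1 isClosed_closure.isOpen_compl v hv hne
    apply h1
    apply h
    rintro w ⟨hw, hwY⟩
    rw [MvPolynomial.aeval_eq_eval]
    by_contra h3
    exact h2 w hw h3 (subset_closure hwY)

theorem vanishingIdeal_affineCone_closure (Y : Set (PSpace n)) :
    MvPolynomial.vanishingIdeal ℂ (affineCone (closure Y)) =
      MvPolynomial.vanishingIdeal ℂ (affineCone Y) := by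
  apply le_antisymm
  · exact MvPolynomial.vanishingIdeal_anti_mono fun v ⟨hv, h⟩ => ⟨hv, subset_closure h⟩
  · rintro F hF v ⟨hv, h⟩
    rw [MvPolynomial.aeval_eq_eval]
    exact (mk_mem_closure_iff hv).1 h F hF

theorem mk_mem_iff_of_isClosed {X : Set (PSpace n)} (hX : IsClosed X) {v : Vec n} (hv : v ≠ 0) :
    Projectivization.mk ℂ v hv ∈ X ↔
      ∀ F ∈ MvPolynomial.vanishingIdeal ℂ (affineCone X), MvPolynomial.eval v F = 0 := by
  rw [← mk_mem_closure_iff hv, hX.closure_eq]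

theorem isIrreducible_of_isPrime {X : Set (PSpace n)}
    (h : (MvPolynomial.vanishingIdeal ℂ (affineCone X)).IsPrime) : IsIrreducible X := by
  constructor
  · by_contra hne
    rw [Set.not_nonempty_iff_eq_empty] at hne
    apply h.ne_top
    rw [eq_top_iff]
    rintro F - v ⟨hv, hvX⟩
    rw [hne] at hvX
    exact hvX.elim
  · rintro U V hU hV ⟨P, hPX, hPU⟩ ⟨Q, hQX, hQV⟩
    induction P using Projectivization.ind with | _ v hv
    induction Q using Projectivization.ind with | _ w hw
    obtain ⟨F, hF1, hF2⟩ := isOpen_PSpace_iff.1 hU v hv hPU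
    obtain ⟨G, hG1, hG2⟩ := isOpen_PSpace_iff.1 hV w hw hQV
    have hF : F ∉ MvPolynomial.vanishingIdeal ℂ (affineCone X) := fun h => hF1 (by
      simpa [MvPolynomial.aeval_eq_eval] using h v ⟨hv, hPX⟩)
    have hG : G ∉ MvPolynomial.vanishingIdeal ℂ (affineCone X) := fun h => hG1 (by
      simpa [MvPolynomial.aeval_eq_eval] using h w ⟨hw, hQX⟩)
    have hFG : F * G ∉ MvPolynomial.vanishingIdeal ℂ (affineCone X) := fun hm =>
      (h.mem_or_mem hm).elim hF hG
    rw [MvPolynomial.mem_vanishingIdeal_iff] at hFG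
    push Not at hFG
    obtain ⟨u, ⟨hu, huX⟩, hne⟩ := hFG
    rw [MvPolynomial.aeval_eq_eval, map_mul] at hne
    exact ⟨_, huX, hF2 u hu (left_ne_zero_of_mul hne), hG2 u hu (right_ne_zero_of_mul hne)⟩

/-- The cone over an irreducible set is irreducible: if `F` and `G` do not vanish on the cone, then
there is a point of the set on whose line neither of them vanishes, and their restrictions to this
line are polynomials in one variable. -/
theorem isPrime_vanishingIdeal_affineCone {X : Set (PSpace n)} (hX : IsIrreducible X) :
    (MvPolynomial.vanishingIdeal ℂ (affineCone X)).IsPrime := by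
  have hne : ∀ F, F ∉ MvPolynomial.vanishingIdeal ℂ (affineCone X) → (X ∩ projOpen F).Nonempty := by
    intro F hF
    rw [MvPolynomial.mem_vanishingIdeal_iff] at hF
    push Not at hF
    obtain ⟨u, ⟨hu, huX⟩, hne⟩ := hF
    exact ⟨_, huX, u, hu, rfl, by rwa [MvPolynomial.aeval_eq_eval] at hne⟩
  refine Ideal.isPrime_iff.2 ⟨?_, fun {F G} hFG => ?_⟩
  · rw [Ideal.ne_top_iff_one]
    intro h
    obtain ⟨Q, hQ⟩ := hX.1
    have := h Q.rep ⟨Q.rep_nonzero, by rwa [Projectivization.mk_rep]⟩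
    simp at this
  · by_contra! hcon
    obtain ⟨Q, hQX, ⟨v, hv, rfl, hF⟩, ⟨w, hw, hwv, hG⟩⟩ :=
      hX.2 _ _ (isOpen_projOpen F) (isOpen_projOpen G) (hne F hcon.1) (hne G hcon.2)
    obtain ⟨a, rfl⟩ := (Projectivization.mk_eq_mk_iff' ℂ w v hw hv).1 hwv
    let ev : MvPolynomial (Fin (n + 1)) ℂ →ₐ[ℂ] Polynomial ℂ :=
      MvPolynomial.aeval fun i => Polynomial.C (v i) * Polynomial.X
    have hev : ∀ (c : ℂ) (H : MvPolynomial (Fin (n + 1)) ℂ),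
        (ev H).eval c = MvPolynomial.eval (c • v) H := by
      intro c H
      have := MvPolynomial.comp_aeval_apply (fun i => Polynomial.C (v i) * Polynomial.X)
        (Polynomial.aeval c) H
      rw [Polynomial.coe_aeval_eq_eval] at this
      rw [this, MvPolynomial.aeval_eq_eval]
      have h : (fun i => Polynomial.eval c (Polynomial.C (v i) * Polynomial.X)) = c • v := by
        funext i
        rw [Polynomial.eval_mul, Polynomial.eval_C, Polynomial.eval_X, Pi.smul_apply, smul_eq_mul,
          mul_comm]
      rw [h]
    have h1 : ev F ≠ 0 := fun h => hF (by
      rw [← one_smul ℂ v, ← hev, h, Polynomial.eval_zero])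
    have h2 : ev G ≠ 0 := fun h => hG (by
      rw [← hev, h, Polynomial.eval_zero])
    have h3 : ev F * ev G * Polynomial.X ≠ 0 := mul_ne_zero (mul_ne_zero h1 h2) Polynomial.X_ne_zero
    obtain ⟨c, hc⟩ := Polynomial.exists_eval_ne_zero_of_natDegree_lt_card _ h3
      ((Cardinal.natCast_lt_aleph0).trans_le (Cardinal.aleph0_le_mk ℂ))
    rw [Polynomial.eval_mul, Polynomial.eval_X, Polynomial.eval_mul, hev, hev] at hc
    have hc0 : c ≠ 0 := right_ne_zero_of_mul hc
    have h4 := hFG (c • v) ⟨smul_ne_zero hc0 hv, by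
      rw [show Projectivization.mk ℂ (c • v) (smul_ne_zero hc0 hv) = Projectivization.mk ℂ v hv from
        (Projectivization.mk_eq_mk_iff' ℂ _ _ _ _).2 ⟨c, rfl⟩]
      exact hQX⟩
    rw [MvPolynomial.aeval_eq_eval, map_mul] at h4
    exact left_ne_zero_of_mul hc h4

end PSpace

/-! ### The Zariski topology of the Grassmannian -/

section Frames
variable {r n : ℕ}

theorem isOpen_Grass_iff {O : Set (Grass r n)} : IsOpen O ↔
    ∀ b : Frame r n, b.span ∈ O →
      ∃ F : MvPolynomial (Fin (r + 1) × Fin (n + 1)) ℂ, MvPolynomial.eval b.coords F ≠ 0 ∧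
        ∀ b' : Frame r n, MvPolynomial.eval b'.coords F ≠ 0 → b'.span ∈ O :=
  isOpen_coinduced_zariski_iff _ _

/-- Change of a frame by an invertible matrix. -/
def Frame.act (g : Matrix (Fin (r + 1)) (Fin (r + 1)) ℂ) (hg : g.det ≠ 0) (b : Frame r n) :
    Frame r n :=
  ⟨fun i => ∑ k, g i k • b.1 k, by
    rw [Fintype.linearIndependent_iff]
    intro c hc
    have h1 : ∑ k, (∑ i, c i * g i k) • b.1 k = 0 := by
      rw [← hc]
      simp only [Finset.sum_smul, Finset.smul_sum, smul_smul]
      rw [Finset.sum_comm]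
    have h2 := Fintype.linearIndependent_iff.1 b.2 _ h1
    have h3 : Matrix.vecMul c g = 0 := funext fun k => by
      simpa [Matrix.vecMul, dotProduct] using h2 k
    have := Matrix.eq_zero_of_vecMul_eq_zero hg h3
    exact fun i => congrFun this i⟩

theorem Frame.span_act (g : Matrix (Fin (r + 1)) (Fin (r + 1)) ℂ) (hg : g.det ≠ 0)
    (b : Frame r n) : (b.act g hg).span = b.span := by
  apply Subtype.ext
  refine Submodule.eq_of_le_of_finrank_eq (K := ℂ) ?_ ?_
  · refine Submodule.span_le.2 ?_
    rintro _ ⟨i, rfl⟩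
    change ∑ k, g i k • b.1 k ∈ Submodule.span ℂ (Set.range b.1)
    exact Submodule.sum_mem _ fun k _ => Submodule.smul_mem _ _
      (Submodule.subset_span (Set.mem_range_self k))
  · rw [(b.act g hg).span.2, b.span.2]

theorem Frame.exists_act_eq {b b' : Frame r n} (h : b'.span = b.span) :
    ∃ (g : Matrix (Fin (r + 1)) (Fin (r + 1)) ℂ) (hg : g.det ≠ 0), b' = b.act g hg := by
  have h1 : ∀ i, ∃ c : Fin (r + 1) → ℂ, ∑ k, c k • b.1 k = b'.1 i := fun i => by
    apply (Submodule.mem_span_range_iff_exists_fun ℂ).1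
    have : b'.1 i ∈ b'.span.1 := Submodule.subset_span (Set.mem_range_self i)
    rwa [h] at this
  choose g hg using h1
  have hdet : (Matrix.of g).det ≠ 0 := by
    intro h0
    obtain ⟨c, hc0, hc⟩ := Matrix.exists_vecMul_eq_zero_iff.2 h0
    apply hc0
    funext i
    refine Fintype.linearIndependent_iff.1 b'.2 c ?_ i
    simp only [← hg, Finset.smul_sum, smul_smul]
    rw [Finset.sum_comm]
    simp only [← Finset.sum_smul]
    refine Finset.sum_eq_zero fun k _ => ?_
    have := congrFun hc k
    simp only [Matrix.vecMul, dotProduct, Matrix.of_apply, Pi.zero_apply] at this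
    rw [this, zero_smul]
  exact ⟨Matrix.of g, hdet, Subtype.ext (funext fun i => (hg i).symm)⟩

theorem Frame.coords_act (g : Matrix (Fin (r + 1)) (Fin (r + 1)) ℂ) (hg : g.det ≠ 0)
    (b : Frame r n) (ij : Fin (r + 1) × Fin (n + 1)) :
    (b.act g hg).coords ij = ∑ k, g ij.1 k * b.coords (k, ij.2) := by
  simp [Frame.act, Frame.coords]

theorem Frame.exists_span_eq (σ : Grass r n) : ∃ b : Frame r n, b.span = σ := by
  let e := Module.finBasisOfFinrankEq ℂ σ.1 σ.2
  refine ⟨⟨fun i => (e i : Vec n), ?_⟩, ?_⟩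
  · exact e.linearIndependent.map' σ.1.subtype (Submodule.ker_subtype _)
  · apply Subtype.ext
    change Submodule.span ℂ (Set.range fun i => (e i : Vec n)) = σ.1
    have := congrArg (Submodule.map σ.1.subtype) e.span_eq
    rw [Submodule.map_span, ← Set.range_comp, Submodule.map_top, Submodule.range_subtype] at this
    exact this

/-- The image in the Grassmannian of the principal open set `F ≠ 0`. -/
def grassOpen (F : MvPolynomial (Fin (r + 1) × Fin (n + 1)) ℂ) : Set (Grass r n) :=
  {σ | ∃ b : Frame r n, b.span = σ ∧ MvPolynomial.eval b.coords F ≠ 0}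

theorem isOpen_grassOpen (F : MvPolynomial (Fin (r + 1) × Fin (n + 1)) ℂ) :
    IsOpen (grassOpen F : Set (Grass r n)) := by
  rw [isOpen_Grass_iff]
  rintro b ⟨b', hb', hF⟩
  obtain ⟨g, hg, rfl⟩ := Frame.exists_act_eq hb'
  have key : ∀ b : Frame r n, MvPolynomial.eval b.coords (MvPolynomial.bind₁ (fun ij =>
      ∑ k, MvPolynomial.C (g ij.1 k) * MvPolynomial.X (k, ij.2)) F) =
      MvPolynomial.eval (b.act g hg).coords F := by
    intro b
    rw [eval_bind₁]
    congr 2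
    ext ij
    simp [Frame.coords_act]
  exact ⟨_, by rw [key]; exact hF, fun b' h => ⟨b'.act g hg, b'.span_act g hg, by rwa [key] at h⟩⟩

/-- The set of the frames of the members of an irreducible family is irreducible: if `F` and `G` do
not vanish on it, then there is a member such that neither of them vanishes on the frames of this
member, and these frames are parametrized by the invertible matrices. -/
theorem isPrime_vanishingIdeal_framesOf {C : Set (Grass r n)} (hC : IsIrreducible C) :
    (MvPolynomial.vanishingIdeal ℂ (framesOf C)).IsPrime := by
  have hne : ∀ F, F ∉ MvPolynomial.vanishingIdeal ℂ (framesOf C) → (C ∩ grassOpen F).Nonempty := by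
    intro F hF
    rw [MvPolynomial.mem_vanishingIdeal_iff] at hF
    push Not at hF
    obtain ⟨_, ⟨b, rfl, hb⟩, hne⟩ := hF
    exact ⟨b.span, hb, b, rfl, by rwa [MvPolynomial.aeval_eq_eval] at hne⟩
  refine Ideal.isPrime_iff.2 ⟨?_, fun {F G} hFG => ?_⟩
  · rw [Ideal.ne_top_iff_one]
    intro h
    obtain ⟨σ, hσ⟩ := hC.1
    obtain ⟨b, rfl⟩ := Frame.exists_span_eq σ
    have := h b.coords ⟨b, rfl, hσ⟩
    simp at this
  · by_contra! hcon
    obtain ⟨σ, hσ, ⟨b, rfl, hF⟩, ⟨b', hb', hG⟩⟩ :=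
      hC.2 _ _ (isOpen_grassOpen F) (isOpen_grassOpen G) (hne F hcon.1) (hne G hcon.2)
    obtain ⟨g, hg, rfl⟩ := Frame.exists_act_eq hb'
    -- the pullback of polynomials along `m ↦ m • b`
    let ev : MvPolynomial (Fin (r + 1) × Fin (n + 1)) ℂ →ₐ[ℂ]
        MvPolynomial (Fin (r + 1) × Fin (r + 1)) ℂ := MvPolynomial.bind₁ fun ij =>
      ∑ k, MvPolynomial.X (ij.1, k) * MvPolynomial.C (b.coords (k, ij.2))
    let d : MvPolynomial (Fin (r + 1) × Fin (r + 1)) ℂ :=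
      (Matrix.of fun i j => MvPolynomial.X (i, j)).det
    have hd : ∀ m : Matrix (Fin (r + 1)) (Fin (r + 1)) ℂ,
        MvPolynomial.eval (fun ij => m ij.1 ij.2) d = m.det := by
      intro m
      simp only [d]
      rw [RingHom.map_det]
      congr 1
      ext i j
      simp
    have hev : ∀ (m : Matrix (Fin (r + 1)) (Fin (r + 1)) ℂ) (hm : m.det ≠ 0) H,
        MvPolynomial.eval (fun ij => m ij.1 ij.2) (ev H) =
          MvPolynomial.eval (b.act m hm).coords H := by
      intro m hm H
      simp only [ev]
      rw [eval_bind₁]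
      congr 2
      ext ij
      simp [Frame.coords_act]
    have h1 : ev F ≠ 0 := fun h => hF (by
      have := hev 1 (by simp) F
      rw [h, map_zero] at this
      rw [this]
      congr 2
      ext ij
      simp [Frame.coords_act, Matrix.one_apply])
    have h2 : ev G ≠ 0 := fun h => hG (by
      have := hev g hg G
      rw [h, map_zero] at this
      exact this.symm)
    have h3 : d ≠ 0 := fun h => by
      have := hd 1
      rw [h] at this
      simp at this
    have h4 : ∃ m : Fin (r + 1) × Fin (r + 1) → ℂ, MvPolynomial.eval m (ev F * ev G * d) ≠ 0 := by
      by_contra! h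
      exact mul_ne_zero (mul_ne_zero h1 h2) h3 (MvPolynomial.funext fun m => by rw [h, map_zero])
    obtain ⟨m, hm⟩ := h4
    rw [map_mul, map_mul] at hm
    have hm0 : (Matrix.of fun i j => m (i, j)).det ≠ 0 := by
      rw [← hd]
      exact right_ne_zero_of_mul hm
    have e1 := hev _ hm0 F
    have e2 := hev _ hm0 G
    have h5 := hFG _ ⟨b.act _ hm0, rfl, by rw [Frame.span_act]; exact hσ⟩
    rw [MvPolynomial.aeval_eq_eval, map_mul, ← e1, ← e2] at h5
    exact left_ne_zero_of_mul hm h5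

/-- Frames form an open subset of the space of matrices. -/
theorem Frame.exists_open (b : Frame r n) :
    ∃ G : MvPolynomial (Fin (r + 1) × Fin (n + 1)) ℂ, MvPolynomial.eval b.coords G ≠ 0 ∧
      ∀ x, MvPolynomial.eval x G ≠ 0 → ∃ b' : Frame r n, x = b'.coords := by
  obtain ⟨f, hf⟩ := LinearMap.exists_leftInverse_of_injective (Fintype.linearCombination ℂ b.1)
    (LinearMap.ker_eq_bot.2 b.2.fintypeLinearCombination_injective)
  let N : Matrix (Fin (r + 1)) (Fin (r + 1)) (MvPolynomial (Fin (r + 1) × Fin (n + 1)) ℂ) :=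
    Matrix.of fun i k => ∑ j, MvPolynomial.X (i, j) * MvPolynomial.C (f (Pi.single j 1) k)
  have hN : ∀ x : Fin (r + 1) × Fin (n + 1) → ℂ, MvPolynomial.eval x N.det =
      (Matrix.of fun i k => f (fun j => x (i, j)) k).det := by
    intro x
    rw [RingHom.map_det]
    congr 1
    ext i k
    have h2 : (fun j => x (i, j)) = ∑ j, x (i, j) • (Pi.single j 1 : Vec n) :=
      pi_eq_sum_univ' _
    simp only [RingHom.mapMatrix_apply, Matrix.map_apply, N, Matrix.of_apply]
    conv_rhs => rw [h2, map_sum]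
    simp
  refine ⟨N.det, ?_, fun x hx => ?_⟩
  · rw [hN]
    have : (Matrix.of fun i k => f (fun j => b.coords (i, j)) k) = 1 := by
      ext i k
      have := congrFun (LinearMap.congr_fun hf (Pi.single i 1)) k
      rw [LinearMap.comp_apply, Fintype.linearCombination_apply_single, one_smul] at this
      rw [Matrix.of_apply, show (fun j => b.coords (i, j)) = b.1 i from rfl, this]
      simp [Matrix.one_apply, Pi.single_apply, eq_comm]
    rw [this, Matrix.det_one]
    exact one_ne_zero
  · rw [hN] at hx
    refine ⟨⟨fun i j => x (i, j), ?_⟩, rfl⟩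
    rw [Fintype.linearIndependent_iff]
    intro c hc
    have h3 : Matrix.vecMul c (Matrix.of fun i k => f (fun j => x (i, j)) k) = 0 := by
      have := congrArg f hc
      rw [map_sum, map_zero] at this
      funext k
      have := congrFun this k
      simpa [Matrix.vecMul, dotProduct] using this
    exact fun i => congrFun (Matrix.eq_zero_of_vecMul_eq_zero hx h3) i

/-- The set of the frames of the members of a locally closed family is locally closed. -/
theorem IsLocallyClosed.exists_framesOf {C : Set (Grass r n)} (hC : IsLocallyClosed C)
    {b : Frame r n} (hb : b.span ∈ C) :
    ∃ h : MvPolynomial (Fin (r + 1) × Fin (n + 1)) ℂ, MvPolynomial.eval b.coords h ≠ 0 ∧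
      ∀ x, (∀ F ∈ MvPolynomial.vanishingIdeal ℂ (framesOf C), MvPolynomial.eval x F = 0) →
        MvPolynomial.eval x h ≠ 0 → x ∈ framesOf C := by
  obtain ⟨U, Z, hU, hZ, rfl⟩ := hC
  obtain ⟨F, hF1, hF2⟩ := isOpen_Grass_iff.1 hU b hb.1
  obtain ⟨G, hG1, hG2⟩ := b.exists_open
  refine ⟨F * G, by rw [map_mul]; exact mul_ne_zero hF1 hG1, fun x hx hne => ?_⟩
  rw [map_mul] at hne
  obtain ⟨b', rfl⟩ := hG2 x (right_ne_zero_of_mul hne)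
  refine ⟨b', rfl, hF2 b' (left_ne_zero_of_mul hne), ?_⟩
  by_contra hb'
  obtain ⟨H, hH1, hH2⟩ := isOpen_Grass_iff.1 hZ.isOpen_compl b' hb'
  apply hH1
  apply hx
  rintro _ ⟨b'', rfl, hb''⟩
  rw [MvPolynomial.aeval_eq_eval]
  by_contra h
  exact hH2 b'' h hb''.2

/-- A property of the general member of `C` holds where a suitable polynomial does not vanish. -/
theorem General.exists_polynomial {C : Set (Grass r n)} {p : Grass r n → Prop} (h : General C p) :
    ∃ F : MvPolynomial (Fin (r + 1) × Fin (n + 1)) ℂ,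
      F ∉ MvPolynomial.vanishingIdeal ℂ (framesOf C) ∧
      ∀ b : Frame r n, b.span ∈ C → MvPolynomial.eval b.coords F ≠ 0 → p b.span := by
  obtain ⟨O, hO, ⟨σ, hσO, hσC⟩, hp⟩ := h
  obtain ⟨b, rfl⟩ := Frame.exists_span_eq σ
  obtain ⟨F, hF1, hF2⟩ := isOpen_Grass_iff.1 hO b hσO
  refine ⟨F, fun h => hF1 ?_, fun b' hb' hne => hp _ ⟨hF2 b' hne, hb'⟩⟩
  simpa [MvPolynomial.aeval_eq_eval] using h b.coords ⟨b, rfl, hσC⟩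

end Frames

/-! ### Dimension and the generic tangent space -/

section Dimension

/-- By Noether normalization, the dimension of a finitely generated domain is at most its
transcendence degree. -/
theorem exists_algebraicIndependent_ringKrullDim_le (A : Type) [CommRing A] [IsDomain A]
    [Algebra ℂ A] [Algebra.FiniteType ℂ A] :
    ∃ (s : ℕ) (y : Fin s → A), AlgebraicIndependent ℂ y ∧ ringKrullDim A ≤ s := by
  obtain ⟨s, g, hg, hint⟩ := exists_integral_inj_algHom_of_fg ℂ A
  refine ⟨s, fun i => g (MvPolynomial.X i), ?_, ?_⟩
  · change Function.Injective (MvPolynomial.aeval fun i => g (MvPolynomial.X i))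
    rw [show MvPolynomial.aeval (fun i => g (MvPolynomial.X i)) = g from
      MvPolynomial.algHom_ext (by simp)]
    exact hg
  · have h1 : ringKrullDim (MvPolynomial (Fin s) ℂ) = s := by
      rw [MvPolynomial.ringKrullDim_of_isNoetherianRing]; simp
    rw [← h1]
    let _ : Algebra (MvPolynomial (Fin s) ℂ) A := g.toRingHom.toAlgebra
    have : Algebra.IsIntegral (MvPolynomial (Fin s) ℂ) A := ⟨hint⟩
    refine Order.krullDim_le_of_strictMono (PrimeSpectrum.comap (algebraMap _ A)) ?_
    intro P Q hPQ
    obtain ⟨hle, x, hxQ, hxP⟩ := Set.ssubset_iff_exists.1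
      (show (P.asIdeal : Set A) ⊂ Q.asIdeal from hPQ)
    exact Ideal.comap_lt_comap_of_integral_mem_sdiff (I := P.asIdeal) (J := Q.asIdeal) hPQ.le
      ⟨hxQ, hxP⟩ (Algebra.IsIntegral.isIntegral x)

variable {Ω : Type} [Field Ω] [Algebra ℂ Ω] {ι κ : Type} [Fintype ι] [Fintype κ]

/-- The transcendence degree of `ℂ(ξ)` is at most the dimension of the tangent space at `ξ`: for
algebraically independent elements of `ℂ[ξ]` there are derivations dual to them, and their values
at `ξ` are linearly independent. -/
theorem card_le_of_algebraicIndependent {ξ : ι → Ω} {w : κ → ι → Ω}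
    (hw : genericTangent ξ ≤ Submodule.span Ω (Set.range w)) {s : ℕ}
    (G : Fin s → MvPolynomial ι ℂ)
    (hG : AlgebraicIndependent ℂ fun k => MvPolynomial.aeval ξ (G k)) : s ≤ Fintype.card κ := by
  classical
  have h1 : ∀ j : Fin s, ∃ D : Derivation ℂ Ω Ω, ∀ k,
      D (MvPolynomial.aeval ξ (G k)) = (Pi.single j 1 : Fin s → Ω) k := fun j =>
    exists_derivation_of_mem_genericTangent (ξ := fun k => MvPolynomial.aeval ξ (G k))
      (v := Pi.single j 1) fun F hF => by
        rw [(injective_iff_map_eq_zero _).1 hG F hF]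
        simpa using differential_C (R := Ω) _ _ 0
  choose D hD using h1
  have hLI : LinearIndependent Ω (fun j i => D j (ξ i)) := by
    rw [Fintype.linearIndependent_iff]
    intro c hc k
    have h2 : differential ξ (∑ j, c j • fun i => D j (ξ i)) (G k) = c k := by
      have h3 : ∀ s : Finset (Fin s), differential ξ (∑ j ∈ s, c j • fun i => D j (ξ i)) (G k) =
          ∑ j ∈ s, c j * D j (MvPolynomial.aeval ξ (G k)) := by
        intro s
        induction s using Finset.induction_on with
        | empty => simp [differential]
        | insert a s ha ih =>
          rw [Finset.sum_insert ha, Finset.sum_insert ha, differential_add_vec,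
            differential_smul_vec, ih, Derivation.apply_aeval]
      rw [h3]
      simp [hD, Pi.single_apply]
    rw [← h2, hc]
    simp [differential]
  have h4 : Submodule.span Ω (Set.range fun j i => D j (ξ i)) ≤
      Submodule.span Ω (Set.range w) := by
    refine le_trans (Submodule.span_le.2 ?_) hw
    rintro _ ⟨j, rfl⟩
    exact derivation_mem_genericTangent (D j) ξ
  have h5 := Submodule.finrank_mono h4
  rw [finrank_span_eq_card hLI, Fintype.card_fin] at h5
  exact h5.trans (finrank_range_le_card w)

variable {n : ℕ}

theorem linearPoints_mk {L : Submodule ℂ (Vec n)} {v : Vec n} (hv : v ≠ 0) :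
    Projectivization.mk ℂ v hv ∈ linearPoints L ↔ v ∈ L := by
  change (Projectivization.mk ℂ v hv).submodule ≤ L ↔ _
  rw [Projectivization.submodule_mk, Submodule.span_singleton_le_iff_mem]

/-- Restriction of a polynomial to the line `u + ℂ w`, where `w` may be zero. -/
def lineRestrict {ι : Type} (u w : ι → ℂ) : MvPolynomial ι ℂ →ₐ[ℂ] Polynomial ℂ :=
  MvPolynomial.aeval fun i => Polynomial.C (u i) + Polynomial.C (w i) * Polynomial.X

theorem eval_lineRestrict {ι : Type} (u w : ι → ℂ) (F : MvPolynomial ι ℂ) (c : ℂ) :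
    (lineRestrict u w F).eval c = MvPolynomial.eval (u + c • w) F := by
  have := MvPolynomial.comp_aeval_apply
    (fun i => Polynomial.C (u i) + Polynomial.C (w i) * Polynomial.X) (Polynomial.aeval c) F
  rw [Polynomial.coe_aeval_eq_eval] at this
  rw [lineRestrict, this, MvPolynomial.aeval_eq_eval]
  have h : (fun i => Polynomial.eval c (Polynomial.C (u i) + Polynomial.C (w i) * Polynomial.X)) =
      u + c • w := by
    funext i
    rw [Polynomial.eval_add, Polynomial.eval_mul, Polynomial.eval_C, Polynomial.eval_C,
      Polynomial.eval_X, Pi.add_apply, Pi.smul_apply, smul_eq_mul, mul_comm]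
  rw [h]

theorem exists_eval_ne_zero {f : Polynomial ℂ} (hf : f ≠ 0) : ∃ c, f.eval c ≠ 0 :=
  Polynomial.exists_eval_ne_zero_of_natDegree_lt_card _ hf
      ((Cardinal.natCast_lt_aleph0).trans_le (Cardinal.aleph0_le_mk ℂ))

/-- Linear spaces are irreducible: polynomials `F` and `G` that do not vanish at `u` and `w`,
respectively, have nonzero restrictions to the line through `u` and `w`. -/
theorem isPrime_vanishingIdeal_linearPoints {L : Submodule ℂ (Vec n)} (hL : L ≠ ⊥) :
    (MvPolynomial.vanishingIdeal ℂ (affineCone (linearPoints L))).IsPrime := by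
  have hne : ∀ F, F ∉ MvPolynomial.vanishingIdeal ℂ (affineCone (linearPoints L)) →
      ∃ u ∈ L, u ≠ 0 ∧ MvPolynomial.eval u F ≠ 0 := by
    intro F hF
    rw [MvPolynomial.mem_vanishingIdeal_iff] at hF
    push Not at hF
    obtain ⟨u, ⟨hu, huX⟩, hne⟩ := hF
    exact ⟨u, (linearPoints_mk hu).1 huX, hu, by rwa [MvPolynomial.aeval_eq_eval] at hne⟩
  refine Ideal.isPrime_iff.2 ⟨?_, fun {F G} hFG => ?_⟩
  · rw [Ideal.ne_top_iff_one]
    intro h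
    obtain ⟨u, hu, hu0⟩ := L.exists_mem_ne_zero_of_ne_bot hL
    have := h u ⟨hu0, (linearPoints_mk hu0).2 hu⟩
    simp at this
  · by_contra! hcon
    obtain ⟨u, hu, hu0, hF⟩ := hne F hcon.1
    obtain ⟨w, hw, hw0, hG⟩ := hne G hcon.2
    obtain ⟨j, hj⟩ := Function.ne_iff.1 hu0
    let ev := lineRestrict u (w - u)
    have h1 : ev F ≠ 0 := fun h => hF (by
      have := eval_lineRestrict u (w - u) F 0
      rw [show lineRestrict u (w - u) F = 0 from h] at this
      simpa using this.symm)
    have h2 : ev G ≠ 0 := fun h => hG (by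
      have := eval_lineRestrict u (w - u) G 1
      rw [show lineRestrict u (w - u) G = 0 from h] at this
      simpa using this.symm)
    have h3 : ev (MvPolynomial.X j) ≠ 0 := fun h => hj (by
      have := eval_lineRestrict u (w - u) (MvPolynomial.X j) 0
      rw [show lineRestrict u (w - u) (MvPolynomial.X j) = 0 from h] at this
      simpa using this.symm)
    obtain ⟨c, hc⟩ := exists_eval_ne_zero (mul_ne_zero (mul_ne_zero h1 h2) h3)
    rw [Polynomial.eval_mul, Polynomial.eval_mul, eval_lineRestrict, eval_lineRestrict,
      eval_lineRestrict, MvPolynomial.eval_X] at hc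
    have hne : u + c • (w - u) ≠ 0 := fun h => right_ne_zero_of_mul hc (by rw [h]; rfl)
    have h4 := hFG (u + c • (w - u)) ⟨hne, (linearPoints_mk hne).2
      (L.add_mem hu (L.smul_mem c (L.sub_mem hw hu)))⟩
    rw [MvPolynomial.aeval_eq_eval, map_mul] at h4
    exact left_ne_zero_of_mul hc h4

theorem isIrreducible_linearPoints {L : Submodule ℂ (Vec n)} (hL : L ≠ ⊥) :
    IsIrreducible (linearPoints L) :=
  isIrreducible_of_isPrime (isPrime_vanishingIdeal_linearPoints hL)

theorem isClosed_linearPoints (L : Submodule ℂ (Vec n)) : IsClosed (linearPoints L) := by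
  rw [← isOpen_compl_iff, isOpen_PSpace_iff]
  intro v hv hvL
  rw [Set.mem_compl_iff, linearPoints_mk] at hvL
  obtain ⟨f, hf1, hf2⟩ := Submodule.exists_le_ker_of_notMem hvL
  let F : MvPolynomial (Fin (n + 1)) ℂ := ∑ i, MvPolynomial.C (f (Pi.single i 1)) * MvPolynomial.X i
  have hF : ∀ w, MvPolynomial.eval w F = f w := by
    intro w
    conv_rhs => rw [pi_eq_sum_univ' w, map_sum]
    simp [F, mul_comm]
  refine ⟨F, by rwa [hF], fun w hw hne hmem => ?_⟩
  rw [linearPoints_mk] at hmem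
  exact hne (by rw [hF]; exact hf2 hmem)

theorem linearPoints_submodule (Q : PSpace n) : linearPoints Q.submodule = {Q} := by
  ext P
  induction P using Projectivization.ind with | _ v hv
  induction Q using Projectivization.ind with | _ w hw
  rw [linearPoints_mk, Projectivization.submodule_mk, Submodule.mem_span_singleton,
    Set.mem_singleton_iff, Projectivization.mk_eq_mk_iff']

theorem isClosed_singleton_PSpace (Q : PSpace n) : IsClosed {Q} := by
  rw [← linearPoints_submodule]; exact isClosed_linearPoints _

/-- A chain of irreducible closed sets bounds the dimension from below. -/
theorem le_topologicalKrullDim {X : Set (PSpace n)} {d : ℕ} (Z : Fin (d + 1) → Set (PSpace n))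
    (hZ : StrictMono Z) (hc : ∀ i, IsClosed (Z i)) (hi : ∀ i, IsIrreducible (Z i))
    (hX : ∀ i, Z i ⊆ X) : (d : WithBot ℕ∞) ≤ topologicalKrullDim X := by
  have himg : ∀ i, Subtype.val '' (Subtype.val ⁻¹' Z i : Set X) = Z i := fun i => by
    rw [Subtype.image_preimage_coe, Set.inter_eq_right.2 (hX i)]
  let f : Fin (d + 1) → TopologicalSpace.IrreducibleCloseds X := fun i =>
    ⟨Subtype.val ⁻¹' Z i, by
      refine ⟨?_, ?_⟩
      · have := (hi i).1
        rw [← himg i] at this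
        exact this.of_image
      · rintro _ _ ⟨U, hU, rfl⟩ ⟨V, hV, rfl⟩ ⟨x, hx, hxU⟩ ⟨y, hy, hyV⟩
        obtain ⟨z, hz, hzUV⟩ := (hi i).2 U V hU hV ⟨x, hx, hxU⟩ ⟨y, hy, hyV⟩
        exact ⟨⟨z, hX i hz⟩, hz, hzUV⟩, (hc i).preimage continuous_subtype_val⟩
  have hf : StrictMono f := by
    intro i j hij
    have := hZ hij
    rw [← himg i, ← himg j] at this
    constructor
    · exact (Set.image_subset_image_iff Subtype.val_injective).1 this.1
    · exact fun h => this.2 ((Set.image_subset_image_iff Subtype.val_injective).2 h)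
  exact Order.LTSeries.length_le_krullDim (LTSeries.mk d f hf)

/-- The dimension of a projective variety is less than the dimension of the tangent space of its
cone at the generic point. A chain of irreducible closed subsets gives a chain of primes of the
homogeneous coordinate ring, which can be prolonged by the irrelevant ideal. -/
theorem topologicalKrullDim_le_of_genericTangent {X : Set (PSpace n)}
    {ξ : Fin (n + 1) → Ω} (hξ : IsGenericPointOf ξ (affineCone X)) {d : ℕ}
    {w : Fin (d + 1) → Fin (n + 1) → Ω}
    (hw : genericTangent ξ ≤ Submodule.span Ω (Set.range w)) :
    topologicalKrullDim X ≤ d := by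
  let I := RingHom.ker (MvPolynomial.aeval (R := ℂ) ξ)
  have : I.IsPrime := RingHom.ker_isPrime _
  obtain ⟨s, y, hy, hs⟩ := exists_algebraicIndependent_ringKrullDim_le
    (MvPolynomial (Fin (n + 1)) ℂ ⧸ I)
  choose G hG using fun k => Ideal.Quotient.mk_surjective (y k)
  have hsd : s ≤ d + 1 := by
    have := card_le_of_algebraicIndependent hw G (by
      let a : (MvPolynomial (Fin (n + 1)) ℂ ⧸ I) →ₐ[ℂ] Ω :=
        Ideal.Quotient.liftₐ I (MvPolynomial.aeval ξ) fun F hF => hF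
      have ha : Function.Injective a := by
        rw [injective_iff_map_eq_zero]
        intro y
        obtain ⟨F, rfl⟩ := Ideal.Quotient.mk_surjective y
        exact fun hF => Ideal.Quotient.eq_zero_iff_mem.2 hF
      have h := hy.map' ha
      convert h using 1
      funext k
      rw [Function.comp_apply, ← hG k]
      rfl)
    simpa using this
  -- irreducible closed subsets of `X` give primes of the coordinate ring of the cone
  let P : TopologicalSpace.IrreducibleCloseds X → Ideal (MvPolynomial (Fin (n + 1)) ℂ) := fun Z =>
    MvPolynomial.vanishingIdeal ℂ (affineCone (Subtype.val '' (Z : Set X)))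
  have hPprime : ∀ Z, (P Z).IsPrime := fun Z => isPrime_vanishingIdeal_affineCone
    (Z.isIrreducible.image _ continuous_subtype_val.continuousOn)
  have hPI : ∀ Z, I ≤ P Z := by
    rintro Z F hF v ⟨hv, ⟨z, -, hz⟩⟩
    exact (hξ F).2 hF v ⟨hv, hz ▸ z.2⟩
  have hanti : ∀ Z Z', Z ≤ Z' → P Z' ≤ P Z := fun Z Z' h =>
    MvPolynomial.vanishingIdeal_anti_mono fun v ⟨hv, hv'⟩ => ⟨hv, Set.image_mono h hv'⟩
  have hinj : ∀ Z Z', P Z' ≤ P Z → Z ≤ Z' := by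
    rintro Z Z' h ⟨Q, hQ⟩ hQZ
    induction Q using Projectivization.ind with | _ v hv
    obtain ⟨T, hT, hTZ⟩ := isClosed_induced_iff.1 Z'.isClosed
    have hm : Projectivization.mk ℂ v hv ∈ closure (Subtype.val '' (Z' : Set X)) := by
      rw [mk_mem_closure_iff]
      intro F hF
      have := h hF v ⟨hv, ⟨_, hQZ, rfl⟩⟩
      rwa [MvPolynomial.aeval_eq_eval] at this
    have hsub : Subtype.val '' (Z' : Set X) ⊆ T := by
      rw [← hTZ]; exact Set.image_preimage_subset _ _
    have := closure_minimal hsub hT hm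
    change _ ∈ (Z' : Set X)
    rw [← hTZ]
    exact this
  let f : TopologicalSpace.IrreducibleCloseds X →
      (PrimeSpectrum (MvPolynomial (Fin (n + 1)) ℂ ⧸ I))ᵒᵈ := fun Z => OrderDual.toDual
    ⟨(P Z).map (Ideal.Quotient.mk I), by
      have := hPprime Z
      exact Ideal.map_isPrime_of_surjective Ideal.Quotient.mk_surjective
        (by rw [Ideal.mk_ker]; exact hPI Z)⟩
  have hcomap : ∀ J : Ideal (MvPolynomial (Fin (n + 1)) ℂ), I ≤ J →
      (J.map (Ideal.Quotient.mk I)).comap (Ideal.Quotient.mk I) = J := fun J hJ => by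
    rw [Ideal.comap_map_of_surjective' _ Ideal.Quotient.mk_surjective, Ideal.mk_ker,
      sup_eq_left.2 hJ]
  have hf : StrictMono f := by
    intro Z Z' hlt
    change (P Z').map (Ideal.Quotient.mk I) < (P Z).map (Ideal.Quotient.mk I)
    refine lt_of_le_not_ge (Ideal.map_mono (hanti _ _ hlt.le)) fun h => hlt.not_ge (hinj _ _ ?_)
    have := Ideal.comap_mono (f := Ideal.Quotient.mk I) h
    rwa [hcomap _ (hPI _), hcomap _ (hPI _)] at this
  -- the irrelevant ideal lies strictly above the primes of the points of `X`
  let m0 : Ideal (MvPolynomial (Fin (n + 1)) ℂ) := MvPolynomial.vanishingIdeal ℂ {(0 : Vec n)}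
  have hm0 : ∀ Z, P Z < m0 := by
    intro Z
    obtain ⟨⟨Q, hQX⟩, hQ⟩ := Z.isIrreducible.1
    induction Q using Projectivization.ind with | _ v hv
    have hcv : ∀ c : ℂ, c ≠ 0 → c • v ∈ affineCone (Subtype.val '' (Z : Set X)) := fun c hc =>
      ⟨smul_ne_zero hc hv, ⟨_, hQ, ((Projectivization.mk_eq_mk_iff' ℂ _ _ _ _).2 ⟨c, rfl⟩).symm⟩⟩
    refine lt_of_le_not_ge (fun F hF => ?_) fun h => ?_
    · rw [MvPolynomial.mem_vanishingIdeal_singleton_iff, MvPolynomial.aeval_eq_eval]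
      by_contra hne
      have h1 : lineRestrict 0 v F ≠ 0 := fun h => hne (by
        have := eval_lineRestrict 0 v F 0
        rw [h] at this
        simpa using this.symm)
      obtain ⟨c, hc⟩ := exists_eval_ne_zero (mul_ne_zero h1 Polynomial.X_ne_zero)
      rw [Polynomial.eval_mul, Polynomial.eval_X, eval_lineRestrict, zero_add] at hc
      have := hF _ (hcv c (right_ne_zero_of_mul hc))
      rw [MvPolynomial.aeval_eq_eval] at this
      exact left_ne_zero_of_mul hc this
    · obtain ⟨j, hj⟩ := Function.ne_iff.1 hv
      have hX : MvPolynomial.X j ∈ m0 := by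
        rw [MvPolynomial.mem_vanishingIdeal_singleton_iff]; simp
      have := h hX (1 • v) (by simpa using hcv 1 one_ne_zero)
      simp at this
      exact hj this
  refine iSup_le fun p => ?_
  let q := p.map f hf
  have hm0prime : m0.IsPrime := by
    refine Ideal.isPrime_iff.2 ⟨?_, fun {F G} hFG => ?_⟩
    · rw [Ideal.ne_top_iff_one]
      intro h
      have := h 0 rfl
      simp at this
    · simp only [m0, MvPolynomial.mem_vanishingIdeal_singleton_iff] at hFG ⊢
      rwa [map_mul, mul_eq_zero] at hFG
  have hIm : I ≤ m0 := (hPI p.head).trans (hm0 _).le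
  let M0 : (PrimeSpectrum (MvPolynomial (Fin (n + 1)) ℂ ⧸ I))ᵒᵈ := OrderDual.toDual
    ⟨m0.map (Ideal.Quotient.mk I), Ideal.map_isPrime_of_surjective Ideal.Quotient.mk_surjective
        (by rw [Ideal.mk_ker]; exact hIm)⟩
  have hlt : M0 < q.head := by
    change (P p.head).map (Ideal.Quotient.mk I) < m0.map (Ideal.Quotient.mk I)
    refine lt_of_le_not_ge (Ideal.map_mono (hm0 _).le) fun h => (hm0 p.head).not_ge ?_
    have := Ideal.comap_mono (f := Ideal.Quotient.mk I) h
    rwa [hcomap _ (hPI _), hcomap _ hIm] at this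
  have h1 := Order.LTSeries.length_le_krullDim (RelSeries.cons q M0 hlt)
  rw [Order.krullDim_orderDual] at h1
  have h2 := h1.trans hs
  have h3 : (RelSeries.cons q M0 hlt).length = p.length + 1 := by
    rw [show (RelSeries.cons q M0 hlt).length = 0 + q.length + 1 from rfl,
      show q.length = p.length from rfl, zero_add]
  rw [h3] at h2
  have h4 : p.length + 1 ≤ s := by exact_mod_cast h2
  have h5 : p.length ≤ d := by omega
  exact_mod_cast h5

end Dimension

/-! ### Polynomial maps and tangent vectors -/

section TangentMap

variable {ι κ : Type} [Fintype ι] [Fintype κ]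

theorem differential_rename {R : Type} [CommRing R] [Algebra ℂ R] (x v : ι → R) (f : κ → ι)
    (F : MvPolynomial κ ℂ) :
    differential x v (MvPolynomial.rename f F) =
      differential (fun k => x (f k)) (fun k => v (f k)) F := by
  have := differential_bind₁ x v (fun k => MvPolynomial.X (f k)) F
  rw [show MvPolynomial.bind₁ (fun k => MvPolynomial.X (f k)) F = MvPolynomial.rename f F from
    AlgHom.congr_fun (MvPolynomial.algHom_ext (f := MvPolynomial.bind₁ fun k => MvPolynomial.X (f k))
      (g := MvPolynomial.rename f) (by simp)) F] at this
  rw [this]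
  simp only [MvPolynomial.aeval_X, differential_X]

theorem mem_zariskiTangent_of_map {Z : Set (ι → ℂ)} {Z' : Set (κ → ℂ)} (g : κ → MvPolynomial ι ℂ)
    (hg : ∀ F ∈ MvPolynomial.vanishingIdeal ℂ Z',
      MvPolynomial.bind₁ g F ∈ MvPolynomial.vanishingIdeal ℂ Z)
    {x v : ι → ℂ} (hv : v ∈ zariskiTangent Z x) :
    (fun k => differential x v (g k)) ∈
      zariskiTangent Z' (fun k => MvPolynomial.eval x (g k)) := by
  rw [mem_zariskiTangent_iff] at hv ⊢
  intro F hF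
  have := hv _ (hg F hF)
  rw [differential_bind₁] at this
  simpa only [MvPolynomial.aeval_eq_eval] using this

/-- A polynomial map that maps `Z` into `Z'` maps tangent vectors to tangent vectors. -/
theorem mem_zariskiTangent_of_mapsTo {Z : Set (ι → ℂ)} {Z' : Set (κ → ℂ)}
    (g : κ → MvPolynomial ι ℂ)
    (hg : ∀ x ∈ Z, (fun k => MvPolynomial.eval x (g k)) ∈ Z')
    {x v : ι → ℂ} (hv : v ∈ zariskiTangent Z x) :
    (fun k => differential x v (g k)) ∈
      zariskiTangent Z' (fun k => MvPolynomial.eval x (g k)) := by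
  refine mem_zariskiTangent_of_map g (fun F hF y hy => ?_) hv
  have := hF _ (hg y hy)
  rwa [MvPolynomial.aeval_eq_eval, eval_bind₁, ← MvPolynomial.aeval_eq_eval]

end TangentMap

/-! ### Tangent vectors of incidence varieties -/

section Incidence

variable {r n : ℕ}

/-- The rows of a matrix written as a vector. -/
def matRow {R : Type} (w : Fin (r + 1) × Fin (n + 1) → R) (i : Fin (r + 1)) : Fin (n + 1) → R :=
  fun j => w (i, j)

theorem Frame.mem_span_iff {b : Frame r n} {u : Vec n} :
    u ∈ b.span.1 ↔ ∃ a : Fin (r + 1) → ℂ, u = ∑ i, a i • b.1 i := by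
  change u ∈ Submodule.span ℂ (Set.range b.1) ↔ _
  rw [Submodule.mem_span_range_iff_exists_fun]
  exact exists_congr fun _ => eq_comm

theorem mk_smul_eq {c : ℂ} (hc : c ≠ 0) {q : Vec n} (hq : q ≠ 0) :
    Projectivization.mk ℂ (c • q) (smul_ne_zero hc hq) = Projectivization.mk ℂ q hq :=
  (Projectivization.mk_eq_mk_iff' ℂ _ _ _ _).2 ⟨c, rfl⟩

/-- Focality can be tested on any representative of the point and any frame. -/
theorem isFocal_iff {I : Set (PSpace n × Grass r n)} {q : Vec n} (hq : q ≠ 0) (b : Frame r n) :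
    IsFocal I (Projectivization.mk ℂ q hq) b.span ↔
      (Projectivization.mk ℂ q hq, b.span) ∈ I ∧
      ∃ v ∈ zariskiTangent (incidenceFrames I) (Sum.elim q b.coords),
        (fun j => v (Sum.inl j)) ∈ Submodule.span ℂ {q} ∧
        ∃ i, (fun j => v (Sum.inr (i, j))) ∉ b.span.1 := by
  constructor
  · rintro ⟨hI, q', hq', b', hqq, hbb, v, hv, hvq, hvb⟩
    refine ⟨hI, ?_⟩
    obtain ⟨c, hc⟩ := (Projectivization.mk_eq_mk_iff' ℂ q q' hq hq').1 hqq.symm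
    have hc0 : c ≠ 0 := fun h => hq (by rw [← hc, h, zero_smul])
    obtain ⟨h, hh, hb⟩ := Frame.exists_act_eq hbb.symm
    let g : Fin (n + 1) ⊕ Fin (r + 1) × Fin (n + 1) →
        MvPolynomial (Fin (n + 1) ⊕ Fin (r + 1) × Fin (n + 1)) ℂ :=
      Sum.elim (fun j => MvPolynomial.C c * MvPolynomial.X (Sum.inl j))
        (fun ij => ∑ k, MvPolynomial.C (h ij.1 k) * MvPolynomial.X (Sum.inr (k, ij.2)))
    have hg : ∀ (q'' : Vec n) (b'' : Frame r n),
        (fun k => MvPolynomial.eval (Sum.elim q'' b''.coords) (g k)) =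
          Sum.elim (c • q'') (b''.act h hh).coords := by
      intro q'' b''
      funext k
      rcases k with j | ij
      · simp [g]
      · simp [g, Frame.coords_act]
    have h1 := mem_zariskiTangent_of_mapsTo (Z := incidenceFrames I) (Z' := incidenceFrames I) g (by
      rintro _ ⟨q'', hq'', b'', rfl, hmem⟩
      refine ⟨c • q'', smul_ne_zero hc0 hq'', b''.act h hh, hg q'' b'', ?_⟩
      rw [mk_smul_eq hc0 hq'', Frame.span_act]
      exact hmem) hv
    rw [hg, hc, ← hb] at h1
    have hl : (fun j => differential (Sum.elim q' b'.coords) v (g (Sum.inl j))) =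
        c • fun j => v (Sum.inl j) := by
      funext j
      simp [g, differential_mul, differential_C, differential_X]
    have hr : ∀ i, (fun j => differential (Sum.elim q' b'.coords) v (g (Sum.inr (i, j)))) =
        ∑ k, h i k • fun j => v (Sum.inr (k, j)) := by
      intro i
      funext j
      simp [g, differential_sum, differential_mul, differential_C, differential_X]
    refine ⟨_, h1, ?_, ?_⟩
    · rw [hl, ← hc, Submodule.span_singleton_smul_eq hc0.isUnit]
      exact Submodule.smul_mem _ _ hvq
    · by_contra! hcon
      obtain ⟨i, hi⟩ := hvb
      apply hi
      have h2 : (fun j => v (Sum.inr (i, j))) =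
          ∑ k, h⁻¹ i k • ∑ l, h k l • fun j => v (Sum.inr (l, j)) := by
        have h3 : ∀ l, ∑ k, h⁻¹ i k * h k l = if i = l then 1 else 0 := fun l => by
          have := congrFun (congrFun (Matrix.nonsing_inv_mul h (hh.isUnit)) i) l
          simpa [Matrix.mul_apply, Matrix.one_apply] using this
        simp only [Finset.smul_sum, smul_smul]
        rw [Finset.sum_comm]
        simp only [← Finset.sum_smul, h3]
        simp
      rw [h2]
      refine Submodule.sum_mem _ fun k _ => Submodule.smul_mem _ _ ?_
      rw [← hr]
      exact hcon k
  · rintro ⟨hI, v, hv, hvq, hvb⟩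
    exact ⟨hI, q, hq, b, rfl, rfl, v, hv, hvq, hvb⟩

/-- The projection of an incidence variety to the family maps tangent vectors to tangent
vectors. -/
theorem mem_zariskiTangent_framesOf {C : Set (Grass r n)} {I : Set (PSpace n × Grass r n)}
    (hI : ∀ x ∈ I, x.2 ∈ C) {q : Vec n} {b : Frame r n}
    {v : Fin (n + 1) ⊕ Fin (r + 1) × Fin (n + 1) → ℂ}
    (hv : v ∈ zariskiTangent (incidenceFrames I) (Sum.elim q b.coords)) :
    (fun ij => v (Sum.inr ij)) ∈ zariskiTangent (framesOf C) b.coords := by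
  have := mem_zariskiTangent_of_mapsTo (Z' := framesOf C)
    (fun ij => MvPolynomial.X (Sum.inr ij)) (by
      rintro _ ⟨q'', hq'', b'', rfl, hmem⟩
      exact ⟨b'', by funext ij; simp, hI _ hmem⟩) hv
  simpa [differential_X] using this

/-- A one-dimensional tangent space of `C`, in terms of frames: there is a tangent vector `w₀` that
moves the member of the family, and all other tangent vectors are multiples of it up to vectors
that do not move the member. -/
theorem exists_mem_zariskiTangent_of_finrank_eq_one {C : Set (Grass r n)} {b : Frame r n}
    (h : Module.finrank ℂ (tangentSpace C b) = 1) :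
    ∃ w₀ ∈ zariskiTangent (framesOf C) b.coords, (∃ i, matRow w₀ i ∉ b.span.1) ∧
      ∀ w ∈ zariskiTangent (framesOf C) b.coords, ∃ c : ℂ, ∀ i,
        matRow w i - c • matRow w₀ i ∈ b.span.1 := by
  obtain ⟨⟨y, hy⟩, hne, hspan⟩ := finrank_eq_one_iff'.1 h
  obtain ⟨w₀, hw₀, rfl⟩ := hy
  refine ⟨w₀, hw₀, ?_, fun w hw => ?_⟩
  · by_contra! hcon
    apply hne
    apply Subtype.ext
    funext i
    exact (Submodule.Quotient.mk_eq_zero _).2 (hcon i)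
  · obtain ⟨c, hc⟩ := hspan ⟨_, Submodule.mem_map_of_mem hw⟩
    refine ⟨c, fun i => ?_⟩
    have := congrFun (congrArg Subtype.val hc) i
    exact (Submodule.Quotient.eq _).1 this.symm

variable {Ω : Type} [Field Ω] [Algebra ℂ Ω] {C : Set (Grass r n)}
  {β : Fin (r + 1) × Fin (n + 1) → Ω}

theorem IsGenericPointOf.eval_eq_zero {ι : Type} [Fintype ι] {ξ : ι → Ω} {Z : Set (ι → ℂ)}
    (h : IsGenericPointOf ξ Z) {x : ι → ℂ} (hx : x ∈ Z) (F : MvPolynomial ι ℂ)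
    (hF : MvPolynomial.aeval ξ F = 0) : MvPolynomial.eval x F = 0 := by
  have := (h F).2 hF x hx
  rwa [MvPolynomial.aeval_eq_eval] at this

/-- The vector of values at `x` of a vector of polynomials. -/
def evalVec {ι : Type} (x : ι → ℂ) (κ : Fin (n + 1) → MvPolynomial ι ℂ) : Vec n :=
  fun j => MvPolynomial.eval x (κ j)

/-- The vector of values at a generic point `β` of a vector of polynomials. -/
def aevalVec {ι : Type} (β : ι → Ω) (κ : Fin (n + 1) → MvPolynomial ι ℂ) : Fin (n + 1) → Ω :=
  fun j => MvPolynomial.aeval β (κ j)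

/-- The derivative at `x` in the direction `w` of a vector of polynomials. -/
def diffVec {R ι : Type} [CommRing R] [Algebra ℂ R] [Fintype ι] (x w : ι → R)
    (κ : Fin (n + 1) → MvPolynomial ι ℂ) : Fin (n + 1) → R :=
  fun j => differential x w (κ j)

/-- A vector orthogonal to independent values of polynomial sections extends to a polynomial family
orthogonal to the sections. -/
theorem exists_polynomial_functional (hβ : IsGenericPointOf β (framesOf C)) {b : Frame r n}
    (hb : b.span ∈ C) {m : ℕ}
    {κ : Fin m → Fin (n + 1) → MvPolynomial (Fin (r + 1) × Fin (n + 1)) ℂ}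
    (hκ : LinearIndependent ℂ fun i => evalVec b.coords (κ i))
    {l₀ : Vec n} (hl₀ : ∀ i, ∑ j, evalVec b.coords (κ i) j * l₀ j = 0) :
    ∃ l : Fin (n + 1) → MvPolynomial (Fin (r + 1) × Fin (n + 1)) ℂ,
      (∀ i, ∑ j, aevalVec β (κ i) j * aevalVec β l j = 0) ∧ evalVec b.coords l = l₀ := by
  let R : Matrix (Fin m) (Fin (n + 1)) (MvPolynomial (Fin (r + 1) × Fin (n + 1)) ℂ) :=
    Matrix.of κ
  have hRb : R.map (MvPolynomial.eval b.coords) = Matrix.of fun i => evalVec b.coords (κ i) := rfl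
  obtain ⟨l, h1, h2⟩ := exists_polynomial_mem_ker R (ξ := β) (x := b.coords) (v₀ := l₀)
    (hβ.eval_eq_zero ⟨b, rfl, hb⟩) (by
      rw [hRb, LinearIndependent.rank_matrix (M := Matrix.of fun i => evalVec b.coords (κ i)) hκ]
      exact Matrix.rank_le_card_height _) (by
      rw [hRb]
      funext i
      exact hl₀ i)
  exact ⟨l, fun i => congrFun h1 i, funext h2⟩

/-- Upper bound for tangent vectors `(v, w)` of an incidence variety `I` of linear spaces that
generically are spanned by the sections `κ i`: at `(∑ aᵢ κᵢ(b), b)` one has `v = ∑ aᵢ dκᵢ(w)` modulo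
the span of the `κᵢ(b)`. Here it is essential that each point of each member of `I` is the value of
a polynomial section `κ'` with values in the generic member. -/
theorem sub_mem_span_of_mem_zariskiTangent (hβ : IsGenericPointOf β (framesOf C)) {b : Frame r n}
    (hb : b.span ∈ C) {I : Set (PSpace n × Grass r n)} (hIC : ∀ x ∈ I, x.2 ∈ C) {m : ℕ}
    {κ : Fin m → Fin (n + 1) → MvPolynomial (Fin (r + 1) × Fin (n + 1)) ℂ}
    (hκ : LinearIndependent ℂ fun i => evalVec b.coords (κ i))
    (hI : ∀ (q : Vec n) (hq : q ≠ 0) (b' : Frame r n),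
      (Projectivization.mk ℂ q hq, b'.span) ∈ I →
      ∃ κ' : Fin (n + 1) → MvPolynomial (Fin (r + 1) × Fin (n + 1)) ℂ,
        aevalVec β κ' ∈ Submodule.span Ω (Set.range fun i => aevalVec β (κ i)) ∧
        evalVec b'.coords κ' = q)
    (a : Fin m → ℂ) {v : Fin (n + 1) ⊕ Fin (r + 1) × Fin (n + 1) → ℂ}
    (hv : v ∈ zariskiTangent (incidenceFrames I)
      (Sum.elim (∑ i, a i • evalVec b.coords (κ i)) b.coords)) :
    (fun j => v (Sum.inl j)) - ∑ i, a i • diffVec b.coords (fun ij => v (Sum.inr ij)) (κ i) ∈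
      Submodule.span ℂ (Set.range fun i => evalVec b.coords (κ i)) := by
  by_contra hne
  obtain ⟨f, hf1, hf2⟩ := Submodule.exists_le_ker_of_notMem hne
  have hf : ∀ u : Vec n, f u = ∑ j, u j * f (Pi.single j 1) := fun u => by
    conv_lhs => rw [pi_eq_sum_univ' u, map_sum]
    simp
  obtain ⟨l, hl1, hl2⟩ := exists_polynomial_functional hβ hb hκ
    (l₀ := fun j => f (Pi.single j 1)) fun i => by
      rw [← hf]
      exact hf2 (Submodule.subset_span ⟨i, rfl⟩)
  have hl2' : ∀ j, MvPolynomial.eval b.coords (l j) = f (Pi.single j 1) := fun j => congrFun hl2 j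
  have hw := mem_zariskiTangent_framesOf (C := C) hIC hv
  rw [mem_zariskiTangent_iff] at hv hw
  -- a functional that separates the difference from the span extends to a polynomial family `l` of
  -- equations of `I`; the claim results from the differentials of `∑ j, κ i j * l j` and of
  -- `∑ j, q j * l j`, where `q j` are the coordinates of the point
  have hG : ∀ κ' : Fin (n + 1) → MvPolynomial (Fin (r + 1) × Fin (n + 1)) ℂ,
      aevalVec β κ' ∈ Submodule.span Ω (Set.range fun i => aevalVec β (κ i)) →
      (∑ j, κ' j * l j) ∈ MvPolynomial.vanishingIdeal ℂ (framesOf C) := fun κ' hκ' => by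
    rw [hβ]
    have : ∑ j, aevalVec β κ' j * aevalVec β l j = 0 := by
      generalize aevalVec β κ' = u at hκ'
      induction hκ' using Submodule.span_induction with
      | mem x hx => obtain ⟨i, rfl⟩ := hx; exact hl1 i
      | zero => simp
      | add x y _ _ hx hy => simp [add_mul, Finset.sum_add_distrib, hx, hy]
      | smul c x _ hx => simp [mul_assoc, ← Finset.mul_sum, hx]
    simpa [aevalVec] using this
  have e1 : ∀ i, ∑ j, (diffVec b.coords (fun ij => v (Sum.inr ij)) (κ i) j * f (Pi.single j 1) +
      evalVec b.coords (κ i) j * differential b.coords (fun ij => v (Sum.inr ij)) (l j)) = 0 :=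
    fun i => by
    have := hw _ (hG (κ i) (Submodule.subset_span ⟨i, rfl⟩))
    rw [differential_sum] at this
    rw [← this]
    refine Finset.sum_congr rfl fun j _ => ?_
    rw [differential_mul, MvPolynomial.aeval_eq_eval, hl2']
    rfl
  have hren : ∀ F : MvPolynomial (Fin (r + 1) × Fin (n + 1)) ℂ,
      differential (Sum.elim (∑ i, a i • evalVec b.coords (κ i)) b.coords) v
        (MvPolynomial.rename Sum.inr F) =
        differential b.coords (fun ij => v (Sum.inr ij)) F := fun F => by
    exact differential_rename _ _ _ _
  have hH : (∑ j, MvPolynomial.X (Sum.inl j) * MvPolynomial.rename Sum.inr (l j)) ∈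
      MvPolynomial.vanishingIdeal ℂ (incidenceFrames I) := by
    rintro _ ⟨q', hq', b', rfl, hmem⟩
    obtain ⟨κ', h1, rfl⟩ := hI q' hq' b' hmem
    have e := hG κ' h1 _ ⟨b', rfl, hIC _ hmem⟩
    rw [MvPolynomial.aeval_eq_eval] at e
    simpa only [map_sum, map_mul, MvPolynomial.aeval_X, MvPolynomial.aeval_rename,
      Sum.elim_comp_inr, Sum.elim_inl, MvPolynomial.aeval_eq_eval, evalVec] using e
  have e2 := hv _ hH
  rw [differential_sum] at e2
  have e3 : ∑ j, (v (Sum.inl j) * f (Pi.single j 1) +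
      (∑ i, a i • evalVec b.coords (κ i)) j *
        differential b.coords (fun ij => v (Sum.inr ij)) (l j)) = 0 := by
    rw [← e2]
    refine Finset.sum_congr rfl fun j _ => ?_
    rw [differential_mul, differential_X, MvPolynomial.aeval_X, MvPolynomial.aeval_rename, hren,
      Sum.elim_comp_inr, MvPolynomial.aeval_eq_eval, hl2']
    rfl
  apply hf1
  rw [map_sub, map_sum, hf]
  simp only [map_smul, smul_eq_mul]
  simp_rw [hf (diffVec _ _ _)]
  rw [Finset.sum_add_distrib] at e3
  have e4 : ∑ j, (∑ i, a i • evalVec b.coords (κ i)) j *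
        differential b.coords (fun ij => v (Sum.inr ij)) (l j) =
      ∑ i, a i * ∑ j, evalVec b.coords (κ i) j *
        differential b.coords (fun ij => v (Sum.inr ij)) (l j) := by
    simp only [Finset.sum_apply, Pi.smul_apply, smul_eq_mul, Finset.sum_mul, Finset.mul_sum]
    rw [Finset.sum_comm]
    exact Finset.sum_congr rfl fun _ _ => Finset.sum_congr rfl fun _ _ => by ring
  have e5 : ∀ i, ∑ j, evalVec b.coords (κ i) j *
        differential b.coords (fun ij => v (Sum.inr ij)) (l j) =
      - ∑ j, diffVec b.coords (fun ij => v (Sum.inr ij)) (κ i) j * f (Pi.single j 1) := fun i => by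
    have := e1 i
    rw [Finset.sum_add_distrib] at this
    exact (neg_eq_of_add_eq_zero_right this).symm
  rw [e4] at e3
  simp only [e5, mul_neg, Finset.sum_neg_distrib] at e3
  rw [← e3]; ring

/-- A polynomial section of an incidence variety `I` maps tangent vectors of `C` to tangent vectors
of `I`, even at points where the value of the section does not belong to `I`. -/
theorem mem_zariskiTangent_incidenceFrames (hβ : IsGenericPointOf β (framesOf C))
    {I : Set (PSpace n × Grass r n)}
    (κ : Fin (n + 1) → MvPolynomial (Fin (r + 1) × Fin (n + 1)) ℂ)
    (hκ : ∀ᶠ φ in genericFilter Ω, Sum.elim (evalVec (fun ij => φ (β ij)) κ)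
      (fun ij => φ (β ij)) ∈ incidenceFrames I) {b : Frame r n}
    {w : Fin (r + 1) × Fin (n + 1) → ℂ} (hw : w ∈ zariskiTangent (framesOf C) b.coords) :
    Sum.elim (diffVec b.coords w κ) w ∈ zariskiTangent (incidenceFrames I)
      (Sum.elim (evalVec b.coords κ) b.coords) := by
  have he : ∀ y : Fin (r + 1) × Fin (n + 1) → ℂ, (fun k => MvPolynomial.eval y
      ((Sum.elim κ fun ij => MvPolynomial.X ij : _ → MvPolynomial _ ℂ) k)) =
      Sum.elim (evalVec y κ) y := fun y => by
    funext k
    rcases k with j | ij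
    · rfl
    · exact MvPolynomial.eval_X _
  have := mem_zariskiTangent_of_map (Z' := incidenceFrames I)
    (Sum.elim κ fun ij => MvPolynomial.X ij) (fun F hF => by
      rw [hβ]
      apply aeval_eq_zero_of_eventually
      filter_upwards [hκ] with φ hφ
      rw [eval_bind₁, he]
      have := hF _ hφ
      rwa [MvPolynomial.aeval_eq_eval] at this) hw
  rw [he] at this
  convert this using 1
  funext k
  rcases k with j | ij
  · rfl
  · exact (differential_X b.coords w ij).symm

/-- Lower bound for the focal locus of an incidence variety `I`: let the sections `κ i` span linear
spaces that generically are contained in the members of `I`. If `∑ aᵢ dκᵢ(w)` lies in the span of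
the `κᵢ(b)`, for some nonzero tangent vector `w` of `C`, then `∑ aᵢ κᵢ(b)` is a focal point. -/
theorem isFocal_of_diffVec_mem (hβ : IsGenericPointOf β (framesOf C)) {b : Frame r n}
    {I : Set (PSpace n × Grass r n)} {m : ℕ}
    {κ : Fin m → Fin (n + 1) → MvPolynomial (Fin (r + 1) × Fin (n + 1)) ℂ}
    (hI : ∀ κ' : Fin (n + 1) → MvPolynomial (Fin (r + 1) × Fin (n + 1)) ℂ,
      aevalVec β κ' ∈ Submodule.span Ω (Set.range fun i => aevalVec β (κ i)) →
      aevalVec β κ' ≠ 0 → ∀ᶠ φ in genericFilter Ω,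
        Sum.elim (evalVec (fun ij => φ (β ij)) κ') (fun ij => φ (β ij)) ∈ incidenceFrames I)
    (hb : b.span ∈ C) {w : Fin (r + 1) × Fin (n + 1) → ℂ}
    (hw : w ∈ zariskiTangent (framesOf C) b.coords) (hwb : ∃ i, matRow w i ∉ b.span.1)
    (a : Fin m → ℂ)
    (ha : ∑ i, a i • diffVec b.coords w (κ i) ∈
      Submodule.span ℂ (Set.range fun i => evalVec b.coords (κ i)))
    (hq : ∑ i, a i • evalVec b.coords (κ i) ≠ 0)
    (hmem : (Projectivization.mk ℂ _ hq, b.span) ∈ I) :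
    IsFocal I (Projectivization.mk ℂ _ hq) b.span := by
  obtain ⟨c, hc⟩ := (Submodule.mem_span_range_iff_exists_fun ℂ).1 ha
  -- a linear function `L` with `dL(w) = 1`
  obtain ⟨ij, hij⟩ : ∃ ij, w ij ≠ 0 := by
    by_contra! h
    obtain ⟨i, hi⟩ := hwb
    apply hi
    rw [show matRow w i = 0 from funext fun j => h (i, j)]
    exact Submodule.zero_mem _
  let L : MvPolynomial (Fin (r + 1) × Fin (n + 1)) ℂ :=
    MvPolynomial.C (w ij)⁻¹ * (MvPolynomial.X ij - MvPolynomial.C (b.coords ij))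
  have hL0 : MvPolynomial.eval b.coords L = 0 := by simp [L]
  have hL1 : differential b.coords w L = 1 := by
    simp [L, differential_mul, differential_sub, differential_C, differential_X, hij]
  -- a section through the point, corrected so that its derivative along `w` is zero
  let κ' : Fin (n + 1) → MvPolynomial (Fin (r + 1) × Fin (n + 1)) ℂ := fun j =>
    ∑ i, (MvPolynomial.C (a i) - MvPolynomial.C (c i) * L) * κ i j
  have h1 : evalVec b.coords κ' = ∑ i, a i • evalVec b.coords (κ i) := by
    funext j
    simp [κ', evalVec, hL0, Finset.sum_apply]
  have h2 : diffVec b.coords w κ' = 0 := by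
    have h3 : diffVec b.coords w κ' = ∑ i, a i • diffVec b.coords w (κ i) -
        ∑ i, c i • evalVec b.coords (κ i) := by
      funext j
      simp only [diffVec, κ', differential_sum, differential_mul, differential_sub, differential_C,
        hL1, MvPolynomial.aeval_eq_eval, map_sub, map_mul, hL0, MvPolynomial.eval_C, Pi.sub_apply,
        Finset.sum_apply, Pi.smul_apply, smul_eq_mul, evalVec]
      rw [← Finset.sum_sub_distrib]
      exact Finset.sum_congr rfl fun i _ => by ring
    rw [h3, hc, sub_self]
  have h4 : aevalVec β κ' ∈ Submodule.span Ω (Set.range fun i => aevalVec β (κ i)) := by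
    rw [Submodule.mem_span_range_iff_exists_fun]
    refine ⟨fun i => MvPolynomial.aeval β (MvPolynomial.C (a i) - MvPolynomial.C (c i) * L), ?_⟩
    funext j
    simp only [aevalVec, κ', map_sum, map_mul, Finset.sum_apply, Pi.smul_apply, smul_eq_mul]
  have h5 : aevalVec β κ' ≠ 0 := by
    intro h
    apply hq
    rw [← h1]
    funext j
    exact hβ.eval_eq_zero ⟨b, rfl, hb⟩ _ (congrFun h j)
  have h6 := mem_zariskiTangent_incidenceFrames hβ κ' (hI κ' h4 h5) hw
  rw [h1, h2] at h6
  rw [isFocal_iff hq b]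
  refine ⟨hmem, _, h6, ?_, hwb⟩
  exact Submodule.zero_mem _

end Incidence

/-! ### Non-membership and ranks under general specializations -/

section Transfer
variable {Ω : Type} [Field Ω] [Algebra ℂ Ω] {ι : Type} [Fintype ι]

theorem eq_zero_of_eventually {a : Ω} (h : ∀ᶠ φ in genericFilter Ω, φ a = 0) : a = 0 := by
  by_contra hne
  obtain ⟨φ, h1, h2⟩ := (h.and (generic_ne hne)).exists
  exact h2 h1

theorem generic_notMem_span {m : ℕ} {v : Fin m → ι → Ω} (hv : LinearIndependent Ω v) {u : ι → Ω}
    (hu : u ∉ Submodule.span Ω (Set.range v)) : ∀ᶠ φ in genericFilter Ω,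
      (fun i => φ (u i)) ∉ Submodule.span ℂ (Set.range fun k i => φ (v k i)) := by
  filter_upwards [generic_linearIndependent (linearIndependent_finCons.2 ⟨hv, hu⟩)] with φ h
  have : (fun k i => φ ((Fin.cons u v : Fin (m + 1) → ι → Ω) k i)) =
      Fin.cons (fun i => φ (u i)) (fun k i => φ (v k i)) := by
    funext k
    refine Fin.cases ?_ (fun k => ?_) k <;> rfl
  rw [this] at h
  exact (linearIndependent_finCons.1 h).2

/-- Ranks do not drop under general specializations. -/
theorem generic_rank_le {τ ν : Type} [Fintype τ] [Fintype ν] (A : Matrix τ ν Ω) :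
    ∀ᶠ φ in genericFilter Ω, A.rank ≤ (A.map φ).rank := by
  obtain ⟨f, hf⟩ : ∃ f : Fin A.rank → τ, LinearIndependent Ω (fun i => A (f i)) := by
    obtain ⟨s, hs, hspan, hli⟩ := exists_linearIndependent Ω (Set.range A.row)
    have hfin : s.Finite := (Set.finite_range _).subset hs
    have hcard : Nat.card s = A.rank := by
      rw [Matrix.rank_eq_finrank_span_row, ← hspan]
      have := hfin.fintype
      rw [Nat.card_eq_fintype_card, ← finrank_span_eq_card hli, Subtype.range_coe]
    have : Finite s := hfin
    let e : Fin A.rank ≃ s := (finCongr hcard.symm).trans (Finite.equivFin s).symm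
    choose g hg using fun i => hs (e i).2
    refine ⟨g, ?_⟩
    have h2 := hli.comp e e.injective
    have h3 : (fun i => A (g i)) = Subtype.val ∘ e := funext hg
    rw [h3]
    exact h2
  filter_upwards [generic_linearIndependent hf] with φ h
  rw [Matrix.rank_eq_finrank_span_row (A.map φ)]
  have h2 := finrank_span_eq_card h
  rw [Fintype.card_fin] at h2
  rw [← h2]
  apply Submodule.finrank_mono
  apply Submodule.span_mono
  rintro _ ⟨i, rfl⟩
  exact ⟨f i, rfl⟩

end Transfer

/-! ### Tangent vectors along the orbits of the general linear group -/

section Vertical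
variable {r n : ℕ} {k : Type} [Field k]

/-- The basis of the space of matrices whose rows are combinations of the vectors `B`. -/
def vertical (B : Fin (r + 1) → Fin (n + 1) → k) (ik : Fin (r + 1) × Fin (r + 1)) :
    Fin (r + 1) × Fin (n + 1) → k :=
  fun ij => if ij.1 = ik.1 then B ik.2 ij.2 else 0

theorem matRow_sum_vertical (B : Fin (r + 1) → Fin (n + 1) → k)
    (c : Fin (r + 1) × Fin (r + 1) → k) (i : Fin (r + 1)) :
    matRow (∑ ik, c ik • vertical B ik) i = ∑ l, c (i, l) • B l := by
  funext j
  simp only [matRow, Finset.sum_apply, Pi.smul_apply, smul_eq_mul, vertical, Fintype.sum_prod_type]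
  rw [Finset.sum_eq_single i]
  · simp
  · intro i' _ hi'
    simp [hi'.symm]
  · simp

theorem mem_span_vertical_iff {B : Fin (r + 1) → Fin (n + 1) → k}
    {v : Fin (r + 1) × Fin (n + 1) → k} :
    v ∈ Submodule.span k (Set.range (vertical B)) ↔
      ∀ i, matRow v i ∈ Submodule.span k (Set.range B) := by
  constructor
  · intro h i
    obtain ⟨c, rfl⟩ := (Submodule.mem_span_range_iff_exists_fun k).1 h
    rw [matRow_sum_vertical]
    exact Submodule.sum_mem _ fun l _ => Submodule.smul_mem _ _ (Submodule.subset_span ⟨l, rfl⟩)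
  · intro h
    choose c hc using fun i => (Submodule.mem_span_range_iff_exists_fun k).1 (h i)
    refine (Submodule.mem_span_range_iff_exists_fun k).2 ⟨fun ik => c ik.1 ik.2, ?_⟩
    funext ij
    have := matRow_sum_vertical B (fun ik => c ik.1 ik.2) ij.1
    rw [hc] at this
    exact congrFun this ij.2

theorem linearIndependent_vertical {B : Fin (r + 1) → Fin (n + 1) → k}
    (hB : LinearIndependent k B) : LinearIndependent k (vertical B) := by
  rw [Fintype.linearIndependent_iff]
  intro c hc ⟨i, l⟩
  have := matRow_sum_vertical B c i
  rw [hc] at this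
  exact Fintype.linearIndependent_iff.1 hB (fun l => c (i, l)) this.symm l

/-- Matrices whose rows lie in the span of the frame are tangent to the frames of `C`: they are
tangent to the orbit of the general linear group. -/
theorem mem_zariskiTangent_of_vertical {C : Set (Grass r n)} {b : Frame r n} (hb : b.span ∈ C)
    {v : Fin (r + 1) × Fin (n + 1) → ℂ} (hv : ∀ i, matRow v i ∈ b.span.1) :
    v ∈ zariskiTangent (framesOf C) b.coords := by
  choose m hm using fun i => Frame.mem_span_iff.1 (hv i)
  -- the general linear group, whose tangent space is the space of all matrices
  let Z : Set (Fin (r + 1) × Fin (r + 1) → ℂ) := {x | (Matrix.of fun i k => x (i, k)).det ≠ 0}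
  let d : MvPolynomial (Fin (r + 1) × Fin (r + 1)) ℂ :=
    (Matrix.of fun i j => MvPolynomial.X (i, j)).det
  have hd : ∀ x : Fin (r + 1) × Fin (r + 1) → ℂ,
      MvPolynomial.eval x d = (Matrix.of fun i k => x (i, k)).det := by
    intro x
    simp only [d]
    rw [RingHom.map_det]
    congr 1
    ext i j
    simp
  have hone : (Matrix.of fun i k : Fin (r + 1) => if i = k then (1 : ℂ) else 0).det = 1 := by
    have : (Matrix.of fun i k : Fin (r + 1) => if i = k then (1 : ℂ) else 0) = 1 := by
      ext i k; simp [Matrix.one_apply]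
    rw [this, Matrix.det_one]
  have hZ : ∀ F ∈ MvPolynomial.vanishingIdeal ℂ Z, F = 0 := by
    intro F hF
    have h1 : F * d = 0 := MvPolynomial.funext fun x => by
      rw [map_mul, map_zero, hd]
      by_cases hx : (Matrix.of fun i k => x (i, k)).det = 0
      · rw [hx, mul_zero]
      · have := hF x hx
        rw [MvPolynomial.aeval_eq_eval] at this
        rw [this, zero_mul]
    refine (mul_eq_zero.1 h1).resolve_right fun h => ?_
    have := hd fun ik => if ik.1 = ik.2 then 1 else 0
    rw [h, hone, map_zero] at this
    exact zero_ne_one this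
  have h1 : (fun ik => m ik.1 ik.2) ∈
      zariskiTangent Z (fun ik => if ik.1 = ik.2 then 1 else 0) := by
    rw [mem_zariskiTangent_iff]
    intro F hF
    rw [hZ F hF]
    simp [differential]
  have h2 := mem_zariskiTangent_of_mapsTo (Z' := framesOf C) (fun ij =>
    ∑ l, MvPolynomial.X (ij.1, l) * MvPolynomial.C (b.coords (l, ij.2))) (by
      intro x hx
      refine ⟨b.act _ hx, ?_, by rw [Frame.span_act]; exact hb⟩
      funext ij
      simp [Frame.coords_act]) h1
  convert h2 using 1
  · congr 1
    funext ij
    simp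
  · funext ij
    have := congrFun (hm ij.1) ij.2
    simp only [differential_sum, differential_mul, differential_X, differential_C]
    simpa [matRow, Frame.coords] using this

end Vertical

/-! ### The generic frame of a smooth curve -/

section SmoothCurve

variable {r n : ℕ} {Ω : Type} [Field Ω] [Algebra ℂ Ω] {C : Set (Grass r n)}
  {β : Fin (r + 1) × Fin (n + 1) → Ω}

/-- The frame `β` over `Ω` is a generic frame of the smooth curve `C`: it is a generic point of
the set of frames of `C`, its general specializations are frames of members of `C`, and the tangent
spaces of `C` have dimension `1`. -/
structure IsGenericFrame (C : Set (Grass r n)) (β : Fin (r + 1) × Fin (n + 1) → Ω) : Prop where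
  generic : IsGenericPointOf β (framesOf C)
  mem : ∀ᶠ φ in genericFilter Ω, ∃ b : Frame r n, b.span ∈ C ∧ b.coords = fun ij => φ (β ij)
  smooth : ∀ b : Frame r n, b.span ∈ C → Module.finrank ℂ (tangentSpace C b) = 1

/-- The space spanned by the rows of a frame. -/
def rowSpan (β : Fin (r + 1) × Fin (n + 1) → Ω) : Submodule Ω (Fin (n + 1) → Ω) :=
  Submodule.span Ω (Set.range (matRow β))

/-- A derivation applied to the entries of a vector. -/
def dVec (D : Derivation ℂ Ω Ω) (q : Fin (n + 1) → Ω) : Fin (n + 1) → Ω := fun j => D (q j)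

theorem Frame.span_eq_of_coords {b : Frame r n} {x : Fin (r + 1) × Fin (n + 1) → ℂ}
    (h : b.coords = x) : b.span.1 = Submodule.span ℂ (Set.range (matRow x)) := by
  rw [← h]; rfl

theorem IsGenericFrame.linearIndependent (h : IsGenericFrame C β) :
    LinearIndependent Ω (matRow β) := by
  by_contra hli
  rw [Fintype.linearIndependent_iff] at hli
  push Not at hli
  obtain ⟨g, hg, i, hi⟩ := hli
  have h1 : ∀ j, ∑ i, g i * β (i, j) = 0 := fun j => by
    simpa [matRow] using congrFun hg j
  obtain ⟨φ, ⟨b, -, hb⟩, h2, h3, h4⟩ := (h.mem.and ((generic_ne hi).and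
    ((eventually_all.2 fun j => generic_sum_mul g (fun i => β (i, j))).and generic_zero))).exists
  apply h2
  refine Fintype.linearIndependent_iff.1 b.2 (fun i => φ (g i)) ?_ i
  funext j
  have := h3 j
  rw [h1, h4] at this
  simp only [Finset.sum_apply, Pi.smul_apply, smul_eq_mul, Pi.zero_apply]
  rw [this]
  exact Finset.sum_congr rfl fun i _ => by rw [← congrFun hb (i, j)]; rfl

theorem IsGenericFrame.finrank_rowSpan (h : IsGenericFrame C β) :
    Module.finrank Ω (rowSpan β) = r + 1 := by
  rw [rowSpan, finrank_span_eq_card h.linearIndependent, Fintype.card_fin]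

/-- Some derivation moves the generic member of `C`. -/
theorem IsGenericFrame.exists_derivation (h : IsGenericFrame C β) :
    ∃ D : Derivation ℂ Ω Ω, ∃ i, dVec D (matRow β i) ∉ rowSpan β := by
  by_contra! hcon
  have hT : genericTangent β ≤ Submodule.span Ω (Set.range (vertical (matRow β))) := by
    intro v hv
    obtain ⟨D, hD⟩ := exists_derivation_of_mem_genericTangent hv
    rw [mem_span_vertical_iff]
    intro i
    have := hcon D i
    rwa [show dVec D (matRow β i) = matRow v i from funext fun j => hD (i, j)] at this
  obtain ⟨φ, ⟨b, hbC, hb⟩, h1, h0⟩ := (h.mem.and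
    ((generic_zariskiTangent_le h.generic hT).and generic_zero)).exists
  obtain ⟨w₀, hw₀, ⟨i, hi⟩, -⟩ := exists_mem_zariskiTangent_of_finrank_eq_one (h.smooth b hbC)
  rw [hb] at hw₀
  apply hi
  rw [Frame.span_eq_of_coords hb]
  have h2 : (fun k i => φ (vertical (matRow β) k i)) =
      vertical (matRow fun ij => φ (β ij)) := by
    funext k i
    simp only [vertical, apply_ite φ, h0]
    rfl
  rw [h2] at h1
  exact mem_span_vertical_iff.1 (h1 hw₀) i

/-- The velocities of the generic member of `C` under all derivations are proportional. -/
theorem IsGenericFrame.exists_sub_smul_mem (h : IsGenericFrame C β) {D₀ : Derivation ℂ Ω Ω}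
    (hD₀ : ∃ i, dVec D₀ (matRow β i) ∉ rowSpan β) (D : Derivation ℂ Ω Ω) :
    ∃ c : Ω, ∀ i, dVec D (matRow β i) - c • dVec D₀ (matRow β i) ∈ rowSpan β := by
  obtain ⟨l, hl1, hl2, -⟩ := exists_equations_of_span (matRow β)
  -- `u D` represents the velocity modulo the generic member; the `2 × 2` minors of `(u D, u D₀)`
  -- are zero, since they are zero after general specializations, the tangent spaces being lines
  let u : Derivation ℂ Ω Ω → Fin (n + 1) → Fin (r + 1) → Ω := fun D j i =>
    ∑ x, l j x * D (β (i, x))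
  have hminor : ∀ j i j' i', u D j i * u D₀ j' i' - u D j' i' * u D₀ j i = 0 := by
    intro j i j' i'
    apply eq_zero_of_eventually
    have hu : ∀ D', ∀ᶠ φ in genericFilter Ω, ∀ j i, φ (u D' j i) =
        ∑ x, φ (l j x) * φ (D' (β (i, x))) := fun D' =>
      eventually_all.2 fun j => eventually_all.2 fun i => generic_sum_mul _ _
    have hlβ : ∀ᶠ φ in genericFilter Ω, ∀ j k, ∑ x, φ (l j x) * φ (β (k, x)) = 0 := by
      refine eventually_all.2 fun j => eventually_all.2 fun k => ?_
      filter_upwards [generic_sum_mul (l j) (fun x => β (k, x)), generic_zero] with φ h1 h2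
      rw [← h1, show ∑ x, l j x * β (k, x) = 0 from
        hl1 j (matRow β k) (Submodule.subset_span ⟨k, rfl⟩), h2]
    filter_upwards [hu D, hu D₀, hlβ, h.mem,
      generic_mem_zariskiTangent h.generic (derivation_mem_genericTangent D β),
      generic_mem_zariskiTangent h.generic (derivation_mem_genericTangent D₀ β),
      generic_mul (u D j i) (u D₀ j' i'), generic_mul (u D j' i') (u D₀ j i),
      generic_add (u D j i * u D₀ j' i' - u D j' i' * u D₀ j i) (u D j' i' * u D₀ j i)]
      with φ h1 h2 h3 ⟨b, hbC, hb⟩ h4 h5 h6 h7 h8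
    obtain ⟨w₀, -, -, hw⟩ := exists_mem_zariskiTangent_of_finrank_eq_one (h.smooth b hbC)
    rw [hb] at hw
    have hker : ∀ j, ∀ y ∈ b.span.1, ∑ x, φ (l j x) * y x = 0 := by
      intro j y hy
      rw [Frame.span_eq_of_coords hb] at hy
      obtain ⟨c, rfl⟩ := (Submodule.mem_span_range_iff_exists_fun ℂ).1 hy
      simp only [Finset.sum_apply, Pi.smul_apply, smul_eq_mul, Finset.mul_sum]
      rw [Finset.sum_comm]
      refine Finset.sum_eq_zero fun k _ => ?_
      have := h3 j k
      calc _ = c k * ∑ x, φ (l j x) * φ (β (k, x)) := by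
            rw [Finset.mul_sum]
            exact Finset.sum_congr rfl fun _ _ => by simp only [matRow]; ring
        _ = 0 := by rw [this, mul_zero]
    have hval : ∀ (D' : Derivation ℂ Ω Ω) (c : ℂ), (∀ i, matRow (fun ij => φ (D' (β ij))) i -
        c • matRow w₀ i ∈ b.span.1) → ∀ j i, ∑ x, φ (l j x) * φ (D' (β (i, x))) =
          c * ∑ x, φ (l j x) * w₀ (i, x) := by
      intro D' c hc j i
      have := hker j _ (hc i)
      simp only [Pi.sub_apply, Pi.smul_apply, smul_eq_mul, mul_sub, Finset.sum_sub_distrib,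
        sub_eq_zero, matRow] at this
      rw [this, Finset.mul_sum]
      exact Finset.sum_congr rfl fun _ _ => by ring
    obtain ⟨c1, hc1⟩ := hw _ h4
    obtain ⟨c2, hc2⟩ := hw _ h5
    rw [sub_add_cancel, h6, h7, h1, h1, h2, h2] at h8
    rw [hval D c1 hc1, hval D c1 hc1, hval D₀ c2 hc2, hval D₀ c2 hc2] at h8
    have h9 : φ (u D j i * u D₀ j' i' - u D j' i' * u D₀ j i) =
      (c1 * ∑ x, φ (l j x) * w₀ (i, x)) * (c2 * ∑ x, φ (l j' x) * w₀ (i', x)) -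
      (c1 * ∑ x, φ (l j' x) * w₀ (i', x)) * (c2 * ∑ x, φ (l j x) * w₀ (i, x)) := by
      rw [h8]; ring
    rw [h9]; ring
  obtain ⟨i₀, hi₀⟩ := hD₀
  obtain ⟨j₀, hj₀⟩ : ∃ j₀, u D₀ j₀ i₀ ≠ 0 := by
    by_contra! hcon
    exact hi₀ (hl2 _ hcon)
  refine ⟨u D j₀ i₀ / u D₀ j₀ i₀, fun i => hl2 _ fun j => ?_⟩
  have h1 : ∑ x, l j x * (dVec D (matRow β i) - (u D j₀ i₀ / u D₀ j₀ i₀) •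
      dVec D₀ (matRow β i)) x = u D j i - u D j₀ i₀ / u D₀ j₀ i₀ * u D₀ j i := by
    simp only [Pi.sub_apply, Pi.smul_apply, smul_eq_mul, mul_sub, Finset.sum_sub_distrib, u,
      Finset.mul_sum, dVec, matRow]
    congr 1
    exact Finset.sum_congr rfl fun _ _ => by ring
  rw [h1]
  have := hminor j i j₀ i₀
  field_simp
  linear_combination this

/-- Matrices whose rows lie in the span of the generic frame are tangent at the generic frame. -/
theorem IsGenericFrame.vertical_mem_genericTangent (h : IsGenericFrame C β)
    (ik : Fin (r + 1) × Fin (r + 1)) : vertical (matRow β) ik ∈ genericTangent β := by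
  intro F hF
  have h1 : differential β (vertical (matRow β) ik) F =
      MvPolynomial.aeval β (∑ j, MvPolynomial.pderiv (ik.1, j) F * MvPolynomial.X (ik.2, j)) := by
    simp only [differential, vertical, Fintype.sum_prod_type, map_sum, map_mul,
      MvPolynomial.aeval_X]
    rw [Finset.sum_eq_single ik.1]
    · simp [matRow]
    · intro i _ hi
      simp [hi]
    · simp
  rw [h1, ← h.generic]
  rintro _ ⟨b, rfl, hb⟩
  have h2 : vertical b.1 ik ∈ zariskiTangent (framesOf C) b.coords :=
    mem_zariskiTangent_of_vertical hb fun i =>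
      mem_span_vertical_iff.1 (Submodule.subset_span ⟨ik, rfl⟩) i
  rw [mem_zariskiTangent_iff] at h2
  rw [← h2 F ((h.generic F).2 hF)]
  simp only [differential, vertical, Fintype.sum_prod_type, map_sum, map_mul, MvPolynomial.aeval_X]
  symm
  rw [Finset.sum_eq_single ik.1]
  · simp [Frame.coords]
  · intro i _ hi
    simp [hi]
  · simp

/-- Every tangent vector at a frame extends to a polynomial vector field that is tangent at the
generic frame. Indeed, `C` being smooth, the rank of the Jacobian matrix of its equations is the
same at all frames. -/
theorem IsGenericFrame.exists_polynomial_mem_genericTangent (h : IsGenericFrame C β) {b : Frame r n}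
    (hb : b.span ∈ C) {w₀ : Fin (r + 1) × Fin (n + 1) → ℂ}
    (hw₀ : w₀ ∈ zariskiTangent (framesOf C) b.coords) :
    ∃ w : Fin (r + 1) × Fin (n + 1) → MvPolynomial (Fin (r + 1) × Fin (n + 1)) ℂ,
      (fun ij => MvPolynomial.aeval β (w ij)) ∈ genericTangent β ∧
      ∀ ij, MvPolynomial.eval b.coords (w ij) = w₀ ij := by
  obtain ⟨G, hG⟩ : (MvPolynomial.vanishingIdeal ℂ (framesOf C)).FG := IsNoetherian.noetherian _
  -- the Jacobian matrix of generators of the vanishing ideal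
  let J : Matrix G (Fin (r + 1) × Fin (n + 1)) (MvPolynomial (Fin (r + 1) × Fin (n + 1)) ℂ) :=
    Matrix.of fun F ij => MvPolynomial.pderiv ij F.1
  have hGmem : ∀ F : G, F.1 ∈ MvPolynomial.vanishingIdeal ℂ (framesOf C) := fun F => by
    rw [← hG]; exact Ideal.subset_span F.2
  have key : ∀ {R : Type} [Field R] [Algebra ℂ R] (x v : Fin (r + 1) × Fin (n + 1) → R),
      (∀ F ∈ MvPolynomial.vanishingIdeal ℂ (framesOf C), MvPolynomial.aeval x F = 0) →
      (∀ F ∈ G, differential x v F = 0) →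
      ∀ F ∈ MvPolynomial.vanishingIdeal ℂ (framesOf C), differential x v F = 0 := by
    intro R _ _ x v hx hv F hF
    rw [← hG] at hF hx
    induction hF using Submodule.span_induction with
    | mem F hF => exact hv F hF
    | zero => simp [differential]
    | add F F' _ _ h1 h2 => rw [differential_add, h1, h2, add_zero]
    | smul H F hF h1 =>
      rw [smul_eq_mul, differential_mul, h1, hx F hF, mul_zero, mul_zero, add_zero]
  have hkerβ : ∀ v, v ∈ LinearMap.ker (J.map (MvPolynomial.aeval β)).mulVecLin ↔
      v ∈ genericTangent β := by
    intro v
    rw [LinearMap.mem_ker]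
    constructor
    · intro hv F hF
      refine key β v (fun F hF => (h.generic F).1 hF) (fun F hF => ?_) F ((h.generic F).2 hF)
      exact congrFun hv ⟨F, hF⟩
    · intro hv
      funext F
      exact hv F.1 ((h.generic F).1 (hGmem F))
  have hkerb : ∀ v, v ∈ LinearMap.ker (J.map (MvPolynomial.eval b.coords)).mulVecLin ↔
      v ∈ zariskiTangent (framesOf C) b.coords := by
    intro v
    rw [LinearMap.mem_ker, mem_zariskiTangent_iff]
    constructor
    · intro hv
      refine key b.coords v (fun F hF => hF _ ⟨b, rfl, hb⟩) (fun F hF => ?_)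
      have := congrFun hv ⟨F, hF⟩
      simp only [differential, MvPolynomial.aeval_eq_eval]
      exact this
    · intro hv
      funext F
      have := hv F.1 (hGmem F)
      simp only [differential, MvPolynomial.aeval_eq_eval] at this
      exact this
  have e1 : LinearMap.ker (J.map (MvPolynomial.aeval β)).mulVecLin = genericTangent β :=
    SetLike.ext hkerβ
  have e2 : LinearMap.ker (J.map (MvPolynomial.eval b.coords)).mulVecLin =
    zariskiTangent (framesOf C) b.coords := SetLike.ext hkerb
  -- dimension of the generic tangent space
  obtain ⟨D, i, hD⟩ := h.exists_derivation
  let fΩ : Option (Fin (r + 1) × Fin (r + 1)) → Fin (r + 1) × Fin (n + 1) → Ω :=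
    fun o => o.elim (fun ij => D (β ij)) (vertical (matRow β))
  have hfΩ : LinearIndependent Ω fΩ := by
    rw [linearIndependent_option]
    exact ⟨linearIndependent_vertical h.linearIndependent,
      fun hmem => hD (mem_span_vertical_iff.1 hmem i)⟩
  have h1 : Fintype.card (Option (Fin (r + 1) × Fin (r + 1))) ≤
      Module.finrank Ω (genericTangent β) := by
    rw [← finrank_span_eq_card hfΩ]
    apply Submodule.finrank_mono
    rw [Submodule.span_le]
    rintro _ ⟨o, rfl⟩
    rcases o with _ | ik
    · exact derivation_mem_genericTangent D β
    · exact h.vertical_mem_genericTangent ik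
  -- dimension of the tangent space at `b`
  obtain ⟨w₁, -, -, hw⟩ := exists_mem_zariskiTangent_of_finrank_eq_one (h.smooth b hb)
  let fb : Option (Fin (r + 1) × Fin (r + 1)) → Fin (r + 1) × Fin (n + 1) → ℂ :=
    fun o => o.elim w₁ (vertical b.1)
  have h2 : Module.finrank ℂ (zariskiTangent (framesOf C) b.coords) ≤
      Fintype.card (Option (Fin (r + 1) × Fin (r + 1))) := by
    refine le_trans (Submodule.finrank_mono (t := Submodule.span ℂ (Set.range fb)) ?_)
      (finrank_range_le_card fb)
    intro v hv
    obtain ⟨c, hc⟩ := hw v hv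
    have h3 : v - c • w₁ ∈ Submodule.span ℂ (Set.range (vertical b.1)) :=
      mem_span_vertical_iff.2 hc
    have h4 : Submodule.span ℂ (Set.range (vertical b.1)) ≤ Submodule.span ℂ (Set.range fb) := by
      apply Submodule.span_mono
      rintro _ ⟨ik, rfl⟩
      exact ⟨some ik, rfl⟩
    rw [← sub_add_cancel v (c • w₁)]
    exact Submodule.add_mem _ (h4 h3) (Submodule.smul_mem _ _ (Submodule.subset_span ⟨none, rfl⟩))
  have r1 := LinearMap.finrank_range_add_finrank_ker (J.map (MvPolynomial.aeval β)).mulVecLin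
  have r2 := LinearMap.finrank_range_add_finrank_ker
    (J.map (MvPolynomial.eval b.coords)).mulVecLin
  rw [e1, Module.finrank_fintype_fun_eq_card] at r1
  rw [e2, Module.finrank_fintype_fun_eq_card] at r2
  obtain ⟨w, hw1, hw2⟩ := exists_polynomial_mem_ker J (ξ := β) (x := b.coords) (v₀ := w₀)
    (h.generic.eval_eq_zero ⟨b, rfl, hb⟩) (by
      change Module.finrank Ω (LinearMap.range (J.map (MvPolynomial.aeval β)).mulVecLin) ≤
        Module.finrank ℂ (LinearMap.range (J.map (MvPolynomial.eval b.coords)).mulVecLin)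
      omega) ((hkerb w₀).2 hw₀)
  exact ⟨w, (hkerβ _).1 hw1, hw2⟩

end SmoothCurve

/-! ### Focal spaces of moving linear spaces -/

section FocalSpace
variable {n m : ℕ} {k : Type} [Field k]

/-- Let a moving linear space be spanned by `v` and let `u` be the velocities of these vectors. The
focal space consists of the vectors `∑ aᵢ vᵢ` whose velocity `∑ aᵢ uᵢ` stays in the span of `v`. -/
def focalSpace (v u : Fin m → Fin (n + 1) → k) : Submodule k (Fin (n + 1) → k) :=
  ((Submodule.span k (Set.range v)).comap (Fintype.linearCombination k u)).map
    (Fintype.linearCombination k v)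

theorem mem_focalSpace {v u : Fin m → Fin (n + 1) → k} {q : Fin (n + 1) → k} :
    q ∈ focalSpace v u ↔ ∃ a : Fin m → k,
      ∑ i, a i • u i ∈ Submodule.span k (Set.range v) ∧ ∑ i, a i • v i = q := by
  simp only [focalSpace, Submodule.mem_map, Submodule.mem_comap, Fintype.linearCombination_apply]

/-- The matrix whose columns are the vectors `u` and `v`. -/
def focalMatrix {R : Type} (v u : Fin m → Fin (n + 1) → R) :
    Matrix (Fin (n + 1)) (Fin m ⊕ Fin m) R :=
  Matrix.of fun j s => Sum.elim (fun i => u i j) (fun i => v i j) s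

theorem focalMatrix_mulVec (v u : Fin m → Fin (n + 1) → k) (x : Fin m ⊕ Fin m → k) :
    (focalMatrix v u).mulVec x =
      ∑ i, x (Sum.inl i) • u i + ∑ i, x (Sum.inr i) • v i := by
  funext j
  simp [focalMatrix, Matrix.mulVec, dotProduct, Finset.sum_apply, mul_comm]

/-- The focal space is isomorphic to the space of the linear relations between the vectors `u` and
`v`. -/
theorem rank_focalMatrix_add_finrank {v u : Fin m → Fin (n + 1) → k}
    (hv : LinearIndependent k v) :
    (focalMatrix v u).rank + Module.finrank k (focalSpace v u) = m + m := by
  let A := (focalMatrix v u).mulVecLin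
  have hker : ∀ x, x ∈ LinearMap.ker A ↔
      ∑ i, x (Sum.inl i) • u i + ∑ i, x (Sum.inr i) • v i = 0 := fun x => by
    rw [LinearMap.mem_ker, ← focalMatrix_mulVec]; rfl
  let g : LinearMap.ker A →ₗ[k] Fin (n + 1) → k :=
    (Fintype.linearCombination k v ∘ₗ LinearMap.funLeft k k Sum.inl) ∘ₗ (LinearMap.ker A).subtype
  have hg : ∀ x, g x = ∑ i, x.1 (Sum.inl i) • v i := fun x => by
    simp [g, Fintype.linearCombination_apply, LinearMap.funLeft]
  have hinj : Function.Injective g := by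
    rw [← LinearMap.ker_eq_bot, LinearMap.ker_eq_bot']
    intro x hx
    rw [hg] at hx
    have h1 := Fintype.linearIndependent_iff.1 hv _ hx
    have h2 := (hker x.1).1 x.2
    simp only [h1, zero_smul, Finset.sum_const_zero, zero_add] at h2
    have h3 := Fintype.linearIndependent_iff.1 hv _ h2
    apply Subtype.ext
    funext s
    rcases s with i | i
    · exact h1 i
    · exact h3 i
  have hrange : LinearMap.range g = focalSpace v u := by
    ext q
    rw [LinearMap.mem_range, mem_focalSpace]
    constructor
    · rintro ⟨x, rfl⟩
      refine ⟨fun i => x.1 (Sum.inl i), ?_, (hg x).symm⟩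
      rw [eq_neg_of_add_eq_zero_left ((hker x.1).1 x.2)]
      exact Submodule.neg_mem _ (Submodule.sum_mem _ fun i _ =>
        Submodule.smul_mem _ _ (Submodule.subset_span ⟨i, rfl⟩))
    · rintro ⟨a, ha, rfl⟩
      obtain ⟨c, hc⟩ := (Submodule.mem_span_range_iff_exists_fun k).1 ha
      refine ⟨⟨Sum.elim a (-c), (hker _).2 ?_⟩, hg _⟩
      simp [← hc]
  have h1 := LinearMap.finrank_range_add_finrank_ker A
  rw [Module.finrank_fintype_fun_eq_card, ← LinearMap.finrank_range_of_inj hinj, hrange] at h1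
  rw [Fintype.card_sum, Fintype.card_fin] at h1
  exact h1

end FocalSpace

/-! ### Focal spaces under general specializations -/

section GenericFocalSpace
variable {n m d : ℕ} {Ω : Type} [Field Ω] [Algebra ℂ Ω]

theorem generic_smul_sum (a : Fin m → Ω) (v : Fin m → Fin (n + 1) → Ω) :
    ∀ᶠ φ in genericFilter Ω, (fun j => φ ((∑ i, a i • v i) j)) =
      ∑ i, φ (a i) • fun j => φ (v i j) := by
  filter_upwards [eventually_all.2 fun j => generic_sum_mul a (fun i => v i j)] with φ h
  funext j
  simp only [Finset.sum_apply, Pi.smul_apply, smul_eq_mul]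
  exact h j

/-- The focal space commutes with general specializations: the specialized vectors are contained in
the focal space of the specialized family, whose dimension is at most the generic one, as the rank
of the focal matrix does not drop. -/
theorem generic_focalSpace {v u : Fin m → Fin (n + 1) → Ω} (hv : LinearIndependent Ω v)
    {k : Fin d → Fin (n + 1) → Ω} (hk : LinearIndependent Ω k)
    (hspan : Submodule.span Ω (Set.range k) = focalSpace v u) :
    ∀ᶠ φ in genericFilter Ω, focalSpace (fun i j => φ (v i j)) (fun i j => φ (u i j)) =
      Submodule.span ℂ (Set.range fun i j => φ (k i j)) := by
  have h1 : ∀ i, ∀ᶠ φ in genericFilter Ω,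
      (fun j => φ (k i j)) ∈ focalSpace (fun i j => φ (v i j)) (fun i j => φ (u i j)) := by
    intro i
    have hki : k i ∈ focalSpace v u := by
      rw [← hspan]; exact Submodule.subset_span ⟨i, rfl⟩
    obtain ⟨a, ha, hak⟩ := mem_focalSpace.1 hki
    filter_upwards [generic_smul_sum a v, generic_smul_sum a u, generic_mem_span ha]
      with φ h1 h2 h3
    rw [hak] at h1
    rw [h2] at h3
    exact mem_focalSpace.2 ⟨fun i => φ (a i), h3, h1.symm⟩
  filter_upwards [eventually_all.2 h1, generic_linearIndependent hv, generic_linearIndependent hk,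
    generic_rank_le (focalMatrix v u)] with φ h1 h2 h3 h4
  symm
  apply Submodule.eq_of_le_of_finrank_le
  · rw [Submodule.span_le]
    rintro _ ⟨i, rfl⟩
    exact h1 i
  · have e1 := rank_focalMatrix_add_finrank (u := u) hv
    have e2 := rank_focalMatrix_add_finrank (u := fun i j => φ (u i j)) h2
    have e3 : (focalMatrix v u).map φ =
        focalMatrix (fun i j => φ (v i j)) (fun i j => φ (u i j)) := by
      ext j s
      rcases s with s | s <;> rfl
    rw [← e3] at e2
    rw [← hspan, finrank_span_eq_card hk, Fintype.card_fin] at e1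
    rw [finrank_span_eq_card h3, Fintype.card_fin]
    omega

end GenericFocalSpace

/-! ### The focal space as a kernel of derivations -/

section Derived
variable {r n : ℕ} {Ω : Type} [Field Ω] [Algebra ℂ Ω] {C : Set (Grass r n)}
  {β : Fin (r + 1) × Fin (n + 1) → Ω}

theorem dVec_add (D : Derivation ℂ Ω Ω) (q q' : Fin (n + 1) → Ω) :
    dVec D (q + q') = dVec D q + dVec D q' := by
  funext j; simp [dVec]

theorem dVec_smul (D : Derivation ℂ Ω Ω) (a : Ω) (q : Fin (n + 1) → Ω) :
    dVec D (a • q) = a • dVec D q + D a • q := by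
  funext j; simp [dVec, mul_comm]

theorem dVec_zero (D : Derivation ℂ Ω Ω) : dVec D (0 : Fin (n + 1) → Ω) = 0 := by
  funext j; simp [dVec]

theorem dVec_sum {ι : Type*} (s : Finset ι) (D : Derivation ℂ Ω Ω) (q : ι → Fin (n + 1) → Ω) :
    dVec D (∑ i ∈ s, q i) = ∑ i ∈ s, dVec D (q i) := by
  funext j; simp [dVec, Finset.sum_apply]

/-- The space of the vectors of `K` all of whose first derivatives lie in `K` as well. If `K` is the
generic member of a family of linear spaces, then this is its generic focal space. -/
def derivedKernel (K : Submodule Ω (Fin (n + 1) → Ω)) : Submodule Ω (Fin (n + 1) → Ω) where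
  carrier := {q | q ∈ K ∧ ∀ D : Derivation ℂ Ω Ω, dVec D q ∈ K}
  zero_mem' := ⟨K.zero_mem, fun D => by rw [dVec_zero]; exact K.zero_mem⟩
  add_mem' := fun ha hb => ⟨K.add_mem ha.1 hb.1, fun D => by
    rw [dVec_add]; exact K.add_mem (ha.2 D) (hb.2 D)⟩
  smul_mem' := fun c q hq => ⟨K.smul_mem _ hq.1, fun D => by
    rw [dVec_smul]; exact K.add_mem (K.smul_mem _ (hq.2 D)) (K.smul_mem _ hq.1)⟩

theorem derivedKernel_le (K : Submodule Ω (Fin (n + 1) → Ω)) : derivedKernel K ≤ K :=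
  fun _ h => h.1

/-- The derivation `D` fixes the generic member of the family: it maps the vectors of the frame `β`
to the span of this frame. -/
def IsVertical (β : Fin (r + 1) × Fin (n + 1) → Ω) (D : Derivation ℂ Ω Ω) : Prop :=
  ∀ i, dVec D (matRow β i) ∈ rowSpan β

/-- `K` is stable under the derivations that fix the generic member of the family, that is, it
depends only on this member and not on its frame. -/
def IsVerticallyStable (β : Fin (r + 1) × Fin (n + 1) → Ω)
    (K : Submodule Ω (Fin (n + 1) → Ω)) : Prop :=
  ∀ D, IsVertical β D → ∀ q ∈ K, dVec D q ∈ K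

theorem dVec_mem_span {m : ℕ} {v : Fin m → Fin (n + 1) → Ω} {D : Derivation ℂ Ω Ω}
    {K : Submodule Ω (Fin (n + 1) → Ω)} (hvK : Submodule.span Ω (Set.range v) ≤ K)
    (h : ∀ i, dVec D (v i) ∈ K)
    {q : Fin (n + 1) → Ω} (hq : q ∈ Submodule.span Ω (Set.range v)) : dVec D q ∈ K := by
  obtain ⟨a, rfl⟩ := (Submodule.mem_span_range_iff_exists_fun Ω).1 hq
  rw [dVec_sum]
  refine K.sum_mem fun i _ => ?_
  rw [dVec_smul]
  exact K.add_mem (K.smul_mem _ (h i)) (K.smul_mem _ (hvK (Submodule.subset_span ⟨i, rfl⟩)))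

theorem isVerticallyStable_rowSpan : IsVerticallyStable β (rowSpan β) :=
  fun _ hD _ hq => dVec_mem_span le_rfl hD hq

theorem dVec_dVec (D D' : Derivation ℂ Ω Ω) (q : Fin (n + 1) → Ω) :
    dVec D (dVec D' q) = dVec D' (dVec D q) + dVec ⁅D, D'⁆ q := by
  funext j
  simp [dVec, Derivation.commutator_apply]

/-- For a vertical derivation `D` and any derivation `D'`, the vectors `D' D q` and `D D' q` differ
by `⁅D, D'⁆ q`. -/
theorem isVerticallyStable_derivedKernel {K : Submodule Ω (Fin (n + 1) → Ω)}
    (hK : IsVerticallyStable β K) : IsVerticallyStable β (derivedKernel K) := by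
  intro D hD q hq
  have hq2 : ∀ D', dVec D' q ∈ K := hq.2
  refine ⟨hq2 D, fun D' => ?_⟩
  rw [dVec_dVec]
  exact K.add_mem (hK D hD _ (hq2 D')) (hq2 _)

/-- For vertically stable spaces, it suffices to test the derived kernel on one derivation that
moves the generic member, since all others are multiples of it up to vertical ones. -/
theorem IsGenericFrame.mem_derivedKernel_iff (h : IsGenericFrame C β)
    {K : Submodule Ω (Fin (n + 1) → Ω)} (hK : IsVerticallyStable β K) {D : Derivation ℂ Ω Ω}
    (hD : ¬ IsVertical β D) {q : Fin (n + 1) → Ω} :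
    q ∈ derivedKernel K ↔ q ∈ K ∧ dVec D q ∈ K := by
  refine ⟨fun hq => ⟨hq.1, hq.2 D⟩, fun hq => ⟨hq.1, fun D' => ?_⟩⟩
  obtain ⟨c, hc⟩ := h.exists_sub_smul_mem (not_forall.1 hD) D'
  have h1 : ∀ q : Fin (n + 1) → Ω, dVec (D' - c • D) q = dVec D' q - c • dVec D q := fun q => by
    funext j; simp [dVec]
  have h2 := hK (D' - c • D) (fun i => by rw [h1]; exact hc i) q hq.1
  rw [h1] at h2
  rw [← sub_add_cancel (dVec D' q) (c • dVec D q)]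
  exact K.add_mem h2 (K.smul_mem _ hq.2)

/-- If the velocities are derivatives along `D`, then the focal space consists of the vectors of
the span whose derivative along `D` stays in the span. By the product rule, the derivatives of the
coefficients do not matter. -/
theorem focalSpace_dVec {m : ℕ} (v : Fin m → Fin (n + 1) → Ω) (D : Derivation ℂ Ω Ω)
    {q : Fin (n + 1) → Ω} : q ∈ focalSpace v (fun i => dVec D (v i)) ↔
      q ∈ Submodule.span Ω (Set.range v) ∧ dVec D q ∈ Submodule.span Ω (Set.range v) := by
  have key : ∀ a : Fin m → Ω, (∑ i, a i • dVec D (v i) ∈ Submodule.span Ω (Set.range v) ↔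
      dVec D (∑ i, a i • v i) ∈ Submodule.span Ω (Set.range v)) := by
    intro a
    rw [dVec_sum]
    simp only [dVec_smul, Finset.sum_add_distrib]
    have h1 : ∑ i, D (a i) • v i ∈ Submodule.span Ω (Set.range v) :=
      Submodule.sum_mem _ fun i _ => Submodule.smul_mem _ _ (Submodule.subset_span ⟨i, rfl⟩)
    exact (Submodule.add_mem_iff_left _ h1).symm
  rw [mem_focalSpace]
  constructor
  · rintro ⟨a, h1, rfl⟩
    exact ⟨Submodule.sum_mem _ fun i _ => Submodule.smul_mem _ _ (Submodule.subset_span ⟨i, rfl⟩),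
      (key a).1 h1⟩
  · rintro ⟨h1, h2⟩
    obtain ⟨a, rfl⟩ := (Submodule.mem_span_range_iff_exists_fun Ω).1 h1
    exact ⟨a, (key a).2 h2, rfl⟩

end Derived

/-! ### Polynomial sections of families of linear spaces -/

section Sections
variable {r n m : ℕ} {Ω : Type} [Field Ω] [Algebra ℂ Ω] {C : Set (Grass r n)}
  {β : Fin (r + 1) × Fin (n + 1) → Ω}

/-- A polynomial section lying in the span of others generically does so wherever the latter are
independent. -/
theorem IsGenericPointOf.evalVec_mem_span (hβ : IsGenericPointOf β (framesOf C)) {b : Frame r n}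
    (hb : b.span ∈ C) {κ : Fin m → Fin (n + 1) → MvPolynomial (Fin (r + 1) × Fin (n + 1)) ℂ}
    (hκ : LinearIndependent ℂ fun i => evalVec b.coords (κ i))
    {κ' : Fin (n + 1) → MvPolynomial (Fin (r + 1) × Fin (n + 1)) ℂ}
    (h : aevalVec β κ' ∈ Submodule.span Ω (Set.range fun i => aevalVec β (κ i))) :
    evalVec b.coords κ' ∈ Submodule.span ℂ (Set.range fun i => evalVec b.coords (κ i)) := by
  by_contra hne
  obtain ⟨f, hf1, hf2⟩ := Submodule.exists_le_ker_of_notMem hne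
  have hf : ∀ u : Vec n, f u = ∑ j, u j * f (Pi.single j 1) := fun u => by
    conv_lhs => rw [pi_eq_sum_univ' u, map_sum]
    simp
  obtain ⟨l, hl1, hl2⟩ := exists_polynomial_functional hβ hb hκ
    (l₀ := fun j => f (Pi.single j 1)) (fun i => by
      rw [← hf]
      exact hf2 (Submodule.subset_span ⟨i, rfl⟩))
  apply hf1
  have hl3 : ∀ j, f (Pi.single j 1) = evalVec b.coords l j := fun j => (congrFun hl2 j).symm
  rw [hf]
  simp only [hl3]
  have h1 : MvPolynomial.aeval β (∑ j, κ' j * l j) = 0 := by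
    obtain ⟨c, hc⟩ := (Submodule.mem_span_range_iff_exists_fun Ω).1 h
    rw [map_sum]
    simp only [map_mul]
    have : ∀ j, MvPolynomial.aeval β (κ' j) = ∑ i, c i * aevalVec β (κ i) j := fun j => by
      have := congrFun hc j
      simp only [Finset.sum_apply, Pi.smul_apply, smul_eq_mul] at this
      exact this.symm
    simp only [this, Finset.sum_mul]
    rw [Finset.sum_comm]
    refine Finset.sum_eq_zero fun i _ => ?_
    have := hl1 i
    simp only [mul_assoc, ← Finset.mul_sum]
    rw [show ∑ j, aevalVec β (κ i) j * MvPolynomial.aeval β (l j) = 0 from this, mul_zero]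
  have h2 := hβ.eval_eq_zero ⟨b, rfl, hb⟩ _ h1
  simpa [evalVec] using h2

/-- Polynomial sections that are independent at a special frame are generically independent. -/
theorem IsGenericPointOf.linearIndependent_aevalVec (hβ : IsGenericPointOf β (framesOf C))
    {b : Frame r n} (hb : b.span ∈ C)
    {κ : Fin m → Fin (n + 1) → MvPolynomial (Fin (r + 1) × Fin (n + 1)) ℂ}
    (hκ : LinearIndependent ℂ fun i => evalVec b.coords (κ i)) :
    LinearIndependent Ω fun i => aevalVec β (κ i) := by
  obtain ⟨g, hg⟩ := LinearMap.exists_leftInverse_of_injective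
    (Fintype.linearCombination ℂ fun i => evalVec b.coords (κ i))
    (LinearMap.ker_eq_bot.2 (linearIndependent_iff_injective_fintypeLinearCombination.1 hκ))
  have hgκ : ∀ k, g (evalVec b.coords (κ k)) = Pi.single k 1 := fun k => by
    have := LinearMap.congr_fun hg (Pi.single k 1)
    simpa [Fintype.linearCombination_apply_single] using this
  -- a matrix of polynomials whose determinant is `1` at `b`, and hence nonzero at `β`
  let M : Matrix (Fin m) (Fin m) (MvPolynomial (Fin (r + 1) × Fin (n + 1)) ℂ) :=
    Matrix.of fun k i => ∑ j, κ k j * MvPolynomial.C (g (Pi.single j 1) i)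
  have h1 : M.map (MvPolynomial.eval b.coords) = 1 := by
    ext k i
    have h2 := congrFun (hgκ k) i
    rw [pi_eq_sum_univ' (evalVec b.coords (κ k)), map_sum] at h2
    simp only [Finset.sum_apply, map_smul, Pi.smul_apply, smul_eq_mul] at h2
    simp only [M, Matrix.map_apply, Matrix.of_apply, map_sum, map_mul, MvPolynomial.eval_C,
      Matrix.one_apply]
    rw [show ∑ j, MvPolynomial.eval b.coords (κ k j) * g (Pi.single j 1) i = _ from h2,
      Pi.single_apply]
    exact if_congr eq_comm rfl rfl
  have h2 : (M.map (MvPolynomial.aeval β)).det ≠ 0 := by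
    intro h0
    have h3 : MvPolynomial.aeval β M.det = 0 := by
      rw [AlgHom.map_det]; exact h0
    have h4 := hβ.eval_eq_zero ⟨b, rfl, hb⟩ _ h3
    rw [RingHom.map_det] at h4
    change (M.map (MvPolynomial.eval b.coords)).det = 0 at h4
    rw [h1, Matrix.det_one] at h4
    exact one_ne_zero h4
  have h3 := Matrix.linearIndependent_rows_of_det_ne_zero h2
  let G : (Fin (n + 1) → Ω) →ₗ[Ω] Fin m → Ω :=
    LinearMap.pi fun i => Fintype.linearCombination Ω fun j => algebraMap ℂ Ω (g (Pi.single j 1) i)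
  refine LinearIndependent.of_comp G ?_
  have h4 : (fun i => M.map (MvPolynomial.aeval β) i) = G ∘ fun i => aevalVec β (κ i) := by
    funext k i
    simp [G, M, Fintype.linearCombination_apply, aevalVec]
  rw [← h4]
  exact h3

/-- The derivative of a vector of polynomials along a polynomial vector field. -/
def derivVec {ι : Type} [Fintype ι] (w : ι → MvPolynomial ι ℂ)
    (κ : Fin (n + 1) → MvPolynomial ι ℂ) : Fin (n + 1) → MvPolynomial ι ℂ :=
  fun j => ∑ i, MvPolynomial.pderiv i (κ j) * w i

theorem evalVec_derivVec {ι : Type} [Fintype ι] (x : ι → ℂ) (w : ι → MvPolynomial ι ℂ)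
    (κ : Fin (n + 1) → MvPolynomial ι ℂ) :
    evalVec x (derivVec w κ) = diffVec x (fun i => MvPolynomial.eval x (w i)) κ := by
  funext j
  simp [evalVec, derivVec, diffVec, differential, MvPolynomial.aeval_eq_eval]

theorem aevalVec_derivVec {ι : Type} [Fintype ι] (x : ι → Ω) (w : ι → MvPolynomial ι ℂ)
    (κ : Fin (n + 1) → MvPolynomial ι ℂ) :
    aevalVec x (derivVec w κ) = diffVec x (fun i => MvPolynomial.aeval x (w i)) κ := by
  funext j
  simp [aevalVec, derivVec, diffVec, differential]

theorem dVec_aevalVec {ι : Type} [Fintype ι] (D : Derivation ℂ Ω Ω) (x : ι → Ω)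
    (κ : Fin (n + 1) → MvPolynomial ι ℂ) :
    dVec D (aevalVec x κ) = diffVec x (fun i => D (x i)) κ := by
  funext j
  exact D.apply_aeval x (κ j)

theorem diffVec_add {R ι : Type} [CommRing R] [Algebra ℂ R] [Fintype ι] (x w w' : ι → R)
    (κ : Fin (n + 1) → MvPolynomial ι ℂ) :
    diffVec x (w + w') κ = diffVec x w κ + diffVec x w' κ := by
  funext j
  exact differential_add_vec _ _ _ _

theorem diffVec_smul {R ι : Type} [CommRing R] [Algebra ℂ R] [Fintype ι] (x w : ι → R) (c : R)
    (κ : Fin (n + 1) → MvPolynomial ι ℂ) :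
    diffVec x (c • w) κ = c • diffVec x w κ := by
  funext j
  exact differential_smul_vec _ _ _ _

/-- The rows of a frame, as polynomial sections. -/
def rowSection (r n : ℕ) (i : Fin (r + 1)) :
    Fin (n + 1) → MvPolynomial (Fin (r + 1) × Fin (n + 1)) ℂ :=
  fun j => MvPolynomial.X (i, j)

theorem evalVec_rowSection (x : Fin (r + 1) × Fin (n + 1) → ℂ) (i : Fin (r + 1)) :
    evalVec x (rowSection r n i) = matRow x i := by
  funext j; simp [evalVec, rowSection, matRow]

theorem aevalVec_rowSection (i : Fin (r + 1)) :
    aevalVec β (rowSection r n i) = matRow β i := by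
  funext j; simp [aevalVec, rowSection, matRow]

theorem diffVec_rowSection (x w : Fin (r + 1) × Fin (n + 1) → ℂ) (i : Fin (r + 1)) :
    diffVec x w (rowSection r n i) = matRow w i := by
  funext j; simp [diffVec, rowSection, matRow, differential_X]

theorem generic_aevalVec {ι : Type} [Finite ι] (x : ι → Ω)
    (κ : Fin (n + 1) → MvPolynomial ι ℂ) : ∀ᶠ φ in genericFilter Ω,
      evalVec (fun i => φ (x i)) κ = fun j => φ (aevalVec x κ j) := by
  filter_upwards [generic_aeval x] with φ h
  funext j
  exact (h _).symm

theorem generic_dVec_aevalVec {ι : Type} [Fintype ι] (D : Derivation ℂ Ω Ω) (x : ι → Ω)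
    (κ : Fin (n + 1) → MvPolynomial ι ℂ) : ∀ᶠ φ in genericFilter Ω,
      diffVec (fun i => φ (x i)) (fun i => φ (D (x i))) κ =
        fun j => φ (dVec D (aevalVec x κ) j) := by
  filter_upwards [generic_differential x (fun i => D (x i))] with φ h
  rw [dVec_aevalVec]
  funext j
  exact (h _).symm

/-- Vertical tangent vectors preserve the span of sections that is generically vertically stable. -/
theorem IsGenericFrame.diffVec_mem_of_vertical (h : IsGenericFrame C β) {b : Frame r n}
    (hb : b.span ∈ C) {κ : Fin m → Fin (n + 1) → MvPolynomial (Fin (r + 1) × Fin (n + 1)) ℂ}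
    (hκ : LinearIndependent ℂ fun i => evalVec b.coords (κ i))
    (hst : IsVerticallyStable β (Submodule.span Ω (Set.range fun i => aevalVec β (κ i))))
    {w : Fin (r + 1) × Fin (n + 1) → ℂ} (hw : ∀ i, matRow w i ∈ b.span.1) (i : Fin m) :
    diffVec b.coords w (κ i) ∈ Submodule.span ℂ (Set.range fun i => evalVec b.coords (κ i)) := by
  obtain ⟨c, hc⟩ := (Submodule.mem_span_range_iff_exists_fun ℂ).1 (mem_span_vertical_iff.2 hw)
  let w' : Fin (r + 1) × Fin (n + 1) → MvPolynomial (Fin (r + 1) × Fin (n + 1)) ℂ := fun ij =>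
    ∑ l, MvPolynomial.C (c (ij.1, l)) * MvPolynomial.X (l, ij.2)
  have h1 : (fun ij => MvPolynomial.eval b.coords (w' ij)) = w := by
    funext ij
    have := congrFun (matRow_sum_vertical b.1 c ij.1) ij.2
    rw [hc] at this
    simp only [matRow, Finset.sum_apply, Pi.smul_apply, smul_eq_mul] at this
    simp only [w', map_sum, map_mul, MvPolynomial.eval_C, MvPolynomial.eval_X]
    exact this.symm
  have h2 : ∀ i, matRow (fun ij => MvPolynomial.aeval β (w' ij)) i =
      ∑ l, algebraMap ℂ Ω (c (i, l)) • matRow β l := by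
    intro i
    funext j
    simp [w', matRow, Finset.sum_apply, Algebra.smul_def]
  have h3 : (fun ij => MvPolynomial.aeval β (w' ij)) ∈ genericTangent β := by
    have : (fun ij => MvPolynomial.aeval β (w' ij)) =
        ∑ ik, algebraMap ℂ Ω (c ik) • vertical (matRow β) ik := by
      funext ij
      have e1 := congrFun (h2 ij.1) ij.2
      rw [← matRow_sum_vertical (matRow β) (fun ik => algebraMap ℂ Ω (c ik))] at e1
      exact e1
    rw [this]
    exact Submodule.sum_mem _ fun ik _ => Submodule.smul_mem _ _ (h.vertical_mem_genericTangent ik)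
  obtain ⟨D, hD⟩ := exists_derivation_of_mem_genericTangent h3
  have hDv : IsVertical β D := by
    intro i
    rw [show dVec D (matRow β i) = _ from (funext fun j => hD (i, j)).trans (h2 i)]
    exact Submodule.sum_mem _ fun l _ => Submodule.smul_mem _ _ (Submodule.subset_span ⟨l, rfl⟩)
  have h4 := hst D hDv _ (Submodule.subset_span ⟨i, rfl⟩)
  rw [dVec_aevalVec, show (fun ij => D (β ij)) = _ from funext hD, ← aevalVec_derivVec] at h4
  have h5 := h.generic.evalVec_mem_span hb hκ h4
  rwa [evalVec_derivVec, h1] at h5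

end Sections

/-! ### Focal points of special members -/

section Lift
variable {r n m : ℕ} {Ω : Type} [Field Ω] [Algebra ℂ Ω] {C : Set (Grass r n)}
  {β : Fin (r + 1) × Fin (n + 1) → Ω}

/-- If the focal space at a special frame `b` is not larger than the one at the generic frame, then
each of its vectors is the value at `b` of a polynomial section with values in the generic focal
space. -/
theorem IsGenericFrame.exists_section_derivedKernel (h : IsGenericFrame C β) {b : Frame r n}
    (hb : b.span ∈ C) {κ : Fin m → Fin (n + 1) → MvPolynomial (Fin (r + 1) × Fin (n + 1)) ℂ}
    (hκ : LinearIndependent ℂ fun i => evalVec b.coords (κ i))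
    {K : Submodule Ω (Fin (n + 1) → Ω)} (hK : IsVerticallyStable β K)
    (hκK : Submodule.span Ω (Set.range fun i => aevalVec β (κ i)) = K)
    {w₀ : Fin (r + 1) × Fin (n + 1) → ℂ} (hw₀ : w₀ ∈ zariskiTangent (framesOf C) b.coords)
    (hw₀b : ∃ i, matRow w₀ i ∉ b.span.1)
    (hd : Module.finrank ℂ (focalSpace (fun i => evalVec b.coords (κ i))
      (fun i => diffVec b.coords w₀ (κ i))) ≤ Module.finrank Ω (derivedKernel K))
    {q : Vec n} (hq : q ∈ focalSpace (fun i => evalVec b.coords (κ i))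
      (fun i => diffVec b.coords w₀ (κ i))) :
    ∃ κ' : Fin (n + 1) → MvPolynomial (Fin (r + 1) × Fin (n + 1)) ℂ,
      aevalVec β κ' ∈ derivedKernel K ∧ evalVec b.coords κ' = q := by
  obtain ⟨w, hwβ, hwb⟩ := h.exists_polynomial_mem_genericTangent hb hw₀
  obtain ⟨D, hD⟩ := exists_derivation_of_mem_genericTangent hwβ
  have hDκ : ∀ κ : Fin (n + 1) → MvPolynomial (Fin (r + 1) × Fin (n + 1)) ℂ,
      aevalVec β (derivVec w κ) = dVec D (aevalVec β κ) := fun κ => by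
    rw [aevalVec_derivVec, dVec_aevalVec, funext hD]
  have hbκ : ∀ κ : Fin (n + 1) → MvPolynomial (Fin (r + 1) × Fin (n + 1)) ℂ,
      evalVec b.coords (derivVec w κ) = diffVec b.coords w₀ κ := fun κ => by
    rw [evalVec_derivVec, funext hwb]
  have hDv : ¬ IsVertical β D := by
    intro hv
    obtain ⟨i, hi⟩ := hw₀b
    apply hi
    have h1 : aevalVec β (derivVec w (rowSection r n i)) ∈
        Submodule.span Ω (Set.range fun i => aevalVec β (rowSection r n i)) := by
      rw [hDκ]
      simp only [aevalVec_rowSection]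
      exact hv i
    have h2 := h.generic.evalVec_mem_span hb (κ := rowSection r n)
      (by simp only [evalVec_rowSection]; exact b.2) h1
    rw [hbκ, diffVec_rowSection] at h2
    simp only [evalVec_rowSection] at h2
    exact h2
  have hκβ := h.generic.linearIndependent_aevalVec hb hκ
  let R := focalMatrix κ fun i => derivVec w (κ i)
  have hRβ : R.map (MvPolynomial.aeval β) = focalMatrix (fun i => aevalVec β (κ i))
      (fun i => dVec D (aevalVec β (κ i))) := by
    ext j s
    rcases s with i | i
    · exact congrFun (hDκ (κ i)) j
    · rfl
  have hRb : R.map (MvPolynomial.eval b.coords) = focalMatrix (fun i => evalVec b.coords (κ i))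
      (fun i => diffVec b.coords w₀ (κ i)) := by
    ext j s
    rcases s with i | i
    · exact congrFun (hbκ (κ i)) j
    · rfl
  have hfoc : focalSpace (fun i => aevalVec β (κ i)) (fun i => dVec D (aevalVec β (κ i))) =
      derivedKernel K := by
    ext k
    rw [focalSpace_dVec, h.mem_derivedKernel_iff hK hDv, hκK]
  have r1 := rank_focalMatrix_add_finrank (u := fun i => dVec D (aevalVec β (κ i))) hκβ
  have r2 := rank_focalMatrix_add_finrank (u := fun i => diffVec b.coords w₀ (κ i)) hκ
  rw [hfoc, ← hRβ] at r1
  rw [← hRb] at r2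
  obtain ⟨a, ha, rfl⟩ := mem_focalSpace.1 hq
  obtain ⟨c, hc⟩ := (Submodule.mem_span_range_iff_exists_fun ℂ).1 ha
  obtain ⟨x, hx1, hx2⟩ := exists_polynomial_mem_ker R (ξ := β) (x := b.coords)
    (v₀ := Sum.elim a (-c)) (h.generic.eval_eq_zero ⟨b, rfl, hb⟩) (by omega) (by
      rw [hRb, focalMatrix_mulVec]
      simp [← hc])
  rw [hRβ, focalMatrix_mulVec] at hx1
  let κ' : Fin (n + 1) → MvPolynomial (Fin (r + 1) × Fin (n + 1)) ℂ := fun j =>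
    ∑ i, x (Sum.inl i) * κ i j
  have hκ' : aevalVec β κ' = ∑ i, MvPolynomial.aeval β (x (Sum.inl i)) • aevalVec β (κ i) := by
    funext j
    simp [κ', aevalVec, Finset.sum_apply]
  refine ⟨κ', ?_, ?_⟩
  · rw [← hfoc, mem_focalSpace]
    refine ⟨_, ?_, hκ'.symm⟩
    rw [eq_neg_of_add_eq_zero_left hx1]
    exact Submodule.neg_mem _ (Submodule.sum_mem _ fun i _ =>
      Submodule.smul_mem _ _ (Submodule.subset_span ⟨i, rfl⟩))
  · funext j
    have : ∀ i, MvPolynomial.eval b.coords (x (Sum.inl i)) = a i := fun i => hx2 (Sum.inl i)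
    simp [κ', evalVec, Finset.sum_apply, this]

end Lift

/-! ### Families of linear spaces and their focal loci -/

section Family
variable {r n m : ℕ} {Ω : Type} [Field Ω] [Algebra ℂ Ω] {C : Set (Grass r n)}
  {β : Fin (r + 1) × Fin (n + 1) → Ω}

theorem span_eq_of_linearIndependent {k : Type} [Field k] {v u : Fin m → Fin (n + 1) → k}
    (hv : LinearIndependent k v) (h : ∀ i, v i ∈ Submodule.span k (Set.range u)) :
    Submodule.span k (Set.range v) = Submodule.span k (Set.range u) := by
  apply Submodule.eq_of_le_of_finrank_le
  · rw [Submodule.span_le]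
    rintro _ ⟨i, rfl⟩
    exact h i
  · rw [finrank_span_eq_card hv]
    exact finrank_range_le_card u

/-- The incidence variety `I` is a family of linear subspaces of the members of `C`, and its generic
member is spanned by the vectors `v`. -/
structure IsLinearFamily (C : Set (Grass r n)) (β : Fin (r + 1) × Fin (n + 1) → Ω)
    (I : Set (PSpace n × Grass r n)) (v : Fin m → Fin (n + 1) → Ω) : Prop where
  snd_mem : ∀ x ∈ I, x.2 ∈ C
  linearIndependent : LinearIndependent Ω v
  stable : IsVerticallyStable β (Submodule.span Ω (Set.range v))
  exists_section : ∀ (q : Vec n) (hq : q ≠ 0) (b : Frame r n),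
    (Projectivization.mk ℂ q hq, b.span) ∈ I →
    ∃ κ : Fin (n + 1) → MvPolynomial (Fin (r + 1) × Fin (n + 1)) ℂ,
      aevalVec β κ ∈ Submodule.span Ω (Set.range v) ∧ evalVec b.coords κ = q
  generic : ∀ᶠ φ in genericFilter Ω, ∃ b : Frame r n, b.span ∈ C ∧ b.coords = (fun ij => φ (β ij)) ∧
    ∀ (q : Vec n) (hq : q ≠ 0), (Projectivization.mk ℂ q hq, b.span) ∈ I ↔
      q ∈ Submodule.span ℂ (Set.range fun i j => φ (v i j))

/-- The focal points of a family of linear spaces on the member over `b` form a linear space: the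
focal space of any polynomial sections that form a basis of this member and belong to the generic
member. -/
theorem IsLinearFamily.mk_mem_focalLocus_iff {I : Set (PSpace n × Grass r n)}
    {v : Fin m → Fin (n + 1) → Ω} (hI : IsLinearFamily C β I v) (h : IsGenericFrame C β)
    {κ : Fin m → Fin (n + 1) → MvPolynomial (Fin (r + 1) × Fin (n + 1)) ℂ}
    (hκv : ∀ i, aevalVec β (κ i) ∈ Submodule.span Ω (Set.range v)) {b : Frame r n}
    (hb : b.span ∈ C) (hκ : LinearIndependent ℂ fun i => evalVec b.coords (κ i))
    (hIb : ∀ (q : Vec n) (hq : q ≠ 0), (Projectivization.mk ℂ q hq, b.span) ∈ I ↔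
      q ∈ Submodule.span ℂ (Set.range fun i => evalVec b.coords (κ i)))
    {w₀ : Fin (r + 1) × Fin (n + 1) → ℂ} (hw₀ : w₀ ∈ zariskiTangent (framesOf C) b.coords)
    (hw₀b : ∃ i, matRow w₀ i ∉ b.span.1) {q : Vec n} (hq : q ≠ 0) :
    Projectivization.mk ℂ q hq ∈ focalLocus I b.span ↔
      q ∈ focalSpace (fun i => evalVec b.coords (κ i)) (fun i => diffVec b.coords w₀ (κ i)) := by
  have hspan := span_eq_of_linearIndependent (h.generic.linearIndependent_aevalVec hb hκ) hκv
  rw [mem_focalSpace]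
  constructor
  · intro hfoc
    obtain ⟨hmem, u, hu, huq, hub⟩ := (isFocal_iff hq b).1 hfoc
    obtain ⟨a, rfl⟩ := (Submodule.mem_span_range_iff_exists_fun ℂ).1 ((hIb _ hq).1 hmem)
    have hw := mem_zariskiTangent_framesOf hI.snd_mem hu
    have h1 := sub_mem_span_of_mem_zariskiTangent h.generic hb hI.snd_mem hκ
      (fun q hq b' hmem' => by
        rw [hspan]
        exact hI.exists_section q hq b' hmem') a hu
    have h2 : ∑ i, a i • diffVec b.coords (fun ij => u (Sum.inr ij)) (κ i) ∈
        Submodule.span ℂ (Set.range fun i => evalVec b.coords (κ i)) := by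
      obtain ⟨c, hc⟩ := Submodule.mem_span_singleton.1 huq
      rw [← hc] at h1
      refine (Submodule.sub_mem_iff_right _ ?_).1 h1
      exact Submodule.smul_mem _ _ (Submodule.sum_mem _ fun i _ =>
        Submodule.smul_mem _ _ (Submodule.subset_span ⟨i, rfl⟩))
    -- `u` is a nonzero multiple of `w₀` modulo vertical vectors
    obtain ⟨w₁, -, -, hw₁⟩ := exists_mem_zariskiTangent_of_finrank_eq_one (h.smooth b hb)
    obtain ⟨c, hc⟩ := hw₁ _ hw
    obtain ⟨c₀, hc₀⟩ := hw₁ _ hw₀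
    have hcne : c ≠ 0 := by
      rintro rfl
      obtain ⟨i, hi⟩ := hub
      apply hi
      have := hc i
      rwa [zero_smul, sub_zero] at this
    let w' : Fin (r + 1) × Fin (n + 1) → ℂ := c • w₀ - c₀ • fun ij => u (Sum.inr ij)
    have hw' : ∀ i, matRow w' i ∈ b.span.1 := by
      intro i
      have : matRow w' i = c • (matRow w₀ i - c₀ • matRow w₁ i) -
          c₀ • (matRow (fun ij => u (Sum.inr ij)) i - c • matRow w₁ i) := by
        funext j
        simp [w', matRow]
        ring
      rw [this]
      exact Submodule.sub_mem _ (Submodule.smul_mem _ _ (hc₀ i)) (Submodule.smul_mem _ _ (hc i))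
    have h3 : ∀ i, diffVec b.coords w' (κ i) ∈
        Submodule.span ℂ (Set.range fun i => evalVec b.coords (κ i)) := fun i =>
      h.diffVec_mem_of_vertical hb hκ (by rw [hspan]; exact hI.stable) hw' i
    have h4 : ∀ i, c • diffVec b.coords w₀ (κ i) = diffVec b.coords w' (κ i) +
        c₀ • diffVec b.coords (fun ij => u (Sum.inr ij)) (κ i) := fun i => by
      rw [← diffVec_smul, ← diffVec_smul, ← diffVec_add]
      congr 1
      simp [w']
    refine ⟨a, ?_, rfl⟩
    rw [← Submodule.smul_mem_iff _ hcne, Finset.smul_sum]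
    have h5 : ∑ i, c • a i • diffVec b.coords w₀ (κ i) =
        ∑ i, a i • diffVec b.coords w' (κ i) +
        c₀ • ∑ i, a i • diffVec b.coords (fun ij => u (Sum.inr ij)) (κ i) := by
      rw [Finset.smul_sum, ← Finset.sum_add_distrib]
      refine Finset.sum_congr rfl fun i _ => ?_
      rw [smul_comm c, h4, smul_add, smul_comm c₀]
    rw [h5]
    exact Submodule.add_mem _ (Submodule.sum_mem _ fun i _ => Submodule.smul_mem _ _ (h3 i))
      (Submodule.smul_mem _ _ h2)
  · rintro ⟨a, ha, rfl⟩
    refine isFocal_of_diffVec_mem h.generic (fun κ' hκ' hκ'0 => ?_) hb hw₀ hw₀b a ha hq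
      ((hIb _ hq).2 (Submodule.sum_mem _ fun i _ =>
        Submodule.smul_mem _ _ (Submodule.subset_span ⟨i, rfl⟩)))
    rw [hspan] at hκ'
    obtain ⟨j, hj⟩ := Function.ne_iff.1 hκ'0
    filter_upwards [hI.generic, generic_mem_span hκ', generic_aevalVec β κ', generic_ne hj]
      with φ ⟨b', hb'C, hb', hb'I⟩ h1 h2 h3
    rw [← h2] at h1
    have hne : evalVec (fun ij => φ (β ij)) κ' ≠ 0 := fun h0 => h3 (by
      rw [h2] at h0; exact congrFun h0 j)
    exact ⟨_, hne, b', by rw [hb'], (hb'I _ hne).2 h1⟩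

theorem generic_span_eq {v u : Fin m → Fin (n + 1) → Ω}
    (h : Submodule.span Ω (Set.range v) = Submodule.span Ω (Set.range u)) :
    ∀ᶠ φ in genericFilter Ω, Submodule.span ℂ (Set.range fun i j => φ (v i j)) =
      Submodule.span ℂ (Set.range fun i j => φ (u i j)) := by
  have h1 : ∀ᶠ φ in genericFilter Ω, ∀ i, (fun j => φ (v i j)) ∈
      Submodule.span ℂ (Set.range fun i j => φ (u i j)) := eventually_all.2 fun i =>
    generic_mem_span (by rw [← h]; exact Submodule.subset_span ⟨i, rfl⟩)
  have h2 : ∀ᶠ φ in genericFilter Ω, ∀ i, (fun j => φ (u i j)) ∈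
      Submodule.span ℂ (Set.range fun i j => φ (v i j)) := eventually_all.2 fun i =>
    generic_mem_span (by rw [h]; exact Submodule.subset_span ⟨i, rfl⟩)
  filter_upwards [h1, h2] with φ h1 h2
  apply le_antisymm <;> rw [Submodule.span_le] <;> rintro _ ⟨i, rfl⟩
  · exact h1 i
  · exact h2 i

/-- The generic focal space of a linear family is the derived kernel of its generic member. -/
theorem IsLinearFamily.generic_focalLocus {I : Set (PSpace n × Grass r n)}
    {v : Fin m → Fin (n + 1) → Ω} (hI : IsLinearFamily C β I v) (h : IsGenericFrame C β)
    {κ : Fin m → Fin (n + 1) → MvPolynomial (Fin (r + 1) × Fin (n + 1)) ℂ}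
    (hκ : Submodule.span Ω (Set.range fun i => aevalVec β (κ i)) = Submodule.span Ω (Set.range v))
    {d : ℕ} {k : Fin d → Fin (n + 1) → Ω} (hk : LinearIndependent Ω k)
    (hspan : Submodule.span Ω (Set.range k) = derivedKernel (Submodule.span Ω (Set.range v))) :
    ∀ᶠ φ in genericFilter Ω, ∃ b : Frame r n, b.span ∈ C ∧ b.coords = (fun ij => φ (β ij)) ∧
      ∀ (q : Vec n) (hq : q ≠ 0), Projectivization.mk ℂ q hq ∈ focalLocus I b.span ↔
        q ∈ Submodule.span ℂ (Set.range fun i j => φ (k i j)) := by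
  obtain ⟨D, i₀, hD⟩ := h.exists_derivation
  have hκli : LinearIndependent Ω fun i => aevalVec β (κ i) := by
    rw [linearIndependent_iff_card_eq_finrank_span, Set.finrank, hκ,
      finrank_span_eq_card hI.linearIndependent]
  have hfoc : Submodule.span Ω (Set.range k) = focalSpace (fun i => aevalVec β (κ i))
      (fun i => dVec D (aevalVec β (κ i))) := by
    ext q
    rw [hspan, focalSpace_dVec, h.mem_derivedKernel_iff hI.stable fun hv => hD (hv i₀), hκ]
  filter_upwards [hI.generic, generic_focalSpace hκli hk hfoc, generic_span_eq hκ,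
    generic_mem_zariskiTangent h.generic (derivation_mem_genericTangent D β),
    generic_notMem_span h.linearIndependent hD,
    eventually_all.2 fun i => generic_aevalVec β (κ i),
    eventually_all.2 fun i => generic_dVec_aevalVec D β (κ i),
    generic_linearIndependent hκli]
    with φ ⟨b, hbC, hb, hbI⟩ h1 h6 h7 h8 h9 h10 h11
  refine ⟨b, hbC, hb, fun q hq => ?_⟩
  rw [← hb] at h7 h9 h10
  rw [hI.mk_mem_focalLocus_iff h (κ := κ) (fun i => by
    rw [← hκ]; exact Submodule.subset_span ⟨i, rfl⟩) hbC (by simpa only [h9] using h11) ?_ h7 ?_ hq]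
  · simp only [h9, h10]
    rw [h1]
  · intro q hq
    rw [hbI]
    simp only [h9]
    rw [h6]
  · refine ⟨i₀, ?_⟩
    rw [Frame.span_eq_of_coords hb]
    exact h8

/-- The generic member of a linear family has a basis of polynomial sections. -/
theorem IsLinearFamily.exists_polynomial_basis {I : Set (PSpace n × Grass r n)}
    {v : Fin m → Fin (n + 1) → Ω} (hI : IsLinearFamily C β I v) (h : IsGenericFrame C β) :
    ∃ κ : Fin m → Fin (n + 1) → MvPolynomial (Fin (r + 1) × Fin (n + 1)) ℂ,
      Submodule.span Ω (Set.range fun i => aevalVec β (κ i)) = Submodule.span Ω (Set.range v) ∧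
      IsLinearFamily C β I (fun i => aevalVec β (κ i)) := by
  obtain ⟨φ, ⟨b, hbC, hb, hbI⟩, h1⟩ :=
    (hI.generic.and (generic_linearIndependent hI.linearIndependent)).exists
  choose κ hκ1 hκ2 using fun i => hI.exists_section _ (h1.ne_zero i) b
    ((hbI _ _).2 (Submodule.subset_span ⟨i, rfl⟩))
  have hli : LinearIndependent Ω fun i => aevalVec β (κ i) := by
    refine h.generic.linearIndependent_aevalVec hbC ?_
    simp only [hκ2]
    exact h1
  have hspan := span_eq_of_linearIndependent hli hκ1
  refine ⟨κ, hspan, hI.snd_mem, hli, ?_, ?_, ?_⟩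
  · rw [hspan]
    exact hI.stable
  · rw [hspan]
    exact hI.exists_section
  · filter_upwards [hI.generic, generic_span_eq hspan] with φ ⟨b, hbC, hb, hbI⟩ h2
    refine ⟨b, hbC, hb, ?_⟩
    rw [h2]
    exact hbI

end Family

/-! ### The family of the planes -/

section IncidenceFamily
variable {r n m : ℕ} {Ω : Type} [Field Ω] [Algebra ℂ Ω] {C : Set (Grass r n)}
  {β : Fin (r + 1) × Fin (n + 1) → Ω}

theorem mk_mem_incidence {q : Vec n} (hq : q ≠ 0) {σ : Grass r n} :
    (Projectivization.mk ℂ q hq, σ) ∈ incidence C ↔ σ ∈ C ∧ q ∈ σ.1 :=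
  and_congr_right fun _ => linearPoints_mk hq

theorem IsGenericFrame.isLinearFamily_incidence (h : IsGenericFrame C β) :
    IsLinearFamily C β (incidence C) (matRow β) where
  snd_mem := fun _ hx => hx.1
  linearIndependent := h.linearIndependent
  stable := isVerticallyStable_rowSpan
  exists_section := by
    intro q hq b hmem
    obtain ⟨a, rfl⟩ := Frame.mem_span_iff.1 ((mk_mem_incidence hq).1 hmem).2
    refine ⟨fun j => ∑ i, MvPolynomial.C (a i) * MvPolynomial.X (i, j), ?_, ?_⟩
    · rw [Submodule.mem_span_range_iff_exists_fun]
      refine ⟨fun i => algebraMap ℂ Ω (a i), ?_⟩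
      funext j
      simp [aevalVec, matRow, Finset.sum_apply, Algebra.smul_def]
    · funext j
      simp [evalVec, Frame.coords, Finset.sum_apply]
  generic := by
    filter_upwards [h.mem] with φ ⟨b, hbC, hb⟩
    refine ⟨b, hbC, hb, fun q hq => ?_⟩
    rw [mk_mem_incidence, Frame.span_eq_of_coords hb]
    exact and_iff_right hbC

theorem IsGenericFrame.mk_mem_focalLocus_incidence_iff (h : IsGenericFrame C β) {b : Frame r n}
    (hb : b.span ∈ C)
    {w₀ : Fin (r + 1) × Fin (n + 1) → ℂ} (hw₀ : w₀ ∈ zariskiTangent (framesOf C) b.coords)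
    (hw₀b : ∃ i, matRow w₀ i ∉ b.span.1) {q : Vec n} (hq : q ≠ 0) :
    Projectivization.mk ℂ q hq ∈ focalLocus (incidence C) b.span ↔
      q ∈ focalSpace (fun i => evalVec b.coords (rowSection r n i))
        (fun i => diffVec b.coords w₀ (rowSection r n i)) := by
  refine h.isLinearFamily_incidence.mk_mem_focalLocus_iff h (κ := rowSection r n) (fun i => ?_) hb
    ?_ (fun q hq => ?_) hw₀ hw₀b hq
  · rw [aevalVec_rowSection]
    exact Submodule.subset_span ⟨i, rfl⟩
  · simp only [evalVec_rowSection]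
    exact b.2
  · simp only [evalVec_rowSection]
    rw [mk_mem_incidence]
    exact and_iff_right hb

end IncidenceFamily

theorem Submodule.exists_basis_fin {k V : Type} [Field k] [AddCommGroup V] [Module k V]
    [FiniteDimensional k V] (K : Submodule k V) {d : ℕ} (hd : Module.finrank k K = d) :
    ∃ v : Fin d → V, LinearIndependent k v ∧ Submodule.span k (Set.range v) = K := by
  let e := Module.finBasisOfFinrankEq k K hd
  refine ⟨K.subtype ∘ e, e.linearIndependent.map' K.subtype K.ker_subtype, ?_⟩
  rw [Set.range_comp, ← Submodule.map_span, e.span_eq, Submodule.map_top, Submodule.range_subtype]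

/-! ### The family of the focal lines -/

section Developable
variable {n : ℕ} {Ω : Type} [Field Ω] [Algebra ℂ Ω] {C : Set (Grass 2 n)}
  {β : Fin (2 + 1) × Fin (n + 1) → Ω}

theorem eq_of_linearPoints_eq {L : Submodule ℂ (Vec n)} {S : Set (PSpace n)}
    (hS : S = linearPoints L) {K : Submodule ℂ (Vec n)}
    (hK : ∀ (q : Vec n) (hq : q ≠ 0), Projectivization.mk ℂ q hq ∈ S ↔ q ∈ K) : K = L := by
  ext q
  by_cases hq : q = 0
  · simp [hq]
  · rw [← hK q hq, hS, linearPoints_mk]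

theorem finrank_eq_two_of_hasFocalLine {σ : Grass 2 n} (hσ : HasFocalLine C σ)
    {K : Submodule ℂ (Vec n)} (hK : ∀ (q : Vec n) (hq : q ≠ 0),
      Projectivization.mk ℂ q hq ∈ focalLocus (incidence C) σ ↔ q ∈ K) :
    Module.finrank ℂ K = 2 := by
  obtain ⟨l, hl⟩ := hσ
  rw [eq_of_linearPoints_eq hl hK, l.2]

theorem IsGenericFrame.eventually_hasFocalLine (h : IsGenericFrame C β) (hdev : IsDevelopable C) :
    ∀ᶠ φ in genericFilter Ω, ∀ b : Frame 2 n, b.span ∈ C → b.coords = (fun ij => φ (β ij)) →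
      HasFocalLine C b.span := by
  obtain ⟨F, hF, hFC⟩ := General.exists_polynomial hdev
  rw [h.generic] at hF
  filter_upwards [generic_aeval β, generic_ne hF] with φ h1 h2 b hb hbφ
  rw [h1] at h2
  exact hFC b hb (by rwa [hbφ])

/-- For a developable family, the generic focal space is a line. -/
theorem IsGenericFrame.finrank_derivedKernel (h : IsGenericFrame C β) (hdev : IsDevelopable C) :
    Module.finrank Ω (derivedKernel (rowSpan β)) = 2 := by
  obtain ⟨k, hk, hspan⟩ := (derivedKernel (rowSpan β)).exists_basis_fin rfl
  obtain ⟨φ, ⟨b, hbC, hb, hbφ⟩, h1, h2⟩ := ((h.isLinearFamily_incidence.generic_focalLocus h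
    (κ := rowSection 2 n) (by simp only [aevalVec_rowSection]) hk hspan).and
    ((h.eventually_hasFocalLine hdev).and (generic_linearIndependent hk))).exists
  have h3 := finrank_eq_two_of_hasFocalLine (h1 b hbC hb) hbφ
  rw [finrank_span_eq_card h2, Fintype.card_fin] at h3
  exact h3

/-- Each point of a focal line, even of a special one, lies on a polynomial section of the family of
the focal lines. -/
theorem IsGenericFrame.exists_section_focalLine (h : IsGenericFrame C β) (hdev : IsDevelopable C)
    {b : Frame 2 n} (hb : b.span ∈ C) (hbl : HasFocalLine C b.span) {q : Vec n} (hq : q ≠ 0)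
    (hqb : Projectivization.mk ℂ q hq ∈ focalLocus (incidence C) b.span) :
    ∃ κ : Fin (n + 1) → MvPolynomial (Fin (2 + 1) × Fin (n + 1)) ℂ,
      aevalVec β κ ∈ derivedKernel (rowSpan β) ∧ evalVec b.coords κ = q := by
  obtain ⟨w₀, hw₀, hw₀b, -⟩ := exists_mem_zariskiTangent_of_finrank_eq_one (h.smooth b hb)
  have h1 := fun q hq => h.mk_mem_focalLocus_incidence_iff hb hw₀ hw₀b (q := q) hq
  refine h.exists_section_derivedKernel hb (κ := rowSection 2 n) ?_ isVerticallyStable_rowSpan ?_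
    hw₀ hw₀b ?_ ((h1 q hq).1 hqb)
  · simp only [evalVec_rowSection]
    exact b.2
  · simp only [aevalVec_rowSection]
    rfl
  · rw [h.finrank_derivedKernel hdev, finrank_eq_two_of_hasFocalLine hbl h1]

theorem mk_mem_firstFocal {q : Vec n} (hq : q ≠ 0) {σ : Grass 2 n} (hσ : σ ∈ C)
    (hσl : HasFocalLine C σ) : (Projectivization.mk ℂ q hq, σ) ∈ firstFocal C ↔
      Projectivization.mk ℂ q hq ∈ focalLocus (incidence C) σ :=
  ⟨fun h => h.2.2, fun h => ⟨hσ, hσl, h⟩⟩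

/-- The focal lines form a linear family. -/
theorem IsGenericFrame.isLinearFamily_firstFocal (h : IsGenericFrame C β)
    (hdev : IsDevelopable C) {k : Fin 2 → Fin (n + 1) → Ω}
    (hspan : Submodule.span Ω (Set.range k) = derivedKernel (rowSpan β)) :
    IsLinearFamily C β (firstFocal C) k := by
  have hk : LinearIndependent Ω k := by
    rw [linearIndependent_iff_card_eq_finrank_span, Set.finrank, hspan,
      h.finrank_derivedKernel hdev, Fintype.card_fin]
  refine ⟨fun x hx => hx.1, hk, ?_, ?_, ?_⟩
  · rw [hspan]
    exact isVerticallyStable_derivedKernel isVerticallyStable_rowSpan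
  · intro q hq b' hmem
    rw [hspan]
    exact h.exists_section_focalLine hdev hmem.1 hmem.2.1 hq hmem.2.2
  · filter_upwards [h.isLinearFamily_incidence.generic_focalLocus h
      (κ := rowSection 2 n) (by simp only [aevalVec_rowSection]) hk hspan,
      h.eventually_hasFocalLine hdev] with φ ⟨b, hbC, hb, hbφ⟩ h1
    refine ⟨b, hbC, hb, fun q hq => ?_⟩
    rw [mk_mem_firstFocal hq hbC (h1 b hbC hb)]
    exact hbφ q hq

end Developable

/-! ### Free parameters -/

section Free
variable {ι τ : Type} {Ω : Type} [Field Ω] [Algebra ℂ Ω] {β : ι → Ω}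

/-- The elements `s` are algebraically independent over the field generated by `β`: a polynomial
relation between `β` and `s` remains true when other elements are substituted for `s`. -/
def IsFreeOver (β : ι → Ω) (s : τ → Ω) : Prop :=
  ∀ G : MvPolynomial (ι ⊕ τ) ℂ, MvPolynomial.aeval (Sum.elim β s) G = 0 →
    ∀ x : τ → Ω, MvPolynomial.aeval (Sum.elim β x) G = 0

theorem IsFreeOver.comp {s : τ → Ω} (hs : IsFreeOver β s) {τ' : Type} {f : τ' → τ}
    (hf : Function.Injective f) : IsFreeOver β (s ∘ f) := by
  intro G hG x
  have h1 : ∀ y : τ → Ω, MvPolynomial.aeval (Sum.elim β y) (MvPolynomial.rename (Sum.map id f) G) =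
      MvPolynomial.aeval (Sum.elim β (y ∘ f)) G := fun y => by
    rw [MvPolynomial.aeval_rename]
    congr 2
    funext k
    rcases k with k | k <;> rfl
  have h2 := hs _ ((h1 s).trans hG) (Function.extend f x 0)
  rwa [h1, Function.extend_comp hf] at h2

theorem IsFreeOver.ne_zero {s : τ → Ω} (hs : IsFreeOver β s) [Nonempty τ] : s ≠ 0 := by
  rintro rfl
  obtain ⟨t⟩ := ‹Nonempty τ›
  have := hs (MvPolynomial.X (Sum.inr t)) (by simp) 1
  simp at this

/-- There are partial derivatives with respect to algebraically independent elements. -/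
theorem IsFreeOver.exists_derivation [Fintype ι] [Fintype τ] [DecidableEq τ] {s : τ → Ω}
    (hs : IsFreeOver β s) (t : τ) :
    ∃ D : Derivation ℂ Ω Ω, (∀ i, D (β i) = 0) ∧ ∀ t', D (s t') = if t' = t then 1 else 0 := by
  have hmem : (Sum.elim 0 (Pi.single t 1) : ι ⊕ τ → Ω) ∈ genericTangent (Sum.elim β s) := by
    intro G hG
    let ζ : ι ⊕ τ → MvPolynomial τ Ω := Sum.elim (fun i => MvPolynomial.C (β i)) MvPolynomial.X
    have hζ : ∀ (x : τ → Ω) (F : MvPolynomial (ι ⊕ τ) ℂ),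
        MvPolynomial.eval x (MvPolynomial.aeval ζ F) =
          MvPolynomial.aeval (Sum.elim β x) F := fun x F => by
      rw [← MvPolynomial.aeval_eq_eval]
      change ((MvPolynomial.aeval x).restrictScalars ℂ) (MvPolynomial.aeval ζ F) = _
      rw [← AlgHom.comp_apply, MvPolynomial.comp_aeval]
      congr 2
      funext k
      rcases k with k | k <;> simp [ζ]
    have h0 : MvPolynomial.aeval ζ G = 0 := by
      have : Infinite Ω := Infinite.of_injective _ (algebraMap ℂ Ω).injective
      exact MvPolynomial.funext fun x => by rw [hζ, map_zero]; exact hs G hG x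
    have h1 := Derivation.apply_aeval ((MvPolynomial.pderiv (R := Ω) t).restrictScalars ℂ) ζ G
    rw [h0, map_zero] at h1
    have h2 := congrArg (MvPolynomial.eval s) h1
    rw [map_zero] at h2
    simp only [differential, map_sum, map_mul, hζ] at h2
    rw [h2]
    refine Finset.sum_congr rfl fun k _ => ?_
    congr 1
    rcases k with k | k
    · simp [ζ]
    · simp [ζ, MvPolynomial.pderiv_X, Pi.single_apply, eq_comm]
  obtain ⟨D, hD⟩ := exists_derivation_of_mem_genericTangent hmem
  refine ⟨D, fun i => hD (Sum.inl i), fun t' => ?_⟩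
  rw [← Pi.single_apply]
  exact hD (Sum.inr t')

end Free

/-! ### Embedded tangent spaces -/

section Scaling
variable {n : ℕ}

theorem zariskiTangent_smul_le (X : Set (PSpace n)) {c : ℂ} (hc : c ≠ 0) (q : Vec n) :
    zariskiTangent (affineCone X) q ≤ zariskiTangent (affineCone X) (c • q) := by
  intro v hv
  have h1 := mem_zariskiTangent_of_mapsTo (Z' := affineCone X)
    (fun j => MvPolynomial.C c * MvPolynomial.X j) (by
      rintro x ⟨hx, hxX⟩
      have : (fun k => MvPolynomial.eval x (MvPolynomial.C c * MvPolynomial.X k)) = c • x := by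
        funext k; simp
      rw [this]
      exact ⟨smul_ne_zero hc hx, by rwa [mk_smul_eq hc hx]⟩) hv
  have e1 : (fun k => MvPolynomial.eval q (MvPolynomial.C c * MvPolynomial.X k)) = c • q := by
    funext k; simp
  have e2 : (fun k => differential q v (MvPolynomial.C c * MvPolynomial.X k)) = c • v := by
    funext k; simp [differential_mul, differential_C, differential_X]
  rw [e1, e2] at h1
  exact (Submodule.smul_mem_iff _ hc).1 h1

/-- The embedded tangent space can be computed at any representative of the point. -/
theorem embeddedTangent_mk (X : Set (PSpace n)) {q : Vec n} (hq : q ≠ 0) :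
    embeddedTangent X (Projectivization.mk ℂ q hq) = zariskiTangent (affineCone X) q := by
  obtain ⟨c, hc⟩ := Projectivization.exists_smul_eq_mk_rep ℂ q hq
  rw [embeddedTangent, ← hc]
  apply le_antisymm
  · have := zariskiTangent_smul_le X (inv_ne_zero c.ne_zero) ((c : ℂ) • q)
    rwa [smul_smul, inv_mul_cancel₀ c.ne_zero, one_smul] at this
  · exact zariskiTangent_smul_le X c.ne_zero q

end Scaling

/-! ### General members and general points -/

section GeneralPoints
variable {r n : ℕ} {Ω : Type} [Field Ω] [Algebra ℂ Ω] {C : Set (Grass r n)}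
  {β : Fin (r + 1) × Fin (n + 1) → Ω}

/-- A property of general specializations of the generic frame is a property of the general member
of `C`. -/
theorem IsGenericPointOf.general_grass (hβ : IsGenericPointOf β (framesOf C))
    {p : Grass r n → Prop} (hp : ∀ᶠ φ in genericFilter Ω, ∃ b : Frame r n,
      b.coords = (fun ij => φ (β ij)) ∧ p b.span) : General C p := by
  obtain ⟨H, hH, hHp⟩ := exists_generic_lift β hp
  have h1 : H ∉ MvPolynomial.vanishingIdeal ℂ (framesOf C) := fun h => hH ((hβ H).1 h)
  rw [MvPolynomial.mem_vanishingIdeal_iff] at h1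
  push Not at h1
  obtain ⟨_, ⟨b, rfl, hb⟩, hbH⟩ := h1
  rw [MvPolynomial.aeval_eq_eval] at hbH
  refine ⟨grassOpen H, isOpen_grassOpen H, ⟨b.span, ⟨b, rfl, hbH⟩, hb⟩, ?_⟩
  rintro _ ⟨⟨b, rfl, hbH⟩, hb⟩
  obtain ⟨φ, ⟨b', hb', hpb'⟩, hφ⟩ := hHp b.coords (hβ.eval_eq_zero ⟨b, rfl, hb⟩) hbH
  have : b' = b := by
    apply Subtype.ext
    funext i j
    have := congrFun (hb'.trans (funext hφ)) (i, j)
    exact this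
  rwa [this] at hpb'

/-- A property of general specializations of the generic point of `X` is a property of the general
point of `X`. -/
theorem IsGenericPointOf.general_projective {X : Set (PSpace n)} {ξ : Fin (n + 1) → Ω}
    (hξ : IsGenericPointOf ξ (affineCone X)) {p : PSpace n → Prop}
    (hp : ∀ᶠ φ in genericFilter Ω, ∀ hq : (fun j => φ (ξ j)) ≠ 0,
      p (Projectivization.mk ℂ (fun j => φ (ξ j)) hq)) : General X p := by
  obtain ⟨H, hH, hHp⟩ := exists_generic_lift ξ hp
  have h1 : H ∉ MvPolynomial.vanishingIdeal ℂ (affineCone X) := fun h => hH ((hξ H).1 h)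
  rw [MvPolynomial.mem_vanishingIdeal_iff] at h1
  push Not at h1
  obtain ⟨q, ⟨hq, hqX⟩, hqH⟩ := h1
  rw [MvPolynomial.aeval_eq_eval] at hqH
  refine ⟨projOpen H, isOpen_projOpen H, ⟨_, ⟨q, hq, rfl, hqH⟩, hqX⟩, ?_⟩
  rintro _ ⟨⟨q, hq, rfl, hqH⟩, hqX⟩
  obtain ⟨φ, hφ, hφq⟩ := hHp q (hξ.eval_eq_zero ⟨hq, hqX⟩) hqH
  have e : (fun j => φ (ξ j)) = q := funext hφq
  have := hφ (by rwa [e])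
  simpa only [e] using this

end GeneralPoints

/-! ### The realization of a family and its tangent space -/

section Realization
variable {r n m : ℕ} {Ω : Type} [Field Ω] [Algebra ℂ Ω] {C : Set (Grass r n)}
  {β : Fin (r + 1) × Fin (n + 1) → Ω}
  {κ : Fin m → Fin (n + 1) → MvPolynomial (Fin (r + 1) × Fin (n + 1)) ℂ}

/-- The generic point of the generic member of a family spanned by polynomial sections `κ`: their
linear combination with coefficients `s`, which are free parameters in the applications. -/
def famPoint (β : Fin (r + 1) × Fin (n + 1) → Ω) (s : Fin m → Ω)
    (κ : Fin m → Fin (n + 1) → MvPolynomial (Fin (r + 1) × Fin (n + 1)) ℂ) : Fin (n + 1) → Ω :=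
  ∑ i, s i • aevalVec β (κ i)

theorem famPoint_mem (s : Fin m → Ω) :
    famPoint β s κ ∈ Submodule.span Ω (Set.range fun i => aevalVec β (κ i)) :=
  Submodule.sum_mem _ fun i _ => Submodule.smul_mem _ _ (Submodule.subset_span ⟨i, rfl⟩)

/-- A polynomial that vanishes at the generic point of the generic member of a family vanishes
on this member. -/
theorem IsFreeOver.aeval_eq_zero_of_mem_span {s : Fin m → Ω} (hs : IsFreeOver β s)
    {F : MvPolynomial (Fin (n + 1)) ℂ} (hF : MvPolynomial.aeval (famPoint β s κ) F = 0)
    {k : Fin (n + 1) → Ω} (hk : k ∈ Submodule.span Ω (Set.range fun i => aevalVec β (κ i))) :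
    MvPolynomial.aeval k F = 0 := by
  obtain ⟨x, rfl⟩ := (Submodule.mem_span_range_iff_exists_fun Ω).1 hk
  let G : MvPolynomial ((Fin (r + 1) × Fin (n + 1)) ⊕ Fin m) ℂ := MvPolynomial.bind₁
    (fun j => ∑ i, MvPolynomial.X (Sum.inr i) * MvPolynomial.rename Sum.inl (κ i j)) F
  have hG : ∀ x : Fin m → Ω, MvPolynomial.aeval (Sum.elim β x) G =
      MvPolynomial.aeval (∑ i, x i • aevalVec β (κ i)) F := fun x => by
    rw [MvPolynomial.aeval_bind₁]
    congr 2
    funext j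
    simp [aevalVec, Finset.sum_apply, MvPolynomial.aeval_rename]
  rw [← hG]
  exact hs G ((hG s).trans hF) x

theorem mem_affineCone_image {I : Set (PSpace n × Grass r n)} {q : Vec n} :
    q ∈ affineCone (Prod.fst '' I) ↔
      ∃ (hq : q ≠ 0) (b : Frame r n), (Projectivization.mk ℂ q hq, b.span) ∈ I := by
  constructor
  · rintro ⟨hq, ⟨Q, σ⟩, hI, hQ⟩
    obtain ⟨b, rfl⟩ := Frame.exists_span_eq σ
    exact ⟨hq, b, by rw [← hQ]; exact hI⟩
  · rintro ⟨hq, b, hI⟩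
    exact ⟨hq, _, hI, rfl⟩

theorem IsLinearFamily.famPoint_ne_zero {I : Set (PSpace n × Grass r n)} [NeZero m]
    (hI : IsLinearFamily C β I fun i => aevalVec β (κ i)) {s : Fin m → Ω} (hs : IsFreeOver β s) :
    famPoint β s κ ≠ 0 := fun h0 =>
  hs.ne_zero (funext (Fintype.linearIndependent_iff.1 hI.linearIndependent s h0))

/-- General specializations of the generic point of a linear family are points of its members. -/
theorem IsLinearFamily.generic_famPoint {I : Set (PSpace n × Grass r n)} [NeZero m]
    (hI : IsLinearFamily C β I fun i => aevalVec β (κ i)) {s : Fin m → Ω} (hs : IsFreeOver β s) :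
    ∀ᶠ φ in genericFilter Ω, ∃ (b : Frame r n) (hq : (fun j => φ (famPoint β s κ j)) ≠ 0),
      b.span ∈ C ∧ b.coords = (fun ij => φ (β ij)) ∧
      (Projectivization.mk ℂ (fun j => φ (famPoint β s κ j)) hq, b.span) ∈ I := by
  obtain ⟨j, hj⟩ := Function.ne_iff.1 (hI.famPoint_ne_zero hs)
  filter_upwards [hI.generic, generic_mem_span (famPoint_mem (κ := κ) s), generic_ne hj]
    with φ ⟨b, hbC, hb, hbI⟩ h1 h2
  have hq : (fun j => φ (famPoint β s κ j)) ≠ 0 := fun h => h2 (congrFun h j)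
  exact ⟨b, hq, hbC, hb, (hbI _ hq).2 h1⟩

/-- The generic point of the generic member of a family is a generic point of the realization of
the family, since all points of the members are values of polynomial sections of the generic
member. -/
theorem IsLinearFamily.isGenericPointOf_famPoint {I : Set (PSpace n × Grass r n)} [NeZero m]
    (hI : IsLinearFamily C β I fun i => aevalVec β (κ i)) (hβ : IsGenericPointOf β (framesOf C))
    {s : Fin m → Ω} (hs : IsFreeOver β s) :
    IsGenericPointOf (famPoint β s κ) (affineCone (realization I)) := by
  intro F
  rw [realization, vanishingIdeal_affineCone_closure]
  constructor
  · intro hF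
    apply aeval_eq_zero_of_eventually
    filter_upwards [hI.generic_famPoint hs] with φ ⟨b, hq, _, _, hmem⟩
    have := hF _ (mem_affineCone_image.2 ⟨hq, b, hmem⟩)
    rwa [MvPolynomial.aeval_eq_eval] at this
  · intro hF q hq
    obtain ⟨hq, b, hmem⟩ := mem_affineCone_image.1 hq
    obtain ⟨κ', hκ', rfl⟩ := hI.exists_section q hq b hmem
    have h1 : MvPolynomial.aeval β (MvPolynomial.bind₁ κ' F) = 0 := by
      rw [MvPolynomial.aeval_bind₁]
      exact hs.aeval_eq_zero_of_mem_span hF hκ'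
    have h2 := hβ.eval_eq_zero ⟨b, rfl, hI.snd_mem _ hmem⟩ _ h1
    rw [eval_bind₁] at h2
    rw [MvPolynomial.aeval_eq_eval]
    exact h2

theorem IsGenericPointOf.isIrreducible {X : Set (PSpace n)} {ξ : Fin (n + 1) → Ω}
    (hξ : IsGenericPointOf ξ (affineCone X)) : IsIrreducible X := by
  apply isIrreducible_of_isPrime
  have : MvPolynomial.vanishingIdeal ℂ (affineCone X) =
      RingHom.ker (MvPolynomial.aeval ξ : MvPolynomial (Fin (n + 1)) ℂ →ₐ[ℂ] Ω) := by
    ext F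
    exact hξ F
  rw [this]
  exact RingHom.ker_isPrime _

/-- If the derivatives of the generic member of a family lie in `S`, then `S` contains the tangent
space of the realization at the generic point. -/
theorem genericTangent_famPoint_le {s : Fin m → Ω} {S : Submodule Ω (Fin (n + 1) → Ω)}
    (h : Submodule.span Ω (Set.range fun i => aevalVec β (κ i)) ≤ derivedKernel S) :
    genericTangent (famPoint β s κ) ≤ S := by
  intro v hv
  obtain ⟨D, hD⟩ := exists_derivation_of_mem_genericTangent hv
  have := (h (famPoint_mem (κ := κ) s)).2 D
  rwa [show dVec D (famPoint β s κ) = v from funext hD] at this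

/-- The derivative of the generic point with respect to a parameter is the corresponding
section. -/
theorem IsFreeOver.exists_dVec_famPoint {s : Fin m → Ω} (hs : IsFreeOver β s) (i : Fin m) :
    ∃ D, IsVertical β D ∧ dVec D (famPoint β s κ) = aevalVec β (κ i) := by
  obtain ⟨D, hD1, hD2⟩ := hs.exists_derivation i
  have hDκ : ∀ κ' : Fin (n + 1) → MvPolynomial (Fin (r + 1) × Fin (n + 1)) ℂ,
      dVec D (aevalVec β κ') = 0 := fun κ' => by
    rw [dVec_aevalVec]
    funext j
    simp [diffVec, differential, hD1]
  refine ⟨D, fun i => ?_, ?_⟩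
  · have := hDκ (rowSection r n i)
    rw [aevalVec_rowSection] at this
    rw [this]
    exact Submodule.zero_mem _
  · rw [famPoint, dVec_sum]
    simp [dVec_smul, hDκ, hD2]

theorem IsFreeOver.le_genericTangent_famPoint {s : Fin m → Ω} (hs : IsFreeOver β s) :
    Submodule.span Ω (Set.range fun i => aevalVec β (κ i)) ≤
      genericTangent (famPoint β s κ) := by
  rw [Submodule.span_le]
  rintro _ ⟨i, rfl⟩
  obtain ⟨D, -, hD⟩ := hs.exists_dVec_famPoint (κ := κ) i
  change aevalVec β (κ i) ∈ _
  rw [← hD]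
  exact derivation_mem_genericTangent D _

/-- If the members of a family really move, then the tangent space of its realization at the
generic point is larger than the member through this point. -/
theorem IsFreeOver.not_genericTangent_famPoint_le {s : Fin m → Ω} (hs : IsFreeOver β s)
    (hK : IsVerticallyStable β (Submodule.span Ω (Set.range fun i => aevalVec β (κ i))))
    (hne : derivedKernel (Submodule.span Ω (Set.range fun i => aevalVec β (κ i))) ≠
      Submodule.span Ω (Set.range fun i => aevalVec β (κ i))) :
    ¬ genericTangent (famPoint β s κ) ≤
      Submodule.span Ω (Set.range fun i => aevalVec β (κ i)) := by
  intro hle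
  apply hne
  refine le_antisymm (derivedKernel_le _) ?_
  rw [Submodule.span_le]
  rintro _ ⟨i, rfl⟩
  obtain ⟨D, hDv, hD⟩ := hs.exists_dVec_famPoint (κ := κ) i
  have h1 : famPoint β s κ ∈
      derivedKernel (Submodule.span Ω (Set.range fun i => aevalVec β (κ i))) :=
    ⟨famPoint_mem s, fun D' => hle (derivation_mem_genericTangent D' _)⟩
  have h2 := isVerticallyStable_derivedKernel hK D hDv _ h1
  rw [hD] at h2
  exact h2

/-- The tangent space of the realization of a moving family at its generic point, if the
derivatives of the generic member lie in a space `S` of dimension one more than this member. -/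
theorem IsLinearFamily.genericTangent_famPoint {I : Set (PSpace n × Grass r n)}
    (hI : IsLinearFamily C β I fun i => aevalVec β (κ i))
    {s : Fin m → Ω} (hs : IsFreeOver β s) {S : Submodule Ω (Fin (n + 1) → Ω)}
    (hS : Submodule.span Ω (Set.range fun i => aevalVec β (κ i)) ≤ derivedKernel S)
    (hSm : Module.finrank Ω S = m + 1)
    (hne : derivedKernel (Submodule.span Ω (Set.range fun i => aevalVec β (κ i))) ≠
      Submodule.span Ω (Set.range fun i => aevalVec β (κ i))) :
    genericTangent (famPoint β s κ) = S := by
  apply Submodule.eq_of_le_of_finrank_le (genericTangent_famPoint_le hS)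
  have h1 := hs.le_genericTangent_famPoint (κ := κ)
  have h2 := hs.not_genericTangent_famPoint_le hI.stable hne
  have h3 := Submodule.finrank_lt_finrank_of_lt (lt_of_le_not_ge h1 h2)
  rw [finrank_span_eq_card hI.linearIndependent, Fintype.card_fin] at h3
  omega

/-- The tangent space at the generic point specializes to the tangent space at general points. -/
theorem generic_zariskiTangent_eq {X : Set (PSpace n)} {ξ : Fin (n + 1) → Ω}
    (hξ : IsGenericPointOf ξ (affineCone X)) {w : Fin m → Fin (n + 1) → Ω}
    (hw : genericTangent ξ = Submodule.span Ω (Set.range w)) :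
    ∀ᶠ φ in genericFilter Ω, zariskiTangent (affineCone X) (fun j => φ (ξ j)) =
      Submodule.span ℂ (Set.range fun i j => φ (w i j)) := by
  filter_upwards [generic_zariskiTangent_le hξ hw.le, eventually_all.2 fun i =>
    generic_mem_zariskiTangent hξ (v := w i)
      (by rw [hw]; exact Submodule.subset_span ⟨i, rfl⟩)] with φ h1 h2
  refine le_antisymm h1 ?_
  rw [Submodule.span_le]
  rintro _ ⟨i, rfl⟩
  exact h2 i

end Realization

/-! ### Taylor polynomials along a derivation -/

section Jets
variable {Ω : Type} [Field Ω] [Algebra ℂ Ω] {ι : Type}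

/-- The Taylor polynomial of order `2` of `a` along the derivation `D`. -/
def taylorTwo (D : Derivation ℂ Ω Ω) (a : Ω) : Polynomial Ω :=
  Polynomial.C a + Polynomial.C (D a) * Polynomial.X +
    Polynomial.C (D (D a) / 2) * Polynomial.X ^ 2

theorem taylorTwo_mul [CharZero Ω] (D : Derivation ℂ Ω Ω) (a b : Ω) :
    taylorTwo D a * taylorTwo D b - taylorTwo D (a * b) = Polynomial.X ^ 3 *
      (Polynomial.C (D a * D (D b) / 2 + D b * D (D a) / 2) +
        Polynomial.C (D (D a) * D (D b) / 4) * Polynomial.X) := by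
  have h1 : D (a * b) = a * D b + b * D a := by simp
  have h2 : D (D (a * b)) / 2 = a * (D (D b) / 2) + D a * D b + b * (D (D a) / 2) := by
    rw [h1]
    simp
    ring
  have h3 : D a * D (D b) / 2 + D b * D (D a) / 2 =
      D a * (D (D b) / 2) + D b * (D (D a) / 2) := by ring
  have h4 : D (D a) * D (D b) / 4 = (D (D a) / 2) * (D (D b) / 2) := by ring
  simp only [taylorTwo]
  rw [h2, h1, h3, h4]
  simp only [map_add, map_mul]
  ring

/-- The Taylor polynomial of order `2` is a homomorphism modulo `X ^ 3`. -/
theorem X_pow_three_dvd_aeval_taylorTwo_sub [CharZero Ω] (D : Derivation ℂ Ω Ω) (η : ι → Ω)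
    (F : MvPolynomial ι ℂ) : (Polynomial.X : Polynomial Ω) ^ 3 ∣
      MvPolynomial.aeval (fun i => taylorTwo D (η i)) F -
        taylorTwo D (MvPolynomial.aeval η F) := by
  induction F using MvPolynomial.induction_on with
  | C a =>
    simp [taylorTwo, Polynomial.algebraMap_apply]
  | add p q hp hq =>
    have : taylorTwo D (MvPolynomial.aeval η (p + q)) = taylorTwo D (MvPolynomial.aeval η p) +
        taylorTwo D (MvPolynomial.aeval η q) := by
      simp only [taylorTwo, map_add, add_div]
      ring
    rw [this, map_add, add_sub_add_comm]
    exact dvd_add hp hq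
  | mul_X p i hp =>
    rw [map_mul, map_mul, MvPolynomial.aeval_X, MvPolynomial.aeval_X]
    have h1 := taylorTwo_mul D (MvPolynomial.aeval η p) (η i)
    have h2 : MvPolynomial.aeval (fun i => taylorTwo D (η i)) p * taylorTwo D (η i) -
        taylorTwo D (MvPolynomial.aeval η p * η i) =
        (MvPolynomial.aeval (fun i => taylorTwo D (η i)) p -
          taylorTwo D (MvPolynomial.aeval η p)) * taylorTwo D (η i) +
        (taylorTwo D (MvPolynomial.aeval η p) * taylorTwo D (η i) -
          taylorTwo D (MvPolynomial.aeval η p * η i)) := by ring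
    rw [h2, h1]
    exact dvd_add (Dvd.dvd.mul_right hp _) (dvd_mul_right _ _)

/-- The Taylor polynomials of the coordinates of a point along a derivation specialize to
parametrizations to the second order of the locus of the point. -/
theorem generic_X_pow_three_dvd [Finite ι] (D : Derivation ℂ Ω Ω) (η : ι → Ω) :
    ∀ᶠ φ in genericFilter Ω, ∀ F : MvPolynomial ι ℂ, MvPolynomial.aeval η F = 0 →
      (Polynomial.X : Polynomial ℂ) ^ 3 ∣ MvPolynomial.aeval (fun i => Polynomial.C (φ (η i)) +
        Polynomial.C (φ (D (η i))) * Polynomial.X +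
        Polynomial.C (φ (D (D (η i)) / 2)) * Polynomial.X ^ 2) F := by
  have : CharZero Ω := charZero_of_injective_algebraMap (algebraMap ℂ Ω).injective
  -- the expansion of `F` at a universal parametrization to the second order
  let U : MvPolynomial ι ℂ → Polynomial (MvPolynomial (Fin 3 × ι) ℂ) := fun F =>
    MvPolynomial.aeval (fun i => Polynomial.C (MvPolynomial.X (0, i)) +
      Polynomial.C (MvPolynomial.X (1, i)) * Polynomial.X +
      Polynomial.C (MvPolynomial.X (2, i)) * Polynomial.X ^ 2) F
  have hU : ∀ {R : Type} [CommRing R] [Algebra ℂ R] (y : Fin 3 × ι → R) (F : MvPolynomial ι ℂ)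
      (d : ℕ), (MvPolynomial.aeval (fun i => Polynomial.C (y (0, i)) +
        Polynomial.C (y (1, i)) * Polynomial.X + Polynomial.C (y (2, i)) * Polynomial.X ^ 2)
        F).coeff d = MvPolynomial.aeval y ((U F).coeff d) := by
    intro R _ _ y F d
    have : MvPolynomial.aeval (fun i => Polynomial.C (y (0, i)) +
        Polynomial.C (y (1, i)) * Polynomial.X + Polynomial.C (y (2, i)) * Polynomial.X ^ 2) F =
        Polynomial.mapAlgHom (MvPolynomial.aeval y) (U F) := by
      rw [← AlgHom.comp_apply, MvPolynomial.comp_aeval]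
      congr 2
      funext i
      simp
    rw [this]
    simp
  filter_upwards [generic_aeval (fun ki : Fin 3 × ι =>
    ![η ki.2, D (η ki.2), D (D (η ki.2)) / 2] ki.1)] with φ hφ F hF
  have h1 := X_pow_three_dvd_aeval_taylorTwo_sub D η F
  have h2 : taylorTwo D (0 : Ω) = 0 := by simp [taylorTwo]
  rw [hF, h2, sub_zero, Polynomial.X_pow_dvd_iff] at h1
  rw [Polynomial.X_pow_dvd_iff]
  intro d hd
  have h3 := h1 d hd
  have h4 := hU (fun ki : Fin 3 × ι => ![η ki.2, D (η ki.2), D (D (η ki.2)) / 2] ki.1) F d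
  have h5 := hU (fun ki : Fin 3 × ι => φ (![η ki.2, D (η ki.2), D (D (η ki.2)) / 2] ki.1)) F d
  have h6 := hφ ((U F).coeff d)
  have h7 := hφ 0
  rw [map_zero, map_zero] at h7
  rw [← h4] at h6
  refine h5.trans ?_
  rw [MvPolynomial.aeval_eq_eval, ← h6]
  refine Eq.trans ?_ h7
  exact congrArg φ h3

end Jets

/-! ### Constant families -/

section Constant
variable {r n m : ℕ} {Ω : Type} [Field Ω] [Algebra ℂ Ω] {C : Set (Grass r n)}
  {β : Fin (r + 1) × Fin (n + 1) → Ω} {I : Set (PSpace n × Grass r n)}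
  {v : Fin m → Fin (n + 1) → Ω}

/-- If the realization of a family of linear spaces lies in a linear space of the same dimension,
then the generic member of the family contains the points of this linear space. -/
theorem IsLinearFamily.algebraMap_mem (hI : IsLinearFamily C β I v)
    {S : Submodule ℂ (Vec n)} (hS : Module.finrank ℂ S = m)
    (hIS : realization I ⊆ linearPoints S) {q : Vec n} (hq : q ∈ S) :
    (fun j => algebraMap ℂ Ω (q j)) ∈ Submodule.span Ω (Set.range v) := by
  by_contra hne
  obtain ⟨φ, ⟨b, hbC, hb, hbI⟩, h1, h2, h3⟩ := (hI.generic.and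
    ((generic_notMem_span hI.linearIndependent hne).and
      ((generic_linearIndependent hI.linearIndependent).and generic_const))).exists
  apply h1
  simp only [h3]
  have h4 : Submodule.span ℂ (Set.range fun i j => φ (v i j)) = S := by
    apply Submodule.eq_of_le_of_finrank_le
    · rw [Submodule.span_le]
      rintro _ ⟨i, rfl⟩
      have hi := (hbI _ (h2.ne_zero i)).2 (Submodule.subset_span ⟨i, rfl⟩)
      exact (linearPoints_mk _).1 (hIS (subset_closure ⟨_, hi, rfl⟩))
    · rw [finrank_span_eq_card h2, hS, Fintype.card_fin]
  rw [h4]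
  exact hq

/-- If the realization of a family of linear spaces lies in a linear space of the same dimension,
then the family is constant. -/
theorem IsLinearFamily.derivedKernel_eq (hI : IsLinearFamily C β I v) (h : IsGenericFrame C β)
    {S : Submodule ℂ (Vec n)} (hS : Module.finrank ℂ S = m)
    (hIS : realization I ⊆ linearPoints S) :
    derivedKernel (Submodule.span Ω (Set.range v)) = Submodule.span Ω (Set.range v) := by
  obtain ⟨e, he, heS⟩ := S.exists_basis_fin hS
  have h1 : ∀ i, (fun j => algebraMap ℂ Ω (e i j)) ∈ Submodule.span Ω (Set.range v) := fun i =>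
    hI.algebraMap_mem hS hIS (by rw [← heS]; exact Submodule.subset_span ⟨i, rfl⟩)
  have h2 : LinearIndependent Ω fun i j => algebraMap ℂ Ω (e i j) := by
    obtain ⟨φ, b, hbC, -⟩ := hI.generic.exists
    have e1 : ∀ i, evalVec b.coords (fun j => MvPolynomial.C (e i j)) = e i := fun i =>
      funext fun j => MvPolynomial.eval_C _
    have e2 : ∀ i, aevalVec β (fun j => MvPolynomial.C (e i j)) =
        fun j => algebraMap ℂ Ω (e i j) := fun i => funext fun j => MvPolynomial.aeval_C _ _
    have := h.generic.linearIndependent_aevalVec hbC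
      (κ := fun i j => MvPolynomial.C (e i j)) (by simp only [e1]; exact he)
    simp only [e2] at this
    exact this
  rw [← span_eq_of_linearIndependent h2 h1]
  refine le_antisymm (derivedKernel_le _) fun q hq => ⟨hq, fun D => ?_⟩
  refine dVec_mem_span le_rfl (fun i => ?_) hq
  have : dVec D (fun j => algebraMap ℂ Ω (e i j)) = 0 := by
    funext j
    simp [dVec]
  rw [this]
  exact Submodule.zero_mem _

end Constant

/-! ### Lower bounds for dimensions -/

section DimensionBounds
variable {n : ℕ}

theorem exists_singleton_ssubset_linearPoints (l : Grass 1 n) :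
    ∃ Q : PSpace n, {Q} ⊂ linearPoints l.1 := by
  obtain ⟨e, he, hel⟩ := l.1.exists_basis_fin l.2
  have hmem : ∀ i, Projectivization.mk ℂ (e i) (he.ne_zero i) ∈ linearPoints l.1 := fun i => by
    rw [linearPoints_mk, ← hel]
    exact Submodule.subset_span ⟨i, rfl⟩
  refine ⟨_, Set.ssubset_iff_of_subset (Set.singleton_subset_iff.2 (hmem 0)) |>.2
    ⟨_, hmem 1, fun h => ?_⟩⟩
  obtain ⟨c, hc⟩ := (Projectivization.mk_eq_mk_iff' ℂ _ _ _ _).1 (Set.mem_singleton_iff.1 h)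
  have := Fintype.linearIndependent_iff.1 he ![c, -1] (by simp [Fin.sum_univ_two, hc]) 1
  simp at this

theorem zero_le_topologicalKrullDim {X : Set (PSpace n)} {P : PSpace n} (hP : P ∈ X) :
    (0 : WithBot ℕ∞) ≤ topologicalKrullDim X := by
  have := le_topologicalKrullDim (d := 0) (fun _ => {P}) (fun i j hij => by omega)
    (fun _ => isClosed_singleton_PSpace P) (fun _ => isIrreducible_singleton)
    (fun _ => Set.singleton_subset_iff.2 hP)
  exact_mod_cast this

theorem one_le_topologicalKrullDim {X Y : Set (PSpace n)} {P : PSpace n} (hP : {P} ⊂ Y)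
    (hYX : Y ⊆ X) (hYc : IsClosed Y) (hY : IsIrreducible Y) :
    (1 : WithBot ℕ∞) ≤ topologicalKrullDim X := by
  have := le_topologicalKrullDim (X := X) (d := 1) ![{P}, Y]
    (Fin.strictMono_iff_lt_succ.2 fun i => by fin_cases i; exact hP)
    (fun i => by fin_cases i; exacts [isClosed_singleton_PSpace P, hYc])
    (fun i => by fin_cases i; exacts [isIrreducible_singleton, hY])
    (fun i => by fin_cases i; exacts [hP.subset.trans hYX, hYX])
  exact_mod_cast this

theorem two_le_topologicalKrullDim {X : Set (PSpace n)} {l : Grass 1 n}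
    (hl : linearPoints l.1 ⊂ X) (hXc : IsClosed X) (hX : IsIrreducible X) :
    (2 : WithBot ℕ∞) ≤ topologicalKrullDim X := by
  obtain ⟨P, hP⟩ := exists_singleton_ssubset_linearPoints l
  have hne : l.1 ≠ ⊥ := fun h => by
    have := l.2
    rw [h, finrank_bot] at this
    omega
  have := le_topologicalKrullDim (X := X) (d := 2) ![{P}, linearPoints l.1, X]
    (Fin.strictMono_iff_lt_succ.2 fun i => by fin_cases i; exacts [hP, hl])
    (fun i => by
      fin_cases i
      exacts [isClosed_singleton_PSpace P, isClosed_linearPoints _, hXc])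
    (fun i => by fin_cases i; exacts [isIrreducible_singleton, isIrreducible_linearPoints hne, hX])
    (fun i => by fin_cases i; exacts [hP.subset.trans hl.subset, hl.subset, le_rfl])
  exact_mod_cast this

end DimensionBounds

/-! ### The family of the second order focal points -/

section SecondFocal
variable {n : ℕ} {Ω : Type} [Field Ω] [Algebra ℂ Ω] {C : Set (Grass 2 n)}
  {β : Fin (2 + 1) × Fin (n + 1) → Ω}

/-- If the focal lines are not constant, then the generic one has just one focal point: derivation
maps the focal line (of vector space dimension `2`) to the plane modulo this line (of dimension
`1`), so that its kernel is not zero. -/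
theorem IsGenericFrame.finrank_derivedKernel_derivedKernel (h : IsGenericFrame C β)
    {k : Fin 2 → Fin (n + 1) → Ω} (hI : IsLinearFamily C β (firstFocal C) k)
    (hspan : Submodule.span Ω (Set.range k) = derivedKernel (rowSpan β))
    (hne : derivedKernel (Submodule.span Ω (Set.range k)) ≠ Submodule.span Ω (Set.range k)) :
    Module.finrank Ω (derivedKernel (Submodule.span Ω (Set.range k))) = 1 := by
  obtain ⟨D, i₀, hD⟩ := h.exists_derivation
  have h1 := rank_focalMatrix_add_finrank (u := fun i => dVec D (k i)) hI.linearIndependent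
  have h2 : focalSpace k (fun i => dVec D (k i)) =
      derivedKernel (Submodule.span Ω (Set.range k)) := by
    ext q
    rw [focalSpace_dVec, h.mem_derivedKernel_iff hI.stable fun hv => hD (hv i₀)]
  have hk : ∀ i, k i ∈ derivedKernel (rowSpan β) := fun i => by
    rw [← hspan]
    exact Submodule.subset_span ⟨i, rfl⟩
  have h3 : (focalMatrix k fun i => dVec D (k i)).rank ≤ 3 := by
    rw [Matrix.rank_eq_finrank_span_cols]
    have h4 : Module.finrank Ω (rowSpan β) = 3 := h.finrank_rowSpan
    rw [← h4]
    apply Submodule.finrank_mono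
    rw [Submodule.span_le]
    rintro _ ⟨s, rfl⟩
    rcases s with i | i
    · exact (hk i).2 D
    · exact (hk i).1
  have h5 := Submodule.finrank_lt_finrank_of_lt (lt_of_le_of_ne (derivedKernel_le _) hne)
  rw [finrank_span_eq_card hI.linearIndependent, Fintype.card_fin] at h5
  rw [h2] at h1
  omega

theorem eq_linearPoints_of_mk_mem_iff {S : Set (PSpace n)} {L : Submodule ℂ (Vec n)}
    (hS : ∀ (q : Vec n) (hq : q ≠ 0), Projectivization.mk ℂ q hq ∈ S ↔ q ∈ L) :
    S = linearPoints L := by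
  ext Q
  induction Q using Projectivization.ind with
  | h q hq => rw [hS, linearPoints_mk]

/-- The second order foci form a linear family of points. At special members of this family the
focal space of the focal line has the generic dimension `1`, and so its points lie on polynomial
sections. -/
theorem IsGenericFrame.isLinearFamily_secondFocal (h : IsGenericFrame C β)
    (hdev : IsDevelopable C)
    {κ : Fin 2 → Fin (n + 1) → MvPolynomial (Fin (2 + 1) × Fin (n + 1)) ℂ}
    (hI : IsLinearFamily C β (firstFocal C) fun i => aevalVec β (κ i))
    {K : Submodule Ω (Fin (n + 1) → Ω)}
    (hκK : Submodule.span Ω (Set.range fun i => aevalVec β (κ i)) = K)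
    (hspan : K = derivedKernel (rowSpan β))
    (hL : Module.finrank Ω (derivedKernel K) = 1) {p : Fin 1 → Fin (n + 1) → Ω}
    (hp : Submodule.span Ω (Set.range p) = derivedKernel K) :
    IsLinearFamily C β (secondFocal C) p := by
  have hpli : LinearIndependent Ω p := by
    rw [linearIndependent_iff_card_eq_finrank_span, Set.finrank, hp, hL, Fintype.card_fin]
  have hKst : IsVerticallyStable β K := by rw [← hκK]; exact hI.stable
  refine ⟨fun x hx => hx.1, hpli, ?_, ?_, ?_⟩
  · rw [hp]
    exact isVerticallyStable_derivedKernel hKst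
  · intro q hq b hmem
    obtain ⟨hb, ⟨l, hl⟩, hfoc⟩ := hmem
    have hb : b.span ∈ C := hb
    obtain ⟨e, he, hel⟩ := l.1.exists_basis_fin l.2
    choose κ' hκ1 hκ2 using fun i => h.exists_section_focalLine hdev hb ⟨l, hl⟩ (he.ne_zero i)
      (by
        rw [show focalLocus (incidence C) b.span = linearPoints l.1 from hl, linearPoints_mk, ← hel]
        exact Submodule.subset_span ⟨i, rfl⟩)
    have hκli : LinearIndependent ℂ fun i => evalVec b.coords (κ' i) := by
      simp only [hκ2]
      exact he
    obtain ⟨w₀, hw₀, hw₀b, -⟩ := exists_mem_zariskiTangent_of_finrank_eq_one (h.smooth b hb)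
    have hκ1' : ∀ i, aevalVec β (κ' i) ∈
        Submodule.span Ω (Set.range fun i => aevalVec β (κ i)) := fun i => by
      rw [hκK, hspan]
      exact hκ1 i
    have h1 := fun q hq => hI.mk_mem_focalLocus_iff h (κ := κ') hκ1' hb hκli (fun q hq => by
      rw [mk_mem_firstFocal hq hb ⟨l, hl⟩,
        show focalLocus (incidence C) b.span = linearPoints l.1 from hl, linearPoints_mk, ← hel]
      simp only [hκ2]) hw₀ hw₀b (q := q) hq
    have h2 := eq_of_linearPoints_eq (hfoc.trans (linearPoints_submodule _).symm) h1
    rw [hp]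
    refine h.exists_section_derivedKernel hb hκli hKst ?_ hw₀ hw₀b ?_ ?_
    · rw [span_eq_of_linearIndependent (h.generic.linearIndependent_aevalVec hb hκli) hκ1', hκK]
    · rw [h2, Projectivization.finrank_submodule, hL]
    · rw [h2, Projectivization.submodule_mk]
      exact Submodule.mem_span_singleton_self q
  · filter_upwards [hI.generic_focalLocus h rfl hpli (by rw [hp, hκK]),
      h.eventually_hasFocalLine hdev, generic_linearIndependent hpli]
      with φ ⟨b, hbC, hb, hbφ⟩ h1 h2
    refine ⟨b, hbC, hb, fun q hq => ?_⟩
    have h3 := eq_linearPoints_of_mk_mem_iff hbφ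
    constructor
    · intro hmem
      refine (hbφ q hq).1 ?_
      rw [show focalLocus (firstFocal C) b.span = {Projectivization.mk ℂ q hq} from hmem.2.2]
      exact Set.mem_singleton _
    · intro hqφ
      refine ⟨hbC, h1 b hbC hb, ?_⟩
      change focalLocus (firstFocal C) b.span = {Projectivization.mk ℂ q hq}
      rw [h3, ← linearPoints_submodule]
      congr 1
      symm
      apply Submodule.eq_of_le_of_finrank_le
      · rw [Projectivization.submodule_mk, Submodule.span_singleton_le_iff_mem]
        exact hqφ
      · rw [Projectivization.finrank_submodule, finrank_span_eq_card h2, Fintype.card_fin]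

end SecondFocal

/-! ### Existence of a generic frame -/

section Existence
variable {r n : ℕ}

/-- A smooth irreducible curve has a generic frame over an extension field of `ℂ` with arbitrarily
many elements algebraically independent over the function field `M` of the variety of frames: the
field of rational functions in the variables `τ` over `M`. -/
theorem IsSmoothCurve.exists_isGenericFrame {C : Set (Grass r n)} (hC : IsSmoothCurve C)
    (τ : Type) :
    ∃ (Ω : Type) (_ : Field Ω) (_ : Algebra ℂ Ω) (β : Fin (r + 1) × Fin (n + 1) → Ω) (s : τ → Ω),
      IsGenericFrame C β ∧ IsFreeOver β s := by
  have hprime := isPrime_vanishingIdeal_framesOf hC.irreducible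
  let A := MvPolynomial (Fin (r + 1) × Fin (n + 1)) ℂ ⧸
    MvPolynomial.vanishingIdeal ℂ (framesOf C)
  let M := FractionRing A
  let B := MvPolynomial τ M
  let Ω := FractionRing B
  let b : Fin (r + 1) × Fin (n + 1) → M := fun ij =>
    algebraMap A M (Ideal.Quotient.mk _ (MvPolynomial.X ij))
  let β : Fin (r + 1) × Fin (n + 1) → Ω := fun ij => algebraMap M Ω (b ij)
  let s : τ → Ω := fun t => algebraMap B Ω (MvPolynomial.X t)
  have hb : ∀ F, MvPolynomial.aeval b F = algebraMap A M (Ideal.Quotient.mk _ F) := by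
    intro F
    change _ = ((IsScalarTower.toAlgHom ℂ A M).comp (Ideal.Quotient.mkₐ ℂ _)) F
    congr 1
    apply MvPolynomial.algHom_ext
    intro ij
    simp [b]
    rfl
  have hβ : ∀ F : MvPolynomial (Fin (r + 1) × Fin (n + 1)) ℂ,
      MvPolynomial.aeval β F = algebraMap M Ω (MvPolynomial.aeval b F) := by
    intro F
    exact MvPolynomial.aeval_algebraMap_apply (R := ℂ) (A := M) (B := Ω) b F
  have hgen : IsGenericPointOf β (framesOf C) := by
    intro F
    rw [hβ, hb, map_eq_zero_iff _ (algebraMap M Ω).injective,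
      map_eq_zero_iff _ (IsFractionRing.injective A M), Ideal.Quotient.eq_zero_iff_mem]
  refine ⟨Ω, inferInstance, inferInstance, β, s, ⟨hgen, ?_, hC.smooth⟩, ?_⟩
  · obtain ⟨σ, hσ⟩ := hC.irreducible.nonempty
    obtain ⟨b₀, rfl⟩ := Frame.exists_span_eq σ
    obtain ⟨H, hH, hHC⟩ := hC.locallyClosed.exists_framesOf hσ
    have hHβ : MvPolynomial.aeval β H ≠ 0 := fun h0 =>
      hH (hgen.eval_eq_zero ⟨b₀, rfl, hσ⟩ H h0)
    filter_upwards [generic_aeval β, generic_ne hHβ, generic_zero] with φ h1 h2 h3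
    obtain ⟨b', hb', hb'C⟩ := hHC (fun ij => φ (β ij))
      (fun F hF => by rw [← h1, (hgen F).1 hF, h3]) (by rwa [← h1])
    exact ⟨b', hb'C, hb'.symm⟩
  · intro G hG x
    let g : MvPolynomial ((Fin (r + 1) × Fin (n + 1)) ⊕ τ) ℂ → B :=
      MvPolynomial.aeval (Sum.elim (fun ij => MvPolynomial.C (b ij)) MvPolynomial.X)
    have h1 : MvPolynomial.aeval (Sum.elim β s) G = algebraMap B Ω (g G) := by
      have : Sum.elim β s = fun k => algebraMap B Ω
          (Sum.elim (fun ij => MvPolynomial.C (b ij)) MvPolynomial.X k) := by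
        funext k
        rcases k with k | k
        · exact IsScalarTower.algebraMap_apply M B Ω (b k)
        · rfl
      rw [this]
      exact MvPolynomial.aeval_algebraMap_apply (R := ℂ) (A := B) (B := Ω) _ G
    rw [hG, eq_comm, map_eq_zero_iff _ (IsFractionRing.injective B Ω)] at h1
    have h2 : MvPolynomial.aeval (Sum.elim β x) G =
        ((MvPolynomial.aeval (R := M) x).restrictScalars ℂ) (g G) := by
      change _ = ((MvPolynomial.aeval (R := M) x).restrictScalars ℂ)
        (MvPolynomial.aeval (Sum.elim (fun ij => MvPolynomial.C (b ij)) MvPolynomial.X) G)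
      rw [← AlgHom.comp_apply, MvPolynomial.comp_aeval]
      congr 2
      funext k
      rcases k with k | k
      · simp [β]
      · simp
    rw [h2, h1, map_zero]

end Existence

/-! ### The three types of developable families -/

section Classification
variable {n : ℕ} {Ω : Type} [Field Ω] [Algebra ℂ Ω] {C : Set (Grass 2 n)}
  {β : Fin (2 + 1) × Fin (n + 1) → Ω}
  {κ : Fin 2 → Fin (n + 1) → MvPolynomial (Fin (2 + 1) × Fin (n + 1)) ℂ}

theorem fst_mem_realization {r : ℕ} {I : Set (PSpace n × Grass r n)} {x : PSpace n × Grass r n}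
    (hx : x ∈ I) : x.1 ∈ realization I :=
  subset_closure ⟨x, hx, rfl⟩

theorem IsDevelopable.exists_linearPoints_subset (hdev : IsDevelopable C) :
    ∃ l : Grass 1 n, linearPoints l.1 ⊆ realization (firstFocal C) := by
  obtain ⟨O, -, ⟨σ, hσO, hσC⟩, hO⟩ := hdev
  obtain ⟨l, hl⟩ := hO σ ⟨hσO, hσC⟩
  refine ⟨l, fun Q hQ => fst_mem_realization (x := (Q, σ)) ⟨hσC, ⟨l, hl⟩, ?_⟩⟩
  change Q ∈ focalLocus (incidence C) σ
  rwa [hl]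

/-- If the generic focal line is constant, then all planes contain it: the generic plane does, and
this is a closed condition. -/
theorem IsGenericFrame.isPlanesThroughLine (h : IsGenericFrame C β) (hdev : IsDevelopable C)
    (hI : IsLinearFamily C β (firstFocal C) fun i => aevalVec β (κ i))
    (hspan : Submodule.span Ω (Set.range fun i => aevalVec β (κ i)) = derivedKernel (rowSpan β))
    {s : Fin 2 → Ω} (hs : IsFreeOver β s)
    (hK : derivedKernel (Submodule.span Ω (Set.range fun i => aevalVec β (κ i))) =
      Submodule.span Ω (Set.range fun i => aevalVec β (κ i))) :
    topologicalKrullDim (realization (firstFocal C)) = 1 ∧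
      ∃ l : Grass 1 n, IsPlanesThroughLine C l := by
  have hξ := hI.isGenericPointOf_famPoint h.generic hs
  have hdim : topologicalKrullDim (realization (firstFocal C)) ≤ (1 : ℕ) :=
    topologicalKrullDim_le_of_genericTangent hξ (genericTangent_famPoint_le hK.ge)
  obtain ⟨l, hl⟩ := hdev.exists_linearPoints_subset
  have hX : linearPoints l.1 = realization (firstFocal C) := by
    by_contra hne
    have := (two_le_topologicalKrullDim (lt_of_le_of_ne hl hne) isClosed_closure
      hξ.isIrreducible).trans hdim
    norm_num at this
  obtain ⟨P, hP⟩ := exists_singleton_ssubset_linearPoints l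
  refine ⟨le_antisymm (by exact_mod_cast hdim) (one_le_topologicalKrullDim
    (hP.trans_le hl) le_rfl isClosed_closure hξ.isIrreducible), l, fun σ hσ q hq => ?_, hX.symm⟩
  obtain ⟨b, rfl⟩ := Frame.exists_span_eq σ
  have h1 := derivedKernel_le _ (hspan ▸ hI.algebraMap_mem l.2 hX.ge hq)
  have e1 : aevalVec β (fun j => MvPolynomial.C (q j)) = fun j => algebraMap ℂ Ω (q j) :=
    funext fun j => MvPolynomial.aeval_C _ _
  have e2 : evalVec b.coords (fun j => MvPolynomial.C (q j)) = q :=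
    funext fun j => MvPolynomial.eval_C _
  have h2 := h.generic.evalVec_mem_span hσ (κ := rowSection 2 n)
    (κ' := fun j => MvPolynomial.C (q j))
    (by simp only [evalVec_rowSection]; exact b.2)
    (by simp only [aevalVec_rowSection]; rw [e1]; exact h1)
  rw [e2] at h2
  simp only [evalVec_rowSection] at h2
  exact h2

/-- The locus of focal lines that move is a surface. -/
theorem IsGenericFrame.topologicalKrullDim_firstFocal (h : IsGenericFrame C β)
    (hdev : IsDevelopable C)
    (hI : IsLinearFamily C β (firstFocal C) fun i => aevalVec β (κ i))
    (hspan : Submodule.span Ω (Set.range fun i => aevalVec β (κ i)) = derivedKernel (rowSpan β))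
    {s : Fin 2 → Ω} (hs : IsFreeOver β s)
    (hK : derivedKernel (Submodule.span Ω (Set.range fun i => aevalVec β (κ i))) ≠
      Submodule.span Ω (Set.range fun i => aevalVec β (κ i))) :
    topologicalKrullDim (realization (firstFocal C)) = 2 := by
  have hξ := hI.isGenericPointOf_famPoint h.generic hs
  obtain ⟨l, hl⟩ := hdev.exists_linearPoints_subset
  apply le_antisymm
  · exact_mod_cast topologicalKrullDim_le_of_genericTangent (d := 2) hξ
      (genericTangent_famPoint_le hspan.le)
  · refine two_le_topologicalKrullDim (lt_of_le_of_ne hl fun hX => hK ?_) isClosed_closure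
      hξ.isIrreducible
    exact hI.derivedKernel_eq h l.2 hX.ge

/-- At general points, the tangent plane of the locus of moving focal lines is the plane of the
family, because the derivatives of the generic focal line lie in the generic plane. -/
theorem IsGenericFrame.generic_isTangentPlane (h : IsGenericFrame C β)
    (hI : IsLinearFamily C β (firstFocal C) fun i => aevalVec β (κ i))
    (hspan : Submodule.span Ω (Set.range fun i => aevalVec β (κ i)) = derivedKernel (rowSpan β))
    {s : Fin 2 → Ω} (hs : IsFreeOver β s)
    (hK : derivedKernel (Submodule.span Ω (Set.range fun i => aevalVec β (κ i))) ≠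
      Submodule.span Ω (Set.range fun i => aevalVec β (κ i))) :
    ∀ᶠ φ in genericFilter Ω, ∃ (b : Frame 2 n) (hq : (fun j => φ (famPoint β s κ j)) ≠ 0),
      b.span ∈ C ∧ b.coords = (fun ij => φ (β ij)) ∧
      (Projectivization.mk ℂ (fun j => φ (famPoint β s κ j)) hq, b.span) ∈ firstFocal C ∧
      IsTangentPlane (realization (firstFocal C))
        (Projectivization.mk ℂ (fun j => φ (famPoint β s κ j)) hq) b.span := by
  have hξ := hI.isGenericPointOf_famPoint h.generic hs
  have hT := hI.genericTangent_famPoint hs hspan.le h.finrank_rowSpan hK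
  filter_upwards [hI.generic_famPoint hs, generic_zariskiTangent_eq hξ hT]
    with φ ⟨b, hq, hbC, hb, hmem⟩ h1
  refine ⟨b, hq, hbC, hb, hmem, fst_mem_realization hmem, ?_⟩
  rw [embeddedTangent_mk, h1, Frame.span_eq_of_coords hb]
  rfl

variable {π : Fin 1 → Fin (n + 1) → MvPolynomial (Fin (2 + 1) × Fin (n + 1)) ℂ}

/-- If the second order focal point is constant, then the locus of the first order foci is a cone,
to which the planes of the family are tangent. -/
theorem IsGenericFrame.isTangentPlanesToCone (h : IsGenericFrame C β)
    (hI : IsLinearFamily C β (firstFocal C) fun i => aevalVec β (κ i))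
    (hspan : Submodule.span Ω (Set.range fun i => aevalVec β (κ i)) = derivedKernel (rowSpan β))
    {s : Fin 2 → Ω} (hs : IsFreeOver β s)
    (hK : derivedKernel (Submodule.span Ω (Set.range fun i => aevalVec β (κ i))) ≠
      Submodule.span Ω (Set.range fun i => aevalVec β (κ i)))
    (hI₂ : IsLinearFamily C β (secondFocal C) fun i => aevalVec β (π i))
    (hspan₂ : Submodule.span Ω (Set.range fun i => aevalVec β (π i)) =
      derivedKernel (Submodule.span Ω (Set.range fun i => aevalVec β (κ i))))
    {s₂ : Fin 1 → Ω} (hs₂ : IsFreeOver β s₂)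
    (hL : derivedKernel (Submodule.span Ω (Set.range fun i => aevalVec β (π i))) =
      Submodule.span Ω (Set.range fun i => aevalVec β (π i))) :
    topologicalKrullDim (realization (secondFocal C)) = 0 ∧
      ∃ P : PSpace n, IsTangentPlanesToCone C P := by
  have hξ := hI.isGenericPointOf_famPoint h.generic hs
  have hη := hI₂.isGenericPointOf_famPoint h.generic hs₂
  have hdim : topologicalKrullDim (realization (secondFocal C)) ≤ (0 : ℕ) :=
    topologicalKrullDim_le_of_genericTangent hη (genericTangent_famPoint_le hL.ge)
  obtain ⟨φ, b, hq, -, -, hmem⟩ := (hI₂.generic_famPoint hs₂).exists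
  generalize (fun j => φ (famPoint β s₂ π j)) = p at hq hmem
  let P := Projectivization.mk ℂ p hq
  have hPD : P ∈ realization (secondFocal C) := fst_mem_realization hmem
  have hD : {P} = realization (secondFocal C) := by
    by_contra hne
    have := (one_le_topologicalKrullDim (lt_of_le_of_ne (Set.singleton_subset_iff.2 hPD) hne) le_rfl
      isClosed_closure hη.isIrreducible).trans hdim
    norm_num at this
  -- the vertex is a constant point of the generic focal line
  have hp : (fun j => algebraMap ℂ Ω (p j)) ∈
      Submodule.span Ω (Set.range fun i => aevalVec β (κ i)) := by
    refine derivedKernel_le _ (hspan₂ ▸ hI₂.algebraMap_mem (S := P.submodule)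
      (Projectivization.finrank_submodule P) ?_ ?_)
    · rw [linearPoints_submodule]
      exact hD.ge
    · rw [Projectivization.submodule_mk]
      exact Submodule.mem_span_singleton_self p
  have hgen := h.generic_isTangentPlane hI hspan hs hK
  refine ⟨le_antisymm (by exact_mod_cast hdim) (zero_le_topologicalKrullDim hPD), P,
    ⟨isClosed_closure, hξ.isIrreducible, ?_, ?_⟩, hD.symm, ?_, ?_⟩
  · have h1 : P ∈ focalLocus (firstFocal C) b.span := by
      rw [show focalLocus (firstFocal C) b.span = {P} from hmem.2.2]
      exact Set.mem_singleton _
    exact fst_mem_realization h1.1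
  · intro Q hQ R hR
    induction Q using Projectivization.ind with
    | h q hq0 =>
    induction R using Projectivization.ind with
    | h u hu =>
    rw [linearPoints_mk, Projectivization.submodule_mk, Projectivization.submodule_mk,
      Submodule.mem_sup] at hR
    obtain ⟨_, h1, _, h2, rfl⟩ := hR
    obtain ⟨x, rfl⟩ := Submodule.mem_span_singleton.1 h1
    obtain ⟨y, rfl⟩ := Submodule.mem_span_singleton.1 h2
    refine (mk_mem_iff_of_isClosed isClosed_closure hu).2 fun F hF => ?_
    -- the polynomial `F(x p + y Z)` in `Z` vanishes at the generic point of `X`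
    let g : Fin (n + 1) → MvPolynomial (Fin (n + 1)) ℂ := fun j =>
      MvPolynomial.C (x * p j) + MvPolynomial.C y * MvPolynomial.X j
    have h3 : MvPolynomial.aeval (famPoint β s κ) (MvPolynomial.bind₁ g F) = 0 := by
      rw [MvPolynomial.aeval_bind₁]
      refine hs.aeval_eq_zero_of_mem_span ((hξ F).1 hF) ?_
      have : (fun j => MvPolynomial.aeval (famPoint β s κ) (g j)) =
          algebraMap ℂ Ω x • (fun j => algebraMap ℂ Ω (p j)) +
            algebraMap ℂ Ω y • famPoint β s κ := by
        funext j
        simp [g, Algebra.smul_def]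
      rw [this]
      exact Submodule.add_mem _ (Submodule.smul_mem _ _ hp)
        (Submodule.smul_mem _ _ (famPoint_mem s))
    have h4 := hξ.eval_eq_zero ⟨hq0, hQ⟩ _ h3
    rw [eval_bind₁] at h4
    have h5 : (fun j => MvPolynomial.eval q (g j)) = x • p + y • q := by
      funext j
      simp [g]
    rwa [h5] at h4
  · refine h.generic.general_grass ?_
    filter_upwards [hgen] with φ ⟨b, hq, _, hb, hmem, htan⟩
    exact ⟨b, hb, _, hmem, htan⟩
  · refine hξ.general_projective ?_
    filter_upwards [hgen] with φ ⟨b, hq, hbC, _, hmem, htan⟩ _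
    exact ⟨b.span, hbC, hmem, htan⟩

/-- If the second order focal point moves, then it describes a curve, whose osculating planes are
the planes of the family: if `η` is the generic second order focal point and `δ` a derivation that
moves the generic plane, then `η, δη` span the generic focal line and `η, δη, δ²η` span the generic
plane. -/
theorem IsGenericFrame.isOsculatingPlanes (h : IsGenericFrame C β)
    (hI : IsLinearFamily C β (firstFocal C) fun i => aevalVec β (κ i))
    (hspan : Submodule.span Ω (Set.range fun i => aevalVec β (κ i)) = derivedKernel (rowSpan β))
    (hK : derivedKernel (Submodule.span Ω (Set.range fun i => aevalVec β (κ i))) ≠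
      Submodule.span Ω (Set.range fun i => aevalVec β (κ i)))
    (hI₂ : IsLinearFamily C β (secondFocal C) fun i => aevalVec β (π i))
    (hspan₂ : Submodule.span Ω (Set.range fun i => aevalVec β (π i)) =
      derivedKernel (Submodule.span Ω (Set.range fun i => aevalVec β (κ i))))
    {s₂ : Fin 1 → Ω} (hs₂ : IsFreeOver β s₂)
    (hL : derivedKernel (Submodule.span Ω (Set.range fun i => aevalVec β (π i))) ≠
      Submodule.span Ω (Set.range fun i => aevalVec β (π i))) :
    topologicalKrullDim (realization (secondFocal C)) = 1 ∧
      ∃ D : Set (PSpace n), IsOsculatingPlanes C D := by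
  have hη := hI₂.isGenericPointOf_famPoint h.generic hs₂
  have hKfin : Module.finrank Ω (Submodule.span Ω (Set.range fun i => aevalVec β (κ i))) = 2 := by
    rw [finrank_span_eq_card hI.linearIndependent, Fintype.card_fin]
  have hT := hI₂.genericTangent_famPoint hs₂ hspan₂.le hKfin hL
  set K := Submodule.span Ω (Set.range fun i => aevalVec β (κ i)) with hKdef
  set L := Submodule.span Ω (Set.range fun i => aevalVec β (π i)) with hLdef
  set η := famPoint β s₂ π with hηdef
  have hdim : topologicalKrullDim (realization (secondFocal C)) = 1 := by
    apply le_antisymm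
    · exact_mod_cast topologicalKrullDim_le_of_genericTangent (d := 1) hη hT.le
    · obtain ⟨φ, b, hq, -, -, hmem⟩ := (hI₂.generic_famPoint hs₂).exists
      refine one_le_topologicalKrullDim (lt_of_le_of_ne
        (Set.singleton_subset_iff.2 (fst_mem_realization hmem)) fun hD => hL ?_) le_rfl
        isClosed_closure hη.isIrreducible
      refine hI₂.derivedKernel_eq h (Projectivization.finrank_submodule
        (Projectivization.mk ℂ _ hq)) ?_
      rw [linearPoints_submodule]
      exact hD.ge
  obtain ⟨δ, i₀, hδ⟩ := h.exists_derivation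
  have hδv : ¬ IsVertical β δ := fun hv => hδ (hv i₀)
  have hη0 : η ≠ 0 := hI₂.famPoint_ne_zero hs₂
  have hηL : η ∈ L := famPoint_mem s₂
  have hLspan : L = Submodule.span Ω {η} := by
    symm
    apply Submodule.eq_of_le_of_finrank_le
    · rwa [Submodule.span_singleton_le_iff_mem]
    · rw [finrank_span_singleton hη0, finrank_span_eq_card hI₂.linearIndependent, Fintype.card_fin]
  have hηK : η ∈ derivedKernel K := hspan₂ ▸ hηL
  have hδη : dVec δ η ∈ K := hηK.2 δ
  have hδηL : dVec δ η ∉ Submodule.span Ω {η} := by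
    intro hmem
    apply hL
    refine le_antisymm (derivedKernel_le _) ?_
    rw [← hLspan] at hmem
    have : η ∈ derivedKernel L := (h.mem_derivedKernel_iff hI₂.stable hδv).2 ⟨hηL, hmem⟩
    conv_lhs => rw [hLspan]
    rwa [Submodule.span_singleton_le_iff_mem]
  have hli2 : LinearIndependent Ω ![dVec δ η, η] := by
    rw [Matrix.vecCons, linearIndependent_finCons]
    refine ⟨?_, by simpa using hδηL⟩
    exact LinearIndependent.of_subsingleton 0 hη0
  have hKspan : Submodule.span Ω (Set.range ![dVec δ η, η]) = K := by
    apply Submodule.eq_of_le_of_finrank_le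
    · rw [Submodule.span_le]
      rintro _ ⟨i, rfl⟩
      fin_cases i
      exacts [hδη, hηK.1]
    · rw [hKfin, finrank_span_eq_card hli2, Fintype.card_fin]
  -- otherwise `K`, which is spanned by `η` and `δη`, would be stable under `δ`
  have hδδη : dVec δ (dVec δ η) ∉ K := by
    intro hmem
    apply hK
    refine le_antisymm (derivedKernel_le _) ?_
    conv_lhs => rw [← hKspan]
    rw [Submodule.span_le]
    rintro _ ⟨i, rfl⟩
    fin_cases i
    exacts [(h.mem_derivedKernel_iff hI.stable hδv).2 ⟨hδη, hmem⟩, hηK]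
  have h2 : (2 : Ω) ≠ 0 := by
    have : CharZero Ω := charZero_of_injective_algebraMap (algebraMap ℂ Ω).injective
    exact two_ne_zero
  -- the coefficient of order `2` of the Taylor polynomial of `η` along `δ`
  let η₂ : Fin (n + 1) → Ω := fun j => δ (δ (η j)) / 2
  have hη₂ : (2 : Ω) • η₂ = dVec δ (dVec δ η) := by
    funext j
    simp [η₂, dVec, mul_div_cancel₀ _ h2]
  have hη₂K : η₂ ∉ K := fun hmem => hδδη (hη₂ ▸ K.smul_mem 2 hmem)
  have hη₂W : η₂ ∈ rowSpan β := by
    rw [← Submodule.smul_mem_iff _ h2, hη₂]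
    exact (hspan ▸ hδη : dVec δ η ∈ derivedKernel (rowSpan β)).2 δ
  have hKW : K ≤ rowSpan β := hspan.trans_le (derivedKernel_le _)
  have hli3 : LinearIndependent Ω (Fin.cons η₂ ![dVec δ η, η] : Fin 3 → Fin (n + 1) → Ω) :=
    linearIndependent_finCons.2 ⟨hli2, by rwa [hKspan]⟩
  have hWspan : Submodule.span Ω (Set.range (Fin.cons η₂ ![dVec δ η, η] :
      Fin 3 → Fin (n + 1) → Ω)) = Submodule.span Ω (Set.range (matRow β)) := by
    refine span_eq_of_linearIndependent hli3 fun i => ?_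
    fin_cases i
    exacts [hη₂W, hKW hδη, hKW hηK.1]
  have hgen : ∀ᶠ φ in genericFilter Ω, ∃ (b : Frame 2 n) (hq : (fun j => φ (η j)) ≠ 0),
      b.span ∈ C ∧ b.coords = (fun ij => φ (β ij)) ∧
      (Projectivization.mk ℂ (fun j => φ (η j)) hq, b.span) ∈ secondFocal C ∧
      IsOsculatingPlane (realization (secondFocal C))
        (Projectivization.mk ℂ (fun j => φ (η j)) hq) b.span := by
    filter_upwards [hI₂.generic_famPoint hs₂, generic_zariskiTangent_eq hη hT,
      generic_linearIndependent hI.linearIndependent, generic_span_eq hWspan,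
      generic_X_pow_three_dvd δ η] with φ ⟨b, hq, hbC, hb, hmem⟩ h1 h2 h3 h4
    refine ⟨b, hq, hbC, hb, hmem, fst_mem_realization hmem, ?_, fun j => φ (η j),
      fun j => φ (δ (η j)), fun j => φ (δ (δ (η j)) / 2), hq, rfl, fun F hF => ?_, ?_⟩
    · rw [embeddedTangent_mk, h1, finrank_span_eq_card h2, Fintype.card_fin]
    · exact h4 F ((hη F).1 hF)
    · rw [Frame.span_eq_of_coords hb]
      refine Eq.trans ?_ h3
      congr 1
      ext y
      constructor
      · rintro (rfl | rfl | rfl)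
        exacts [⟨2, rfl⟩, ⟨1, rfl⟩, ⟨0, rfl⟩]
      · rintro ⟨i, rfl⟩
        fin_cases i
        exacts [Or.inr (Or.inr rfl), Or.inr (Or.inl rfl), Or.inl rfl]
  refine ⟨hdim, _, isClosed_closure, hη.isIrreducible, rfl, ?_, ?_⟩
  · refine h.generic.general_grass ?_
    filter_upwards [hgen] with φ ⟨b, hq, _, hb, hmem, hosc⟩
    exact ⟨b, hb, _, hmem, hosc⟩
  · refine hη.general_projective ?_
    filter_upwards [hgen] with φ ⟨b, hq, hbC, _, hmem, hosc⟩ _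
    exact ⟨b.span, hbC, hmem, hosc⟩

end Classification

end

theorem mainTheorem2 (n : ℕ) (C : Set (Grass 2 n)) (hC : IsSmoothCurve C)
    (hdev : IsDevelopable C) :
    (topologicalKrullDim (realization (firstFocal C)) = 1 ∧
      ∃ l : Grass 1 n, IsPlanesThroughLine C l) ∨
    (topologicalKrullDim (realization (firstFocal C)) = 2 ∧
      topologicalKrullDim (realization (secondFocal C)) = 0 ∧
      ∃ P : PSpace n, IsTangentPlanesToCone C P) ∨
    (topologicalKrullDim (realization (firstFocal C)) = 2 ∧
      topologicalKrullDim (realization (secondFocal C)) = 1 ∧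
      ∃ D : Set (PSpace n), IsOsculatingPlanes C D) := by
  obtain ⟨Ω, _, _, β, s, h, hs⟩ := hC.exists_isGenericFrame (Fin 2)
  obtain ⟨k, -, hk⟩ := (derivedKernel (rowSpan β)).exists_basis_fin (h.finrank_derivedKernel hdev)
  obtain ⟨κ, hκk, hI⟩ := (h.isLinearFamily_firstFocal hdev hk).exists_polynomial_basis h
  have hspan := hκk.trans hk
  by_cases hK : derivedKernel (Submodule.span Ω (Set.range fun i => aevalVec β (κ i))) =
      Submodule.span Ω (Set.range fun i => aevalVec β (κ i))
  · exact Or.inl (h.isPlanesThroughLine hdev hI hspan hs hK)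
  refine Or.inr ?_
  have hdim := h.topologicalKrullDim_firstFocal hdev hI hspan hs hK
  have hfin := h.finrank_derivedKernel_derivedKernel hI hspan hK
  obtain ⟨p, -, hp⟩ := Submodule.exists_basis_fin _ hfin
  obtain ⟨π, hπp, hI₂⟩ :=
    (h.isLinearFamily_secondFocal hdev hI rfl hspan hfin hp).exists_polynomial_basis h
  have hspan₂ := hπp.trans hp
  have hs₂ : IsFreeOver β (s ∘ fun _ : Fin 1 => (0 : Fin 2)) :=
    hs.comp (Function.injective_of_subsingleton _)
  by_cases hL : derivedKernel (Submodule.span Ω (Set.range fun i => aevalVec β (π i))) =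
      Submodule.span Ω (Set.range fun i => aevalVec β (π i))
  · exact Or.inl ⟨hdim, h.isTangentPlanesToCone hI hspan hs hK hI₂ hspan₂ hs₂ hL⟩
  · exact Or.inr ⟨hdim, h.isOsculatingPlanes hI hspan hK hI₂ hspan₂ hs₂ hL⟩
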